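/- Consider the equations of class $\mathcal Q^+$ for $u:\mathbb Z^2\to\mathbb R$, $$\begin{aligned}\mathcal Q^+ ={}& a_1(u_{n,m}+u_{n+1,m+1})+a_2(u_{n+1,m}+u_{n,m+1})+(\alpha_1-\alpha_2)u_{n,m}u_{n+1,m}+(\alpha_1+\alpha_2)u_{n,m+1}u_{n+1,m+1}\\&+(\beta_1-\beta_2)u_{n,m}u_{n,m+1}+(\beta_1+\beta_2)u_{n+1,m}u_{n+1,m+1}+\gamma_1u_{n,m}u_{n+1,m+1}+\gamma_2u_{n+1,m}u_{n,m+1}\\&+(\xi_1-\xi_3)u_{n,m}u_{n+1,m}u_{n,m+1}+(\xi_1+\xi_3)u_{n,m}u_{n+1,m}u_{n+1,m+1}\\&+(\xi_2-\xi_4)u_{n+1,m}u_{n,m+1}u_{n+1,m+1}+(\xi_2+\xi_4)u_{n,m}u_{n,m+1}u_{n+1,m+1}\\&+\zeta u_{n,m}u_{n+1,m}u_{n,m+1}u_{n+1,m+1}=0,\end{aligned}$$ with 13 real coefficients such that $a_1\ne0$, $a_2\ne0$, $|a_1|\neq|a_2|$. For $\kappa\in\mathbb R$ let $K=e^{i\kappa}$,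 $\Omega=e^{-i\omega}$, where the real dispersion relation $\omega=\omega(\kappa)$ is a differentiable function with $a_1(1+K\Omega)+a_2(K+\Omega)=0$ for all $\kappa$ (such functions exist). Call $\kappa$ non-resonant if $a_1(1+K^2\Omega^2)+a_2(K^2+\Omega^2)\neq0$. Insert the formal multiscale expansion $$u_{n,m}=\sum_{\ell\ge1}\varepsilon^{\ell}\sum_{|\alpha|\le\ell}K^{\alpha n}\Omega^{\alpha m}u_\ell^{(\alpha)}(n_1,m_1,m_2),\qquad u_\ell^{(-\alpha)}=\overline{u_\ell^{(\alpha)}},\quad n_1=\varepsilon n,\ m_1=\varepsilon m,\ m_2=\varepsilon^2m,$$ with smooth amplitudes $u_\ell^{(\alpha)}$, whose shifts are Taylor expanded in $\varepsilon$ (further slow times $m_j=\varepsilon^jm$, $j\ge3$, do not enter up to order $\varepsilon^3$), and let $W_j^{(\alpha)}$ be the coefficient of $\varepsilon^jK^{\alpha n}\Omega^{\alpha m}$ in $\mathcal Q^+$. (A) For every non-resonant $\kappa$ the order $\varepsilon^3$ is a nonlinear Schrödinger equation: there is exactly one pair $(\rho_1,\rho_2)\in\mathbb C^2$ for which there is a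 constant $\lambda\neq0$ such that, whenever $W_1^{(\alpha)}=W_2^{(\alpha)}=0$ for all $\alpha$ and $u_2^{(1)}$ depends on $n_1,m_1$ only through $\xi=n_1-\omega'(\kappa)m_1$, then $u_1^{(1)}=\varphi(\xi,m_2)$ for some function $\varphi$ and $$W_3^{(1)}=\lambda\left(i\,\partial_{m_2}\varphi+\rho_1\,\partial_\xi^2\varphi+\rho_2\,\varphi|\varphi|^2\right).$$ Here $\rho_1=a_1a_2(a_1^2-a_2^2)\sin\kappa/(a_1^2+a_2^2+2a_1a_2\cos\kappa)^2$ is real. Moreover, if all amplitudes are bounded and $W_1^{(\alpha)}=W_2^{(\alpha)}=0$ for all $\alpha$ and $W_3^{(1)}=0$, then $u_2^{(1)}$ depends on $n_1,m_1$ only through $\xi$, and $u_1^{(1)}=\varphi(\xi,m_2)$ where $i\partial_{m_2}\varphi+\rho_1\partial_\xi^2\varphi+\rho_2\varphi|\varphi|^2=0$. (B) $\rho_2$ is real for all non-resonant $\kappa$ if and only if the coefficients satisfy at least one of the following sets of conditions. * Case 1: $\alpha_2=\beta_2=0$, $\xi_1=\xi_2$, $\xi_3=\xi_4$. * Case 2: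 $\alpha_2=\beta_2$, $\alpha_1=\beta_1$, $a_1=2a_2$, $\gamma_1=2\gamma_2$, $a_1(\xi_1-\xi_2)=-a_1(\xi_3-\xi_4)=-2\alpha_2\gamma_2$. * Case 3: $\alpha_2=-\beta_2$, $\alpha_1=\beta_1$, $a_2=2a_1$, $\gamma_2=2\gamma_1$, $a_1(\xi_1-\xi_2)=a_1(\xi_3-\xi_4)=-\alpha_2\gamma_1$. * Case 4: $a_2\alpha_1=a_2\beta_1=\tfrac12(a_1+a_2)\gamma_2$, $a_2\gamma_1=a_1\gamma_2$, $a_1(\xi_1-\xi_2)=-\alpha_2\gamma_1$, $a_1(\xi_3-\xi_4)=\beta_2\gamma_1$. * Case 5: $(a_2-a_1)\beta_2=(a_2+a_1)\alpha_2$, $2a_1a_2(a_1-a_2)\alpha_1=(a_1+a_2)(\gamma_2a_1^2-\gamma_1a_2^2)$, $2a_1a_2\beta_1=\gamma_1a_2^2+\gamma_2a_1^2$, $(a_2-a_1)(\xi_1-\xi_2)=(\gamma_1-\gamma_2)\alpha_2$, $(a_2-a_1)^2(\xi_3-\xi_4)=[\gamma_2(a_2-3a_1)-\gamma_1(a_1-3a_2)]\alpha_2$.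 * Case 6: $(a_2+a_1)\beta_2=(a_2-a_1)\alpha_2$, $2a_1a_2\alpha_1=\gamma_1a_2^2+\gamma_2a_1^2$, $2a_1a_2(a_1-a_2)\beta_1=(a_1+a_2)(\gamma_2a_1^2-\gamma_1a_2^2)$, $(a_2^2-a_1^2)(\xi_1-\xi_2)=[\gamma_1(a_1-3a_2)-\gamma_2(a_2-3a_1)]\alpha_2$, $(a_1+a_2)(\xi_3-\xi_4)=(\gamma_2-\gamma_1)\alpha_2$. (C) The six subclasses have $9,7,7,8,8,8$ free parameters, respectively: that many of the 13 coefficients range freely over a nonempty open set, and the remaining ones are smooth functions of them. (D) For real $C$ and $D\neq0$ the substitution $u\mapsto u/(Cu+D)$ at all four lattice points, followed by multiplication by the product of the four denominators $Cu+D$, maps every equation of the above form to exactly one equation of this form (with new coefficients), and each of the six subclasses (with $a_1,a_2\neq0$, $|a_1|\ne|a_2|$) is invariant: an equation belongs to it if and only if its image does. -/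

import Mathlib

noncomputable section

namespace Multiscale

/-- The names of the 13 coefficients of the multilinear equation. -/
inductive Param
  | a₁ | a₂ | α₁ | α₂ | β₁ | β₂ | γ₁ | γ₂ | ξ₁ | ξ₂ | ξ₃ | ξ₄ | ζ
  deriving DecidableEq

instance : Fintype Param :=
  ⟨{.a₁, .a₂, .α₁, .α₂, .β₁, .β₂, .γ₁, .γ₂, .ξ₁, .ξ₂, .ξ₃, .ξ₄, .ζ}, by intro x; cases x <;> decide⟩

/-- An equation of the class `Q⁺`, given by its 13 real coefficients. -/
abbrev QPlus := Param → ℝ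

/-- The left-hand side of the equation, with values in any commutative real algebra; the arguments
stand for `u_{n,m}`, `u_{n+1,m}`, `u_{n,m+1}`, `u_{n+1,m+1}`. -/
def QPlus.lhs (c : QPlus) {A : Type*} [CommRing A] [Algebra ℝ A] (u₀₀ u₁₀ u₀₁ u₁₁ : A) : A :=
  c .a₁ • (u₀₀ + u₁₁) + c .a₂ • (u₁₀ + u₀₁)
    + (c .α₁ - c .α₂) • (u₀₀ * u₁₀) + (c .α₁ + c .α₂) • (u₀₁ * u₁₁)
    + (c .β₁ - c .β₂) • (u₀₀ * u₀₁) + (c .β₁ + c .β₂) • (u₁₀ * u₁₁)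
    + c .γ₁ • (u₀₀ * u₁₁) + c .γ₂ • (u₁₀ * u₀₁)
    + (c .ξ₁ - c .ξ₃) • (u₀₀ * u₁₀ * u₀₁) + (c .ξ₁ + c .ξ₃) • (u₀₀ * u₁₀ * u₁₁)
    + (c .ξ₂ - c .ξ₄) • (u₁₀ * u₀₁ * u₁₁) + (c .ξ₂ + c .ξ₄) • (u₀₀ * u₀₁ * u₁₁)
    + c .ζ • (u₀₀ * u₁₀ * u₀₁ * u₁₁)

/-- The standing assumption on the linear part. -/
def QPlus.IsDispersive (c : QPlus) : Prop :=
  c .a₁ ≠ 0 ∧ c .a₂ ≠ 0 ∧ |c .a₁| ≠ |c .a₂|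

/-! ### Dispersion relation -/

/-- `K = e^{iκ}` -/
def bigK (κ : ℝ) : ℂ := Complex.exp (Complex.I * κ)

/-- `Ω = e^{-iω}` -/
def bigOmega (w : ℝ) : ℂ := Complex.exp (-(Complex.I * w))

/-- The value of the linear part of the equation on `z^n y^m`, divided by `z^n y^m`. -/
def QPlus.symbol (c : QPlus) (z y : ℂ) : ℂ := c .a₁ * (1 + z * y) + c .a₂ * (z + y)

/-- `ω` is a (differentiable, real) dispersion relation: for every wave number `κ` the plane wave
`e^{i(κ n - ω(κ) m)}` solves the linear part of the equation. -/
def QPlus.IsDispersionRelation (c : QPlus) (ω : ℝ → ℝ) : Prop :=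
  Differentiable ℝ ω ∧ ∀ κ, c.symbol (bigK κ) (bigOmega (ω κ)) = 0

/-- The second harmonic `e^{2i(κ n - ω m)}` does not solve the linear part, so that the second
harmonic amplitude is determined by the first one. -/
def QPlus.NonResonant (c : QPlus) (ω : ℝ → ℝ) (κ : ℝ) : Prop :=
  c.symbol (bigK κ ^ 2) (bigOmega (ω κ) ^ 2) ≠ 0

/-! ### The multiscale expansion -/

/-- Complex functions of the slow variables `n₁ = ε n`, `m₁ = ε m`, `m₂ = ε² m`. (The slow times
`m_j` with `j ≥ 3` do not enter the expansion of the equation up to order `ε³`.) -/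
abbrev Slow := ℝ → ℝ → ℝ → ℂ

def dn₁ (f : Slow) : Slow := fun n₁ m₁ m₂ => deriv (fun s => f s m₁ m₂) n₁
def dm₁ (f : Slow) : Slow := fun n₁ m₁ m₂ => deriv (fun s => f n₁ s m₂) m₁
def dm₂ (f : Slow) : Slow := fun n₁ m₁ m₂ => deriv (fun s => f n₁ m₁ s) m₂

/-- `∇ = ∂_{m₁} + ∂_{n₁}` -/
def nabla (f : Slow) : Slow := dm₁ f + dn₁ f

/-- The operators giving the coefficient of `ε^i` in the Taylor expansion of the four fields
`f(n₁, m₁, m₂)`, `f(n₁ + ε, m₁, m₂)`, `f(n₁, m₁ + ε, m₂ + ε²)`, `f(n₁ + ε, m₁ + ε, m₂ + ε²)`. -/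
def opId (i : ℕ) (f : Slow) : Slow := if i = 0 then f else 0

def opA (i : ℕ) (f : Slow) : Slow := (1 / (i.factorial : ℝ)) • dn₁^[i] f

def opB (i : ℕ) (f : Slow) : Slow :=
  ∑ q ∈ Finset.range (i / 2 + 1),
    (1 / ((i - 2 * q).factorial * q.factorial : ℝ)) • dm₁^[i - 2 * q] (dm₂^[q] f)

def opC (i : ℕ) (f : Slow) : Slow :=
  ∑ q ∈ Finset.range (i / 2 + 1),
    (1 / ((i - 2 * q).factorial * q.factorial : ℝ)) • nabla^[i - 2 * q] (dm₂^[q] f)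

/-- Amplitudes: `u ℓ α` is the amplitude `u_ℓ^{(α)}` of the `α`-th harmonic at order `ε^ℓ`;
only those with `1 ≤ ℓ` and `|α| ≤ ℓ` occur in the expansion. -/
abbrev Amplitudes := ℕ → ℤ → Slow

/-- Smooth amplitudes of a real field. -/
def Amplitudes.Admissible (u : Amplitudes) : Prop :=
  (∀ ℓ α, ContDiff ℝ ((⊤ : ℕ∞) : WithTop ℕ∞)
    (fun p : ℝ × ℝ × ℝ => u ℓ α p.1 p.2.1 p.2.2)) ∧
  ∀ ℓ α n₁ m₁ m₂, u ℓ (-α) n₁ m₁ m₂ = (starRingEnd ℂ) (u ℓ α n₁ m₁ m₂)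

def Amplitudes.Bounded (u : Amplitudes) : Prop :=
  ∀ ℓ α, ∃ M : ℝ, ∀ n₁ m₁ m₂, ‖u ℓ α n₁ m₁ m₂‖ ≤ M

/-- Formal expansions: power series in `ε` whose coefficients are Laurent polynomials in the
carrier harmonic `T = K^n Ω^m`, with functions of the slow variables as coefficients. -/
abbrev Expansion := PowerSeries (LaurentPolynomial Slow)

/-- The expansion of a (shifted) field
`∑_r ε^r ∑_{|α| ≤ r} z^α K^{αn} Ω^{αm} ∑_{max(1,|α|) ≤ j ≤ r} op_{r-j} u_j^{(α)}`,
where `z` is the phase factor and `op` the family of slow operators of the shift. -/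
def expand (z : ℂ) (op : ℕ → Slow → Slow) (u : Amplitudes) : Expansion :=
  PowerSeries.mk fun r =>
    ∑ α ∈ Finset.Icc (-(r : ℤ)) r,
      LaurentPolynomial.C
          (z ^ α • ∑ j ∈ Finset.Icc (max 1 α.natAbs) r, op (r - j) (u j α)) *
        LaurentPolynomial.T α

/-- The amplitude `W_j^{(α)}` of `ε^j K^{αn} Ω^{αm}` in the expanded equation, for the carrier
wave with wave number `κ` and frequency `w`. -/
def QPlus.W (c : QPlus) (κ w : ℝ) (u : Amplitudes) (j : ℕ) (α : ℤ) : Slow :=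
  (PowerSeries.coeff j
    (c.lhs (expand 1 opId u) (expand (bigK κ) opA u) (expand (bigOmega w) opB u)
      (expand (bigK κ * bigOmega w) opC u) : Expansion)).coeff α

/-- `f` depends on `n₁, m₁` only through `ξ = n₁ - v m₁`, with profile `φ(ξ, m₂)`. -/
def HasProfile (v : ℝ) (f : Slow) (φ : ℝ → ℝ → ℂ) : Prop :=
  ∀ n₁ m₁ m₂, f n₁ m₁ m₂ = φ (n₁ - v * m₁) m₂

/-- The nonlinear Schrödinger expression `i φ_{m₂} + ρ₁ φ_{ξξ} + ρ₂ φ |φ|²`. -/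
def nls (ρ₁ ρ₂ : ℂ) (φ : ℝ → ℝ → ℂ) (x t : ℝ) : ℂ :=
  Complex.I * deriv (fun s => φ x s) t + ρ₁ * iteratedDeriv 2 (fun y => φ y t) x
    + ρ₂ * (φ x t * ((‖φ x t‖ ^ 2 : ℝ) : ℂ))

/-- At wave number `κ` the order `ε³` of the expansion is the NLS equation with coefficients
`ρ₁, ρ₂`: once the orders `ε` and `ε²` are satisfied and `u_2^{(1)}` depends on `n₁, m₁` through
`ξ = n₁ - ω'(κ) m₁`, the amplitude `u_1^{(1)}` is a function `φ(ξ, m₂)` and `W_3^{(1)}` is the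
NLS expression in `φ`, up to a nonzero constant factor. -/
def QPlus.ReducesToNLS (c : QPlus) (ω : ℝ → ℝ) (κ : ℝ) (ρ₁ ρ₂ : ℂ) : Prop :=
  ∃ lam : ℂ, lam ≠ 0 ∧ ∀ u : Amplitudes, u.Admissible →
    (∀ α, c.W κ (ω κ) u 1 α = 0) → (∀ α, c.W κ (ω κ) u 2 α = 0) →
    (∃ ψ, HasProfile (deriv ω κ) (u 2 1) ψ) →
    ∃ φ, HasProfile (deriv ω κ) (u 1 1) φ ∧
      ∀ n₁ m₁ m₂, c.W κ (ω κ) u 3 1 n₁ m₁ m₂ = lam * nls ρ₁ ρ₂ φ (n₁ - deriv ω κ * m₁) m₂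

/-! ### The six families -/

def QPlus.Case1 (c : QPlus) : Prop :=
  c .α₂ = 0 ∧ c .β₂ = 0 ∧ c .ξ₁ = c .ξ₂ ∧ c .ξ₃ = c .ξ₄

def QPlus.Case2 (c : QPlus) : Prop :=
  c .α₂ = c .β₂ ∧ c .α₁ = c .β₁ ∧ c .a₁ = 2 * c .a₂ ∧ c .γ₁ = 2 * c .γ₂ ∧
  c .a₁ * (c .ξ₁ - c .ξ₂) = -2 * c .α₂ * c .γ₂ ∧
  -c .a₁ * (c .ξ₃ - c .ξ₄) = -2 * c .α₂ * c .γ₂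

def QPlus.Case3 (c : QPlus) : Prop :=
  c .α₂ = -c .β₂ ∧ c .α₁ = c .β₁ ∧ c .a₂ = 2 * c .a₁ ∧ c .γ₂ = 2 * c .γ₁ ∧
  c .a₁ * (c .ξ₁ - c .ξ₂) = -c .α₂ * c .γ₁ ∧
  c .a₁ * (c .ξ₃ - c .ξ₄) = -c .α₂ * c .γ₁

def QPlus.Case4 (c : QPlus) : Prop :=
  c .a₂ * c .α₁ = 1 / 2 * (c .a₁ + c .a₂) * c .γ₂ ∧
  c .a₂ * c .β₁ = 1 / 2 * (c .a₁ + c .a₂) * c .γ₂ ∧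
  c .a₂ * c .γ₁ = c .a₁ * c .γ₂ ∧
  c .a₁ * (c .ξ₁ - c .ξ₂) = -c .α₂ * c .γ₁ ∧
  c .a₁ * (c .ξ₃ - c .ξ₄) = c .β₂ * c .γ₁

def QPlus.Case5 (c : QPlus) : Prop :=
  (c .a₂ - c .a₁) * c .β₂ = (c .a₂ + c .a₁) * c .α₂ ∧
  2 * c .a₁ * c .a₂ * (c .a₁ - c .a₂) * c .α₁ =
    (c .a₁ + c .a₂) * (c .γ₂ * c .a₁ ^ 2 - c .γ₁ * c .a₂ ^ 2) ∧
  2 * c .a₁ * c .a₂ * c .β₁ = c .γ₁ * c .a₂ ^ 2 + c .γ₂ * c .a₁ ^ 2 ∧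
  (c .a₂ - c .a₁) * (c .ξ₁ - c .ξ₂) = (c .γ₁ - c .γ₂) * c .α₂ ∧
  (c .a₂ - c .a₁) ^ 2 * (c .ξ₃ - c .ξ₄) =
    (c .γ₂ * (c .a₂ - 3 * c .a₁) - c .γ₁ * (c .a₁ - 3 * c .a₂)) * c .α₂

def QPlus.Case6 (c : QPlus) : Prop :=
  (c .a₂ + c .a₁) * c .β₂ = (c .a₂ - c .a₁) * c .α₂ ∧
  2 * c .a₁ * c .a₂ * c .α₁ = c .γ₁ * c .a₂ ^ 2 + c .γ₂ * c .a₁ ^ 2 ∧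
  2 * c .a₁ * c .a₂ * (c .a₁ - c .a₂) * c .β₁ =
    (c .a₁ + c .a₂) * (c .γ₂ * c .a₁ ^ 2 - c .γ₁ * c .a₂ ^ 2) ∧
  (c .a₂ ^ 2 - c .a₁ ^ 2) * (c .ξ₁ - c .ξ₂) =
    (c .γ₁ * (c .a₁ - 3 * c .a₂) - c .γ₂ * (c .a₂ - 3 * c .a₁)) * c .α₂ ∧
  (c .a₁ + c .a₂) * (c .ξ₃ - c .ξ₄) = (c .γ₂ - c .γ₁) * c .α₂

/-- The six subclasses of dispersive equations. -/
def family : Fin 6 → Set QPlus :=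
  ![{c | c.IsDispersive ∧ c.Case1}, {c | c.IsDispersive ∧ c.Case2},
    {c | c.IsDispersive ∧ c.Case3}, {c | c.IsDispersive ∧ c.Case4},
    {c | c.IsDispersive ∧ c.Case5}, {c | c.IsDispersive ∧ c.Case6}]

/-- The numbers of free parameters of the six subclasses. -/
def numFree : Fin 6 → ℕ := ![9, 7, 7, 8, 8, 8]

/-- `S` has `N` free parameters: `N` of the 13 coefficients range freely over a nonempty open set
`U` of `ℝ^N`, and the other coefficients are smooth functions of them. -/
def HasFreeParameters (S : Set QPlus) (N : ℕ) : Prop :=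
  ∃ J : Finset Param, J.card = N ∧ ∃ U : Set (J → ℝ), IsOpen U ∧ U.Nonempty ∧
    ∃ g : (J → ℝ) → QPlus, ContDiffOn ℝ ((⊤ : ℕ∞) : WithTop ℕ∞) g U ∧
      (∀ p ∈ U, ∀ j : J, g p j = p j) ∧ S = g '' U

/-! ### Restricted Möbius transformations -/

/-- `c'` arises from `c` by the substitution `u ↦ u / (C u + D)` at all four lattice points,
after clearing denominators. -/
def IsMobiusImage (C D : ℝ) (c c' : QPlus) : Prop :=
  ∀ x y z w : ℝ, C * x + D ≠ 0 → C * y + D ≠ 0 → C * z + D ≠ 0 → C * w + D ≠ 0 →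
    c'.lhs x y z w =
      (C * x + D) * (C * y + D) * (C * z + D) * (C * w + D) *
        c.lhs (x / (C * x + D)) (y / (C * y + D)) (z / (C * z + D)) (w / (C * w + D))

end Multiscale

end

noncomputable section

namespace Multiscale

/-! ### Coefficients of formal expansions -/

section

/-! Every expanded field begins at order ε, so a product of k fields begins at ε^k and only few
amplitudes meet up to order ε³. Order ε forces u_1^{(0)} = 0, since 2(a₁ + a₂) ≠ 0. Order ε²
transports u_1^{(1)} with the group velocity ω' and, off resonance, makes u_2^{(0)} and u_2^{(2)}
multiples of |u_1^{(1)}|² and (u_1^{(1)})². Inserted into W_3^{(1)}, where u_3^{(1)} drops out by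
the dispersion relation, they leave a transport term in u_2^{(1)} plus an NLS expression
(`W_three_one_eq`). The pair (ρ₁, ρ₂) is unique because explicit real profiles can be inserted
(`reducesToNLS_unique`). If W_3^{(1)} = 0, the NLS expression is a source for u_2^{(1)} that is
constant along characteristics, so u_2^{(1)} grows linearly unless the source vanishes
(`hasProfile_of_bounded`).

For the reality of ρ₂, division of numerator and denominator by (KΩ)^{1/2} makes the denominator
real, and Im ρ₂ = 0 becomes a trigonometric identity in κ/2 and ω/2 (`half_angle_conditions`). With
p = tan(κ/2) and r = (a₁ + a₂)/(a₂ - a₁), the dispersion relation reads tan(ω/2) = r/p, so the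
identity is rational in p. A Möbius shift equalizes γ₁ and γ₂, and the numerator becomes a
polynomial of degree at most 5 in p² (`totalIm_eq`). It vanishes at infinitely many points exactly
when its six coefficients vanish. The two extreme ones fix ξ₁ - ξ₂ and ξ₃ - ξ₄; the other four form
a system linear in (α₂, β₂) and in the three reduced quadratic coefficients. A nontrivial solution
makes all 3 × 3 minors vanish; these factor, and their common zeros give the six cases
(`BilinearSystem.solutions`, `ReducedCoordinates.numeratorCoeff_eq_zero_iff_cases`).

The parameter counts come from solving the conditions of each case for the dependent coefficients.
The Möbius image is computed explicitly (`mobius`); it is unique because a multilinear polynomial is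
determined by its values on the vertices of a cube, and each family is invariant because its
conditions transform among themselves. -/

open LaurentPolynomial in
theorem coeff_sum_C_mul_T_mul {R : Type*} [CommRing R] (s : Finset ℤ) (f : ℤ → R)
    (q : LaurentPolynomial R) (γ : ℤ) :
    ((∑ β ∈ s, C (f β) * T β) * q).coeff γ = ∑ β ∈ s, f β * q.coeff (γ - β) := by
  rw [Finset.sum_mul, AddMonoidAlgebra.coeff_sum, Finsupp.finsetSum_apply]
  refine Finset.sum_congr rfl fun β _ => ?_
  rw [← single_eq_C_mul_T]
  rw [AddMonoidAlgebra.coeff_single_mul_apply, neg_add_eq_sub]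

open LaurentPolynomial in
theorem coeff_sum_C_mul_T {R : Type*} [CommRing R] (s : Finset ℤ) (f : ℤ → R) (γ : ℤ) :
    (∑ β ∈ s, C (f β) * T β : LaurentPolynomial R).coeff γ = if γ ∈ s then f γ else 0 := by
  rw [AddMonoidAlgebra.coeff_sum, Finsupp.finsetSum_apply]
  simp only [← single_eq_C_mul_T, AddMonoidAlgebra.coeff_single, Finsupp.single_apply]
  rw [Finset.sum_ite_eq' s γ f]

/-- The amplitude of `ε^r T^α` in `expand z op u`, for `|α| ≤ r`. -/
def shiftAmp (z : ℂ) (op : ℕ → Slow → Slow) (u : Amplitudes) (r : ℕ) (α : ℤ) : Slow :=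
  z ^ α • ∑ j ∈ Finset.Icc (max 1 α.natAbs) r, op (r - j) (u j α)

variable (z z' z'' : ℂ) (op op' op'' : ℕ → Slow → Slow) (u : Amplitudes)

theorem coeff_expand (r : ℕ) (α : ℤ) :
    (PowerSeries.coeff r (expand z op u)).coeff α =
      if α ∈ Finset.Icc (-(r : ℤ)) r then shiftAmp z op u r α else 0 := by
  rw [expand, PowerSeries.coeff_mk, coeff_sum_C_mul_T]
  rfl

theorem coeff_expand_mul (r : ℕ) (q : LaurentPolynomial Slow) (γ : ℤ) :
    (PowerSeries.coeff r (expand z op u) * q).coeff γ =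
      ∑ β ∈ Finset.Icc (-(r : ℤ)) r, shiftAmp z op u r β * q.coeff (γ - β) := by
  rw [expand, PowerSeries.coeff_mk, coeff_sum_C_mul_T_mul]
  rfl

theorem coeff_zero_expand : PowerSeries.coeff 0 (expand z op u) = 0 := by
  rw [expand, PowerSeries.coeff_mk]
  simp

theorem coeff_mul_one_of_coeff_zero {R : Type*} [CommRing R] {e f : PowerSeries R}
    (he : PowerSeries.coeff 0 e = 0) (hf : PowerSeries.coeff 0 f = 0) :
    PowerSeries.coeff 1 (e * f) = 0 := by
  rw [PowerSeries.coeff_mul, Finset.Nat.sum_antidiagonal_eq_sum_range_succ_mk]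
  simp [Finset.sum_range_succ, -PowerSeries.coeff_zero_eq_constantCoeff, he, hf]

theorem coeff_mul_two_of_coeff_zero {R : Type*} [CommRing R] {e f : PowerSeries R}
    (he : PowerSeries.coeff 0 e = 0) (hf : PowerSeries.coeff 0 f = 0) :
    PowerSeries.coeff 2 (e * f) = PowerSeries.coeff 1 e * PowerSeries.coeff 1 f := by
  rw [PowerSeries.coeff_mul, Finset.Nat.sum_antidiagonal_eq_sum_range_succ_mk]
  simp [Finset.sum_range_succ, -PowerSeries.coeff_zero_eq_constantCoeff, he, hf]

theorem coeff_mul_three_of_coeff_zero {R : Type*} [CommRing R] {e f : PowerSeries R}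
    (he : PowerSeries.coeff 0 e = 0) (hf : PowerSeries.coeff 0 f = 0) :
    PowerSeries.coeff 3 (e * f) = PowerSeries.coeff 1 e * PowerSeries.coeff 2 f +
      PowerSeries.coeff 2 e * PowerSeries.coeff 1 f := by
  rw [PowerSeries.coeff_mul, Finset.Nat.sum_antidiagonal_eq_sum_range_succ_mk]
  simp [Finset.sum_range_succ, -PowerSeries.coeff_zero_eq_constantCoeff, he, hf]

theorem coeff_zero_mul_of_coeff_zero {R : Type*} [CommRing R] {e f : PowerSeries R}
    (he : PowerSeries.coeff 0 e = 0) : PowerSeries.coeff 0 (e * f) = 0 := by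
  rw [PowerSeries.coeff_mul]
  simp [-PowerSeries.coeff_zero_eq_constantCoeff, he]

theorem coeff_coeff_smul (a : ℝ) (e : Expansion) (j : ℕ) (α : ℤ) :
    (PowerSeries.coeff j (a • e)).coeff α = a • (PowerSeries.coeff j e).coeff α := by
  rfl

theorem coeff_coeff_add (e f : Expansion) (j : ℕ) (α : ℤ) :
    (PowerSeries.coeff j (e + f)).coeff α =
      (PowerSeries.coeff j e).coeff α + (PowerSeries.coeff j f).coeff α := by
  rw [map_add, AddMonoidAlgebra.coeff_add, Finsupp.add_apply]

theorem Icc_neg_one_one : Finset.Icc (-((1 : ℕ) : ℤ)) ((1 : ℕ) : ℤ) = {-1, 0, 1} := by decide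

theorem Icc_neg_two_two : Finset.Icc (-((2 : ℕ) : ℤ)) ((2 : ℕ) : ℤ) = {-2, -1, 0, 1, 2} := by
  decide

end

/-! ### Products of shifted fields and the slow operators -/

section

/-- The properties of the slow operators of a shift that matter for the nonlinear terms. -/
structure IsShiftOp (op : ℕ → Slow → Slow) : Prop where
  zero_eq : ∀ f, op 0 f = f
  map_zero : ∀ i, op i 0 = 0

variable {z z' z'' : ℂ} {op op' op'' : ℕ → Slow → Slow} {u : Amplitudes}

theorem shiftAmp_one (h : IsShiftOp op) {α : ℤ} (hα : α.natAbs ≤ 1) :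
    shiftAmp z op u 1 α = z ^ α • u 1 α := by
  rw [shiftAmp, max_eq_left hα]
  simp [h.zero_eq]

theorem shiftAmp_two_self (h : IsShiftOp op) {α : ℤ} (hα : α.natAbs = 2) :
    shiftAmp z op u 2 α = z ^ α • u 2 α := by
  rw [shiftAmp, hα]
  simp [h.zero_eq]

theorem shiftAmp_two (h : IsShiftOp op) {α : ℤ} (hα : α.natAbs ≤ 1) :
    shiftAmp z op u 2 α = z ^ α • (op 1 (u 1 α) + u 2 α) := by
  rw [shiftAmp, max_eq_left hα, show Finset.Icc 1 2 = {1, 2} from rfl]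
  simp [h.zero_eq]

theorem shiftAmp_three_one (h : IsShiftOp op) :
    shiftAmp z op u 3 1 = z • (op 2 (u 1 1) + op 1 (u 2 1) + u 3 1) := by
  rw [shiftAmp, show Finset.Icc (max 1 (1 : ℤ).natAbs) 3 = {1, 2, 3} from rfl]
  simp [h.zero_eq, add_assoc]

theorem coeff_two_mul (h : IsShiftOp op) (h' : IsShiftOp op') (γ : ℤ) :
    (PowerSeries.coeff 2 (expand z op u * expand z' op' u)).coeff γ =
      ∑ β ∈ {-1, 0, 1}, if γ - β ∈ ({-1, 0, 1} : Finset ℤ) then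
        (z ^ β * z' ^ (γ - β)) • (u 1 β * u 1 (γ - β)) else 0 := by
  rw [coeff_mul_two_of_coeff_zero (coeff_zero_expand _ _ _) (coeff_zero_expand _ _ _),
    coeff_expand_mul, Icc_neg_one_one]
  refine Finset.sum_congr rfl fun β hβ => ?_
  rw [coeff_expand, Icc_neg_one_one]
  have key : ∀ α ∈ ({-1, 0, 1} : Finset ℤ), α.natAbs ≤ 1 := by decide
  split_ifs with hm
  · rw [shiftAmp_one h (key _ hβ), shiftAmp_one h' (key _ hm), smul_mul_smul_comm]
  · exact mul_zero _

/-- One factor has order 1 and the other order 2. Since u_1^{(0)} = 0, the first has harmonic ±1, so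
the second has harmonic 0 or 2. Hence neither u_2^{(1)} nor a derivative of u_1^{(1)} enters. -/
theorem coeff_three_mul (h : IsShiftOp op) (h' : IsShiftOp op') (h10 : u 1 0 = 0) :
    (PowerSeries.coeff 3 (expand z op u * expand z' op' u)).coeff 1 =
      (z + z') • (u 2 0 * u 1 1) + (z⁻¹ * z' ^ 2 + z ^ 2 * z'⁻¹) • (u 2 2 * u 1 (-1)) := by
  rw [coeff_mul_three_of_coeff_zero (coeff_zero_expand _ _ _) (coeff_zero_expand _ _ _),
    AddMonoidAlgebra.coeff_add, Finsupp.add_apply, coeff_expand_mul, coeff_expand_mul,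
    Icc_neg_one_one, Icc_neg_two_two]
  simp only [coeff_expand, Icc_neg_one_one, Icc_neg_two_two]
  have h1 : ∀ α : ℤ, α.natAbs ≤ 1 → shiftAmp z op u 1 α = z ^ α • u 1 α :=
    fun α => shiftAmp_one h
  have h1' : ∀ α : ℤ, α.natAbs ≤ 1 → shiftAmp z' op' u 1 α = z' ^ α • u 1 α :=
    fun α => shiftAmp_one h'
  have h20 := shiftAmp_two (z := z) (u := u) h (α := 0) (by decide)
  have h20' := shiftAmp_two (z := z') (u := u) h' (α := 0) (by decide)
  have h22 := shiftAmp_two_self (z := z) (u := u) h (α := 2) (by decide)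
  have h22' := shiftAmp_two_self (z := z') (u := u) h' (α := 2) (by decide)
  rw [h10, h.map_zero] at h20
  rw [h10, h'.map_zero] at h20'
  have e1 := h1 (-1) (by decide)
  have e2 := h1 0 (by decide)
  have e3 := h1 1 (by decide)
  have e1' := h1' (-1) (by decide)
  have e2' := h1' 0 (by decide)
  have e3' := h1' 1 (by decide)
  rw [h10] at e2 e2'
  norm_num [e1, e2, e3, e1', e2', e3', h20, h20', h22, h22', Finset.sum_insert]
  funext n₁ m₁ m₂
  simp
  ring

/-- All three factors have order 1 and harmonic ±1, so harmonic 1 arises from two factors +1 and one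
factor -1. The three phase terms correspond to the place of the -1. -/
theorem coeff_three_mul_mul (h : IsShiftOp op) (h' : IsShiftOp op') (h'' : IsShiftOp op'')
    (h10 : u 1 0 = 0) :
    (PowerSeries.coeff 3 (expand z op u * expand z' op' u * expand z'' op'' u)).coeff 1 =
      (z⁻¹ * z' * z'' + z * z'⁻¹ * z'' + z * z' * z''⁻¹) • (u 1 1 ^ 2 * u 1 (-1)) := by
  rw [mul_assoc, coeff_mul_three_of_coeff_zero (coeff_zero_expand _ _ _)
    (coeff_zero_mul_of_coeff_zero (coeff_zero_expand _ _ _)),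
    coeff_mul_one_of_coeff_zero (coeff_zero_expand _ _ _) (coeff_zero_expand _ _ _), mul_zero,
    add_zero, coeff_expand_mul, Icc_neg_one_one]
  simp only [coeff_two_mul h' h'']
  have h1 : ∀ α : ℤ, α.natAbs ≤ 1 → shiftAmp z op u 1 α = z ^ α • u 1 α :=
    fun α => shiftAmp_one h
  have e1 := h1 (-1) (by decide)
  have e2 := h1 0 (by decide)
  have e3 := h1 1 (by decide)
  rw [h10] at e2
  norm_num [e1, e2, e3, h10, Finset.sum_insert]
  funext n₁ m₁ m₂
  simp
  ring

theorem coeff_one_mul :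
    (PowerSeries.coeff 1 (expand z op u * expand z' op' u)) = 0 :=
  coeff_mul_one_of_coeff_zero (coeff_zero_expand _ _ _) (coeff_zero_expand _ _ _)

theorem coeff_two_mul_mul :
    (PowerSeries.coeff 2 (expand z op u * expand z' op' u * expand z'' op'' u)) = 0 := by
  rw [mul_assoc, coeff_mul_two_of_coeff_zero (coeff_zero_expand _ _ _)
    (coeff_zero_mul_of_coeff_zero (coeff_zero_expand _ _ _)), coeff_one_mul, mul_zero]

theorem coeff_one_mul_mul :
    (PowerSeries.coeff 1 (expand z op u * expand z' op' u * expand z'' op'' u)) = 0 :=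
  coeff_mul_one_of_coeff_zero (coeff_zero_mul_of_coeff_zero (coeff_zero_expand _ _ _))
    (coeff_zero_expand _ _ _)

/-- A product of four fields begins at ε⁴, so ζ never enters the conditions. -/
theorem coeff_mul_mul_mul {z''' : ℂ} {op''' : ℕ → Slow → Slow} {j : ℕ} (hj : j ≤ 3) :
    (PowerSeries.coeff j
      (expand z op u * expand z' op' u * expand z'' op'' u * expand z''' op''' u)) = 0 := by
  have h0 := coeff_zero_mul_of_coeff_zero (f := expand z'' op'' u)
    (coeff_zero_mul_of_coeff_zero (f := expand z' op' u) (coeff_zero_expand z op u))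
  have h0' := coeff_zero_expand z''' op''' u
  interval_cases j
  · exact coeff_zero_mul_of_coeff_zero h0
  · exact coeff_mul_one_of_coeff_zero h0 h0'
  · rw [coeff_mul_two_of_coeff_zero h0 h0', coeff_one_mul_mul, zero_mul]
  · rw [coeff_mul_three_of_coeff_zero h0 h0', coeff_one_mul_mul, coeff_two_mul_mul, zero_mul,
      zero_mul, add_zero]

/-! ### The slow operators -/

theorem dn₁_zero : dn₁ 0 = 0 := by funext n m t; simp [dn₁]
theorem dm₁_zero : dm₁ 0 = 0 := by funext n m t; simp [dm₁]
theorem dm₂_zero : dm₂ 0 = 0 := by funext n m t; simp [dm₂]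
theorem nabla_zero : nabla 0 = 0 := by rw [nabla, dm₁_zero, dn₁_zero, add_zero]

theorem isShiftOp_opId : IsShiftOp opId :=
  ⟨fun _ => rfl, fun i => by rw [opId]; split_ifs <;> rfl⟩

theorem isShiftOp_opA : IsShiftOp opA :=
  ⟨fun f => by simp [opA], fun i => by rw [opA, Function.iterate_fixed dn₁_zero, smul_zero]⟩

theorem isShiftOp_opB : IsShiftOp opB :=
  ⟨fun f => by simp [opB], fun i => Finset.sum_eq_zero fun q _ => by
    rw [Function.iterate_fixed dm₂_zero, Function.iterate_fixed dm₁_zero, smul_zero]⟩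

theorem isShiftOp_opC : IsShiftOp opC :=
  ⟨fun f => by simp [opC], fun i => Finset.sum_eq_zero fun q _ => by
    rw [Function.iterate_fixed dm₂_zero, Function.iterate_fixed nabla_zero, smul_zero]⟩

theorem opA_one (f : Slow) : opA 1 f = dn₁ f := by simp [opA]
theorem opB_one (f : Slow) : opB 1 f = dm₁ f := by simp [opB]
theorem opC_one (f : Slow) : opC 1 f = nabla f := by simp [opC]
theorem opA_two (f : Slow) : opA 2 f = (1 / 2 : ℝ) • dn₁ (dn₁ f) := by simp [opA]
theorem opB_two (f : Slow) : opB 2 f = (1 / 2 : ℝ) • dm₁ (dm₁ f) + dm₂ f := by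
  simp [opB, Finset.sum_range_succ]
theorem opC_two (f : Slow) : opC 2 f = (1 / 2 : ℝ) • nabla (nabla f) + dm₂ f := by
  simp [opC, Finset.sum_range_succ]

end

/-! ### The harmonics of the equation up to order ε³ -/

section

namespace QPlus

/-- The quadratic part of the equation, with `f` applied to the phases of the two factors. -/
def quadSum (c : QPlus) (K Ω : ℂ) (f : ℂ → ℂ → ℂ) : ℂ :=
  (c .α₁ - c .α₂) * f 1 K + (c .α₁ + c .α₂) * f Ω (K * Ω)
    + (c .β₁ - c .β₂) * f 1 Ω + (c .β₁ + c .β₂) * f K (K * Ω)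
    + c .γ₁ * f 1 (K * Ω) + c .γ₂ * f K Ω

/-- The cubic part of the equation, with `f` applied to the phases of the three factors. -/
def cubSum (c : QPlus) (K Ω : ℂ) (f : ℂ → ℂ → ℂ → ℂ) : ℂ :=
  (c .ξ₁ - c .ξ₃) * f 1 K Ω + (c .ξ₁ + c .ξ₃) * f 1 K (K * Ω)
    + (c .ξ₂ - c .ξ₄) * f K Ω (K * Ω) + (c .ξ₂ + c .ξ₄) * f 1 Ω (K * Ω)

/-- Coefficient of `|u_1^{(1)}|²` in the zeroth harmonic. -/
def meanCoeff (c : QPlus) (K Ω : ℂ) : ℂ := c.quadSum K Ω fun z w => z⁻¹ * w + z * w⁻¹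

/-- Coefficient of `(u_1^{(1)})²` in the second harmonic. -/
def secondCoeff (c : QPlus) (K Ω : ℂ) : ℂ := c.quadSum K Ω fun z w => z * w

/-- Coefficient of `u_2^{(0)} u_1^{(1)}` in the first harmonic. -/
def meanCoupling (c : QPlus) (K Ω : ℂ) : ℂ := c.quadSum K Ω fun z w => z + w

/-- Coefficient of `u_2^{(2)} u_1^{(-1)}` in the first harmonic. -/
def secondCoupling (c : QPlus) (K Ω : ℂ) : ℂ :=
  c.quadSum K Ω fun z w => z⁻¹ * w ^ 2 + z ^ 2 * w⁻¹

/-- Coefficient of `(u_1^{(1)})² u_1^{(-1)}` in the first harmonic. -/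
def cubicCoeff (c : QPlus) (K Ω : ℂ) : ℂ :=
  c.cubSum K Ω fun z w y => z⁻¹ * w * y + z * w⁻¹ * y + z * w * y⁻¹

end QPlus

variable {c : QPlus} {κ w : ℝ} {u : Amplitudes}

theorem bigK_ne_zero (κ : ℝ) : bigK κ ≠ 0 := Complex.exp_ne_zero _
theorem bigOmega_ne_zero (w : ℝ) : bigOmega w ≠ 0 := Complex.exp_ne_zero _

theorem W_one {α : ℤ} (hα : α.natAbs ≤ 1) :
    c.W κ w u 1 α = c.symbol (bigK κ ^ α) (bigOmega w ^ α) • u 1 α := by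
  have hm : α ∈ Finset.Icc (-((1 : ℕ) : ℤ)) ((1 : ℕ) : ℤ) := by
    rw [Finset.mem_Icc]; omega
  rw [QPlus.W, QPlus.lhs]
  simp only [coeff_coeff_add, coeff_coeff_smul, coeff_one_mul, coeff_one_mul_mul,
    coeff_mul_mul_mul (show 1 ≤ 3 by decide), coeff_expand, if_pos hm,
    shiftAmp_one isShiftOp_opId hα, shiftAmp_one isShiftOp_opA hα, shiftAmp_one isShiftOp_opB hα,
    shiftAmp_one isShiftOp_opC hα]
  funext n₁ m₁ m₂
  simp [QPlus.symbol, mul_zpow]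
  ring

theorem W_one_of_lt {α : ℤ} (hα : 1 < α.natAbs) : c.W κ w u 1 α = 0 := by
  have hm : α ∉ Finset.Icc (-((1 : ℕ) : ℤ)) ((1 : ℕ) : ℤ) := by
    rw [Finset.mem_Icc]; omega
  rw [QPlus.W, QPlus.lhs]
  simp only [coeff_coeff_add, coeff_coeff_smul, coeff_one_mul, coeff_one_mul_mul,
    coeff_mul_mul_mul (show 1 ≤ 3 by decide), coeff_expand, if_neg hm]
  simp

theorem W_two_zero (h10 : u 1 0 = 0) :
    c.W κ w u 2 0 = (2 * (c .a₁ + c .a₂) : ℂ) • u 2 0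
      + c.meanCoeff (bigK κ) (bigOmega w) • (u 1 1 * u 1 (-1)) := by
  have hm : (0 : ℤ) ∈ Finset.Icc (-((2 : ℕ) : ℤ)) ((2 : ℕ) : ℤ) := by decide
  rw [QPlus.W, QPlus.lhs]
  simp only [coeff_coeff_add, coeff_coeff_smul, coeff_two_mul_mul,
    coeff_mul_mul_mul (show 2 ≤ 3 by decide), coeff_expand, if_pos hm,
    shiftAmp_two isShiftOp_opId (show (0 : ℤ).natAbs ≤ 1 by decide),
    shiftAmp_two isShiftOp_opA (show (0 : ℤ).natAbs ≤ 1 by decide),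
    shiftAmp_two isShiftOp_opB (show (0 : ℤ).natAbs ≤ 1 by decide),
    shiftAmp_two isShiftOp_opC (show (0 : ℤ).natAbs ≤ 1 by decide),
    coeff_two_mul isShiftOp_opId isShiftOp_opA, coeff_two_mul isShiftOp_opB isShiftOp_opC,
    coeff_two_mul isShiftOp_opId isShiftOp_opB, coeff_two_mul isShiftOp_opA isShiftOp_opC,
    coeff_two_mul isShiftOp_opId isShiftOp_opC, coeff_two_mul isShiftOp_opA isShiftOp_opB,
    h10, isShiftOp_opId.map_zero, isShiftOp_opA.map_zero, isShiftOp_opB.map_zero,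
    isShiftOp_opC.map_zero]
  norm_num [Finset.sum_insert, h10]
  funext n₁ m₁ m₂
  simp [QPlus.meanCoeff, QPlus.quadSum]
  ring

/-- With u_1^{(0)} = 0, two factors of order 1 only produce the even harmonics 0 and ±2, so the odd
harmonics at ε² are linear in the amplitudes. -/
theorem W_two_one (h10 : u 1 0 = 0) {α : ℤ} (hα : α = 1 ∨ α = -1) :
    c.W κ w u 2 α = c.symbol (bigK κ ^ α) (bigOmega w ^ α) • u 2 α
      + (bigK κ ^ α * (c .a₁ * bigOmega w ^ α + c .a₂)) • dn₁ (u 1 α)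
      + (bigOmega w ^ α * (c .a₁ * bigK κ ^ α + c .a₂)) • dm₁ (u 1 α) := by
  have hm : α ∈ Finset.Icc (-((2 : ℕ) : ℤ)) ((2 : ℕ) : ℤ) := by
    rw [Finset.mem_Icc]; omega
  have hα1 : α.natAbs ≤ 1 := by omega
  rw [QPlus.W, QPlus.lhs]
  simp only [coeff_coeff_add, coeff_coeff_smul, coeff_two_mul_mul,
    coeff_mul_mul_mul (show 2 ≤ 3 by decide), coeff_expand, if_pos hm,
    shiftAmp_two isShiftOp_opId hα1, shiftAmp_two isShiftOp_opA hα1,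
    shiftAmp_two isShiftOp_opB hα1, shiftAmp_two isShiftOp_opC hα1,
    coeff_two_mul isShiftOp_opId isShiftOp_opA, coeff_two_mul isShiftOp_opB isShiftOp_opC,
    coeff_two_mul isShiftOp_opId isShiftOp_opB, coeff_two_mul isShiftOp_opA isShiftOp_opC,
    coeff_two_mul isShiftOp_opId isShiftOp_opC, coeff_two_mul isShiftOp_opA isShiftOp_opB,
    opA_one, opB_one, opC_one, nabla, mul_zpow]
  rcases hα with rfl | rfl <;> norm_num [Finset.sum_insert, h10] <;> funext n₁ m₁ m₂ <;>
    simp [QPlus.symbol, opId] <;> ring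

/-- Writing the harmonic as `2 * α` treats 2 and -2 by one formula. -/
theorem W_two_two (h10 : u 1 0 = 0) {α : ℤ} (hα : α = 1 ∨ α = -1) :
    c.W κ w u 2 (2 * α) = c.symbol (bigK κ ^ (2 * α)) (bigOmega w ^ (2 * α)) • u 2 (2 * α)
      + c.secondCoeff (bigK κ ^ α) (bigOmega w ^ α) • (u 1 α ^ 2) := by
  have hm : 2 * α ∈ Finset.Icc (-((2 : ℕ) : ℤ)) ((2 : ℕ) : ℤ) := by
    rw [Finset.mem_Icc]; omega
  have hα1 : (2 * α).natAbs = 2 := by omega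
  rw [QPlus.W, QPlus.lhs]
  simp only [coeff_coeff_add, coeff_coeff_smul, coeff_two_mul_mul,
    coeff_mul_mul_mul (show 2 ≤ 3 by decide), coeff_expand, if_pos hm,
    shiftAmp_two_self isShiftOp_opId hα1, shiftAmp_two_self isShiftOp_opA hα1,
    shiftAmp_two_self isShiftOp_opB hα1, shiftAmp_two_self isShiftOp_opC hα1,
    coeff_two_mul isShiftOp_opId isShiftOp_opA, coeff_two_mul isShiftOp_opB isShiftOp_opC,
    coeff_two_mul isShiftOp_opId isShiftOp_opB, coeff_two_mul isShiftOp_opA isShiftOp_opC,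
    coeff_two_mul isShiftOp_opId isShiftOp_opC, coeff_two_mul isShiftOp_opA isShiftOp_opB,
    mul_zpow]
  rcases hα with rfl | rfl <;> norm_num [Finset.sum_insert, h10] <;> funext n₁ m₁ m₂ <;>
    simp [QPlus.symbol, QPlus.secondCoeff, QPlus.quadSum] <;> ring

theorem W_two_of_lt {α : ℤ} (hα : 2 < α.natAbs) : c.W κ w u 2 α = 0 := by
  have hm : α ∉ Finset.Icc (-((2 : ℕ) : ℤ)) ((2 : ℕ) : ℤ) := by
    rw [Finset.mem_Icc]; omega
  have h1 : α - -1 ∉ ({-1, 0, 1} : Finset ℤ) := by simp; omega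
  have h2 : α - 0 ∉ ({-1, 0, 1} : Finset ℤ) := by simp; omega
  have h3 : α - 1 ∉ ({-1, 0, 1} : Finset ℤ) := by simp; omega
  rw [QPlus.W, QPlus.lhs]
  simp only [coeff_coeff_add, coeff_coeff_smul, coeff_two_mul_mul,
    coeff_mul_mul_mul (show 2 ≤ 3 by decide), coeff_expand, if_neg hm,
    coeff_two_mul isShiftOp_opId isShiftOp_opA, coeff_two_mul isShiftOp_opB isShiftOp_opC,
    coeff_two_mul isShiftOp_opId isShiftOp_opB, coeff_two_mul isShiftOp_opA isShiftOp_opC,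
    coeff_two_mul isShiftOp_opId isShiftOp_opC, coeff_two_mul isShiftOp_opA isShiftOp_opB]
  rw [Finset.sum_insert (by decide), Finset.sum_insert (by decide), Finset.sum_singleton]
  simp only [Finset.sum_insert (show (-1 : ℤ) ∉ ({0, 1} : Finset ℤ) by decide),
    Finset.sum_insert (show (0 : ℤ) ∉ ({1} : Finset ℤ) by decide), Finset.sum_singleton,
    if_neg h1, if_neg h2, if_neg h3]
  simp

/-- A shift in m moves m₁ by ε and m₂ by ε². Therefore the m₂-derivative of u_1^{(1)} carries the
same coefficient as the m₁-derivative of u_2^{(1)}. -/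
theorem W_three_one (h10 : u 1 0 = 0) :
    c.W κ w u 3 1 = c.symbol (bigK κ) (bigOmega w) • u 3 1
      + (bigK κ * (c .a₁ * bigOmega w + c .a₂)) • dn₁ (u 2 1)
      + (bigOmega w * (c .a₁ * bigK κ + c .a₂)) • (dm₁ (u 2 1) + dm₂ (u 1 1))
      + (1 / 2 : ℂ) • ((c .a₁ * (bigK κ * bigOmega w)) • nabla (nabla (u 1 1))
        + (c .a₂ * bigK κ) • dn₁ (dn₁ (u 1 1)) + (c .a₂ * bigOmega w) • dm₁ (dm₁ (u 1 1)))
      + c.meanCoupling (bigK κ) (bigOmega w) • (u 2 0 * u 1 1)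
      + c.secondCoupling (bigK κ) (bigOmega w) • (u 2 2 * u 1 (-1))
      + c.cubicCoeff (bigK κ) (bigOmega w) • (u 1 1 ^ 2 * u 1 (-1)) := by
  have hm : (1 : ℤ) ∈ Finset.Icc (-((3 : ℕ) : ℤ)) ((3 : ℕ) : ℤ) := by decide
  rw [QPlus.W, QPlus.lhs]
  simp only [coeff_coeff_add, coeff_coeff_smul,
    coeff_mul_mul_mul (show 3 ≤ 3 by decide), coeff_expand, if_pos hm,
    shiftAmp_three_one isShiftOp_opId, shiftAmp_three_one isShiftOp_opA,
    shiftAmp_three_one isShiftOp_opB, shiftAmp_three_one isShiftOp_opC,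
    coeff_three_mul isShiftOp_opId isShiftOp_opA h10,
    coeff_three_mul isShiftOp_opB isShiftOp_opC h10,
    coeff_three_mul isShiftOp_opId isShiftOp_opB h10,
    coeff_three_mul isShiftOp_opA isShiftOp_opC h10,
    coeff_three_mul isShiftOp_opId isShiftOp_opC h10,
    coeff_three_mul isShiftOp_opA isShiftOp_opB h10,
    coeff_three_mul_mul isShiftOp_opId isShiftOp_opA isShiftOp_opB h10,
    coeff_three_mul_mul isShiftOp_opId isShiftOp_opA isShiftOp_opC h10,
    coeff_three_mul_mul isShiftOp_opA isShiftOp_opB isShiftOp_opC h10,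
    coeff_three_mul_mul isShiftOp_opId isShiftOp_opB isShiftOp_opC h10,
    opA_one, opB_one, opC_one, opA_two, opB_two, opC_two]
  have e1 : nabla (u 2 1) = dm₁ (u 2 1) + dn₁ (u 2 1) := rfl
  rw [e1]
  funext n₁ m₁ m₂
  simp [QPlus.symbol, QPlus.meanCoupling, QPlus.secondCoupling, QPlus.cubicCoeff,
    QPlus.quadSum, QPlus.cubSum, opId]
  ring

end

section

open ComplexConjugate

/-! ### Functions of the slow variables -/

/-- Smooth functions of the slow variables. -/
def SmoothSlow (f : Slow) : Prop :=
  ContDiff ℝ ((⊤ : ℕ∞) : WithTop ℕ∞) (fun p : ℝ × ℝ × ℝ => f p.1 p.2.1 p.2.2)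

/-- The slow derivatives are one-variable derivatives; joint differentiability identifies them with
the values of the Fréchet derivative on the coordinate vectors, and the chain rule becomes
linearity. -/
theorem SmoothSlow.hasDerivAt_comp {f : Slow} (hf : SmoothSlow f) {x y t : ℝ → ℝ}
    {x' y' t' s : ℝ} (hx : HasDerivAt x x' s) (hy : HasDerivAt y y' s) (ht : HasDerivAt t t' s) :
    HasDerivAt (fun s => f (x s) (y s) (t s))
      (x' * dn₁ f (x s) (y s) (t s) + y' * dm₁ f (x s) (y s) (t s)
        + t' * dm₂ f (x s) (y s) (t s)) s := by
  set F : ℝ × ℝ × ℝ → ℂ := fun p => f p.1 p.2.1 p.2.2 with hF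
  set L := fderiv ℝ F (x s, y s, t s) with hL
  have hd : HasFDerivAt F L (x s, y s, t s) :=
    ((ContDiff.differentiable hf (by simp)) _).hasFDerivAt
  have key : ∀ {x y t : ℝ → ℝ} {x' y' t' s₀ : ℝ}, HasDerivAt x x' s₀ → HasDerivAt y y' s₀ →
      HasDerivAt t t' s₀ → HasFDerivAt F L (x s₀, y s₀, t s₀) →
      HasDerivAt (fun s => f (x s) (y s) (t s)) (L (x', y', t')) s₀ := by
    intro x y t x' y' t' s₀ hx hy ht hd
    exact hd.comp_hasDerivAt s₀ (hx.prodMk (hy.prodMk ht))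
  have h1 : dn₁ f (x s) (y s) (t s) = L (1, 0, 0) :=
    (key (x := fun r => r) (hasDerivAt_id' (x s)) (hasDerivAt_const (x s) (y s))
      (hasDerivAt_const (x s) (t s)) hd).deriv
  have h2 : dm₁ f (x s) (y s) (t s) = L (0, 1, 0) :=
    (key (y := fun r => r) (hasDerivAt_const (y s) (x s)) (hasDerivAt_id' (y s))
      (hasDerivAt_const (y s) (t s)) hd).deriv
  have h3 : dm₂ f (x s) (y s) (t s) = L (0, 0, 1) :=
    (key (t := fun r => r) (hasDerivAt_const (t s) (x s)) (hasDerivAt_const (t s) (y s))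
      (hasDerivAt_id' (t s)) hd).deriv
  have h4 : L (x', y', t') = x' * L (1, 0, 0) + y' * L (0, 1, 0) + t' * L (0, 0, 1) := by
    have : ((x', y', t') : ℝ × ℝ × ℝ) =
        x' • ((1, 0, 0) : ℝ × ℝ × ℝ) + y' • ((0, 1, 0) : ℝ × ℝ × ℝ)
          + t' • ((0, 0, 1) : ℝ × ℝ × ℝ) := by simp
    rw [this, map_add, map_add, map_smul, map_smul, map_smul]
    simp
  rw [h1, h2, h3, ← h4]
  exact key hx hy ht hd

theorem SmoothSlow.dn₁ {f : Slow} (hf : SmoothSlow f) : SmoothSlow (dn₁ f) := by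
  have h : (fun p : ℝ × ℝ × ℝ => Multiscale.dn₁ f p.1 p.2.1 p.2.2) = fun p =>
      fderiv ℝ (fun p : ℝ × ℝ × ℝ => f p.1 p.2.1 p.2.2) p (1, 0, 0) := by
    funext p
    have hd : HasFDerivAt (fun p : ℝ × ℝ × ℝ => f p.1 p.2.1 p.2.2) _ (p.1, p.2.1, p.2.2) :=
      ((ContDiff.differentiable hf (by simp)) _).hasFDerivAt
    exact (hd.comp_hasDerivAt (f := fun s => (s, p.2.1, p.2.2)) p.1 ((hasDerivAt_id' p.1).prodMk
      ((hasDerivAt_const p.1 p.2.1).prodMk (hasDerivAt_const p.1 p.2.2)))).deriv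
  rw [SmoothSlow, h]
  exact (hf.fderiv_right (by simp)).clm_apply contDiff_const

/-- Method of characteristics: along n = x + v s, m = s the source is constant, so f - s g has
derivative zero. The secular term m g is what boundedness later excludes. -/
theorem eq_add_mul_of_transport {f : Slow} (hf : SmoothSlow f) {v : ℝ} {g : ℝ → ℝ → ℂ}
    (h : ∀ n m t, v * dn₁ f n m t + dm₁ f n m t = g (n - v * m) t) (n m t : ℝ) :
    f n m t = f (n - v * m) 0 t + m * g (n - v * m) t := by
  set x := n - v * m with hx
  have hd : ∀ s : ℝ, HasDerivAt (fun s : ℝ => f (x + v * s) s t - s * g x t) 0 s := by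
    intro s
    have h1 := hf.hasDerivAt_comp (x := fun s => x + v * s) (y := fun s => s) (t := fun _ => t)
      (((hasDerivAt_id' s).const_mul v).const_add x) (hasDerivAt_id' s) (hasDerivAt_const s t)
    have h2 : HasDerivAt (fun s : ℝ => (s : ℂ) * g x t) (1 * g x t) s :=
      (Complex.ofRealCLM.hasDerivAt (x := s)).mul_const (g x t) |>.congr_deriv (by simp)
    refine (h1.sub h2).congr_deriv ?_
    have := h (x + v * s) s t
    rw [show x + v * s - v * s = x by ring] at this
    rw [← this]
    simp
  have := is_const_of_deriv_eq_zero (fun s => (hd s).differentiableAt) (fun s => (hd s).deriv) m 0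
  simp only [mul_zero, add_zero, Complex.ofReal_zero, zero_mul, sub_zero] at this
  rw [← this, hx]
  ring_nf

theorem hasProfile_of_transport {f : Slow} (hf : SmoothSlow f) {v : ℝ}
    (h : ∀ n m t, v * dn₁ f n m t + dm₁ f n m t = 0) : HasProfile v f (fun x t => f x 0 t) := by
  intro n m t
  simpa using eq_add_mul_of_transport hf (g := fun _ _ => 0) h n m t

theorem HasProfile.eq_zero_slice {v : ℝ} {f : Slow} {φ : ℝ → ℝ → ℂ} (h : HasProfile v f φ) :
    φ = fun x t => f x 0 t := by
  funext x t
  simpa using (h x 0 t).symm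

/-- No smoothness is given for φ, so it is replaced by the slice m₁ = 0 of f, to which the chain
rule applies. -/
theorem HasProfile.dm₁_eq {v : ℝ} {f : Slow} {φ : ℝ → ℝ → ℂ} (h : HasProfile v f φ)
    (hf : SmoothSlow f) (n m t : ℝ) : dm₁ f n m t = -v * dn₁ f n m t := by
  have h0 : f = fun n m t => f (n - v * m) 0 t := by
    funext n m t
    rw [h n m t, h (n - v * m) 0 t]
    simp
  have e1 : dn₁ f n m t = dn₁ f (n - v * m) 0 t := by
    have h1 := hf.hasDerivAt_comp (x := fun s => s - v * m) (y := fun _ => 0) (t := fun _ => t)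
      ((hasDerivAt_id' n).sub_const (v * m)) (hasDerivAt_const n 0) (hasDerivAt_const n t)
    conv_lhs => rw [h0]
    refine Eq.trans h1.deriv ?_
    simp
  have h2 := hf.hasDerivAt_comp (x := fun s => n - v * s) (y := fun _ => 0) (t := fun _ => t)
    (((hasDerivAt_id' m).const_mul v).const_sub n) (hasDerivAt_const m 0) (hasDerivAt_const m t)
  rw [e1]
  conv_lhs => rw [h0]
  refine Eq.trans h2.deriv ?_
  simp

theorem HasProfile.dn₁ {v : ℝ} {f : Slow} {φ : ℝ → ℝ → ℂ} (h : HasProfile v f φ) :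
    HasProfile v (dn₁ f) (fun x t => deriv (fun y => φ y t) x) := by
  intro n m t
  have : (fun s => f s m t) = fun s => φ (s - v * m) t := funext fun s => h s m t
  rw [Multiscale.dn₁, this]
  exact deriv_comp_sub_const (f := fun y => φ y t) (v * m) n

theorem HasProfile.dm₂ {v : ℝ} {f : Slow} {φ : ℝ → ℝ → ℂ} (h : HasProfile v f φ) :
    HasProfile v (dm₂ f) (fun x t => deriv (fun s => φ x s) t) := by
  intro n m t
  have : (fun s => f n m s) = fun s => φ (n - v * m) s := funext fun s => h n m s
  rw [Multiscale.dm₂, this]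

theorem dn₁_const_mul (a : ℂ) (f : Slow) : dn₁ (a • f) = a • dn₁ f := by
  funext n m t
  exact deriv_const_mul_field (v := fun s => f s m t) a

theorem dm₁_const_mul (a : ℂ) (f : Slow) : dm₁ (a • f) = a • dm₁ f := by
  funext n m t
  exact deriv_const_mul_field (v := fun s => f n s t) a

/-- The second-order slow operators on a travelling profile. -/
theorem HasProfile.second_derivatives {v : ℝ} {f : Slow} {φ : ℝ → ℝ → ℂ} (h : HasProfile v f φ)
    (hf : SmoothSlow f) (n m t : ℝ) :
    Multiscale.dn₁ (Multiscale.dn₁ f) n m t = iteratedDeriv 2 (fun y => φ y t) (n - v * m) ∧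
    dm₁ (dm₁ f) n m t = v ^ 2 * iteratedDeriv 2 (fun y => φ y t) (n - v * m) ∧
    nabla (nabla f) n m t = (1 - v) ^ 2 * iteratedDeriv 2 (fun y => φ y t) (n - v * m) := by
  have e1 : Multiscale.dn₁ (Multiscale.dn₁ f) n m t =
      iteratedDeriv 2 (fun y => φ y t) (n - v * m) := by
    rw [h.dn₁.dn₁ n m t, iteratedDeriv_succ, iteratedDeriv_one]
  have d1 : dm₁ f = (-v : ℂ) • Multiscale.dn₁ f := by
    funext n m t; exact h.dm₁_eq hf n m t
  have d2 : dm₁ (Multiscale.dn₁ f) = (-v : ℂ) • Multiscale.dn₁ (Multiscale.dn₁ f) := by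
    funext n m t; exact h.dn₁.dm₁_eq hf.dn₁ n m t
  have d3 : nabla f = (1 - v : ℂ) • Multiscale.dn₁ f := by
    rw [nabla, d1]; module
  refine ⟨e1, ?_, ?_⟩
  · rw [d1, dm₁_const_mul, d2, ← e1]
    simp
    ring
  · rw [d3, nabla, dm₁_const_mul, dn₁_const_mul, d2, ← e1]
    simp
    ring

end

section

open ComplexConjugate

/-! ### The dispersion relation -/

theorem bigK_eq (κ : ℝ) : bigK κ = Complex.cos κ + Complex.sin κ * Complex.I := by
  rw [bigK, mul_comm, Complex.exp_mul_I]

theorem conj_bigK (κ : ℝ) : conj (bigK κ) = (bigK κ)⁻¹ := by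
  rw [bigK, ← Complex.exp_conj, ← Complex.exp_neg]
  simp

theorem conj_bigOmega (w : ℝ) : conj (bigOmega w) = (bigOmega w)⁻¹ := by
  rw [bigOmega, ← Complex.exp_conj, ← Complex.exp_neg]
  simp

theorem norm_bigK (κ : ℝ) : ‖bigK κ‖ = 1 := by
  rw [bigK, mul_comm, Complex.norm_exp_ofReal_mul_I]

variable {c : QPlus} {ω : ℝ → ℝ} {κ : ℝ} {u : Amplitudes}

theorem QPlus.IsDispersive.add_ne_zero (hc : c.IsDispersive) : c .a₁ + c .a₂ ≠ 0 := fun h =>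
  hc.2.2 (by rw [eq_neg_of_add_eq_zero_left h, abs_neg])

theorem QPlus.IsDispersive.sub_ne_zero (hc : c.IsDispersive) : c .a₁ - c .a₂ ≠ 0 := fun h =>
  hc.2.2 (by rw [sub_eq_zero.1 h])

/-- Taking norms, a zero would give |a₁| = |a₂|. -/
theorem QPlus.IsDispersive.add_mul_ne_zero (hc : c.IsDispersive) {z : ℂ} (hz : ‖z‖ = 1) :
    (c .a₁ * z + c .a₂ : ℂ) ≠ 0 := by
  intro h
  apply hc.2.2
  have h1 := congrArg norm (eq_neg_of_add_eq_zero_left h)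
  simpa [hz] using h1

/-- The group velocity, from differentiating the dispersion relation. -/
theorem QPlus.IsDispersionRelation.group_velocity (hω : c.IsDispersionRelation ω) (κ : ℝ) :
    bigK κ * (c .a₁ * bigOmega (ω κ) + c .a₂)
      = deriv ω κ * (bigOmega (ω κ) * (c .a₁ * bigK κ + c .a₂)) := by
  have hK : HasDerivAt bigK (Complex.I * bigK κ) κ := by
    have h1 : HasDerivAt (fun κ : ℝ => Complex.I * (κ : ℂ)) (Complex.I * 1) κ :=
      (Complex.ofRealCLM.hasDerivAt (x := κ)).const_mul Complex.I |>.congr_deriv (by simp)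
    exact h1.cexp.congr_deriv (by rw [bigK]; ring)
  have hO : HasDerivAt (fun κ => bigOmega (ω κ))
      (-(Complex.I * deriv ω κ) * bigOmega (ω κ)) κ := by
    have h1 : HasDerivAt (fun κ : ℝ => -(Complex.I * (ω κ : ℂ))) (-(Complex.I * deriv ω κ)) κ :=
      (((hω.1 κ).hasDerivAt).ofReal_comp.const_mul Complex.I).neg
    exact h1.cexp.congr_deriv (by rw [bigOmega]; ring)
  have hS := ((hK.mul hO).const_add (1 : ℂ)).const_mul (c .a₁ : ℂ) |>.add
    ((hK.add hO).const_mul (c .a₂ : ℂ))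
  have h0 : HasDerivAt (fun κ => c.symbol (bigK κ) (bigOmega (ω κ))) 0 κ := by
    simp only [hω.2]
    exact hasDerivAt_const κ 0
  have := hS.unique h0
  have hI := Complex.I_ne_zero
  apply mul_left_cancel₀ hI
  linear_combination this

/-! ### Coefficients of the NLS equation -/

namespace QPlus

/-- The factor in front of the NLS expression. -/
def nlsFactor (c : QPlus) (ω : ℝ → ℝ) (κ : ℝ) : ℂ :=
  -Complex.I * (bigOmega (ω κ) * (c .a₁ * bigK κ + c .a₂))

/-- The dispersive coefficient of the NLS equation. -/
def nlsDispersion (c : QPlus) (ω : ℝ → ℝ) (κ : ℝ) : ℂ :=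
  1 / 2 * (c .a₁ * (bigK κ * bigOmega (ω κ)) * (1 - deriv ω κ) ^ 2
    + c .a₂ * (bigK κ + deriv ω κ ^ 2 * bigOmega (ω κ))) / c.nlsFactor ω κ

/-- The cubic coefficient of the NLS equation, before division by `nlsFactor`. -/
def cubicTotal (c : QPlus) (K Ω : ℂ) : ℂ :=
  c.cubicCoeff K Ω - c.meanCoupling K Ω * (c.meanCoeff K Ω / (2 * (c .a₁ + c .a₂)))
    - c.secondCoupling K Ω * (c.secondCoeff K Ω / c.symbol (K ^ 2) (Ω ^ 2))

/-- The nonlinear coefficient of the NLS equation. -/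
def nlsNonlinearity (c : QPlus) (ω : ℝ → ℝ) (κ : ℝ) : ℂ :=
  c.cubicTotal (bigK κ) (bigOmega (ω κ)) / c.nlsFactor ω κ

end QPlus

theorem nlsFactor_ne_zero (hc : c.IsDispersive) : c.nlsFactor ω κ ≠ 0 :=
  mul_ne_zero (neg_ne_zero.2 Complex.I_ne_zero)
    (mul_ne_zero (bigOmega_ne_zero _) (hc.add_mul_ne_zero (norm_bigK κ)))

theorem ofReal_two_mul_add_ne_zero (hc : c.IsDispersive) : (2 * (c .a₁ + c .a₂) : ℂ) ≠ 0 :=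
  mul_ne_zero two_ne_zero (by exact_mod_cast hc.add_ne_zero)

/-- The symbol at (1, 1) is 2(a₁ + a₂), which is nonzero. -/
theorem amplitude_one_zero_eq_zero (hc : c.IsDispersive) (h1 : ∀ α, c.W κ (ω κ) u 1 α = 0) :
    u 1 0 = 0 := by
  have := h1 0
  rw [W_one (by decide)] at this
  refine (smul_eq_zero.1 this).resolve_left ?_
  have h := ofReal_two_mul_add_ne_zero hc
  simp only [QPlus.symbol, zpow_zero]
  intro h'
  apply h
  linear_combination h'

theorem eq_neg_div_mul_of_add_eq_zero {a b x y : ℂ} (ha : a ≠ 0) (h : a * x + b * y = 0) :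
    x = -(b / a) * y := by
  rw [← mul_right_inj' ha, neg_mul, mul_neg, ← mul_assoc, mul_div_cancel₀ _ ha]
  exact eq_neg_of_add_eq_zero_left h

/-- Once the first two orders are satisfied, the third order is a transport term for `u_2^{(1)}`
plus the NLS expression in the profile of `u_1^{(1)}`. -/
theorem W_three_one_eq (hc : c.IsDispersive) (hω : c.IsDispersionRelation ω)
    (hr : c.NonResonant ω κ) (hu : u.Admissible) (h1 : ∀ α, c.W κ (ω κ) u 1 α = 0)
    (h2 : ∀ α, c.W κ (ω κ) u 2 α = 0) :
    HasProfile (deriv ω κ) (u 1 1) (fun x t => u 1 1 x 0 t) ∧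
    ∀ n m t, c.W κ (ω κ) u 3 1 n m t = c.nlsFactor ω κ *
      (Complex.I * (deriv ω κ * dn₁ (u 2 1) n m t + dm₁ (u 2 1) n m t) +
        nls (c.nlsDispersion ω κ) (c.nlsNonlinearity ω κ) (fun x t => u 1 1 x 0 t)
          (n - deriv ω κ * m) t) := by
  have h10 := amplitude_one_zero_eq_zero hc h1
  have hv := hω.group_velocity κ
  have hs := hω.2 κ
  have hOm := bigOmega_ne_zero (ω κ)
  have hK := hc.add_mul_ne_zero (norm_bigK κ)
  have hlam := nlsFactor_ne_zero (ω := ω) (κ := κ) hc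
  -- In W_2^{(1)} the amplitude u_2^{(1)} is multiplied by the vanishing symbol; by the group
  -- velocity relation the rest is a nonzero multiple of the transport operator applied to
  -- u_1^{(1)}.
  have hprof : HasProfile (deriv ω κ) (u 1 1) (fun x t => u 1 1 x 0 t) := by
    refine hasProfile_of_transport (hu.1 1 1) fun n m t => ?_
    have h := congrFun (congrFun (congrFun (h2 1) n) m) t
    rw [W_two_one h10 (Or.inl rfl)] at h
    simp only [zpow_one, hs, Pi.add_apply, Pi.smul_apply, smul_eq_mul, hv, zero_smul,
      Pi.zero_apply] at h
    apply mul_left_cancel₀ (mul_ne_zero hOm hK)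
    linear_combination h
  refine ⟨hprof, fun n m t => ?_⟩
  obtain ⟨e1, e2, e3⟩ := hprof.second_derivatives (hu.1 1 1) n m t
  have e4 := hprof.dm₂ n m t
  have hconj : ∀ n m t, u 1 (-1) n m t = conj (u 1 1 n m t) := fun n m t => hu.2 1 1 n m t
  have h20 : u 2 0 n m t = -(c.meanCoeff (bigK κ) (bigOmega (ω κ)) / (2 * (c .a₁ + c .a₂))) *
      (u 1 1 n m t * u 1 (-1) n m t) := by
    have h := congrFun (congrFun (congrFun (h2 0) n) m) t
    rw [W_two_zero h10] at h
    simp only [Pi.add_apply, Pi.smul_apply, smul_eq_mul, Pi.zero_apply, Pi.mul_apply] at h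
    exact eq_neg_div_mul_of_add_eq_zero (ofReal_two_mul_add_ne_zero hc) h
  have h22 : u 2 2 n m t = -(c.secondCoeff (bigK κ) (bigOmega (ω κ)) /
      c.symbol (bigK κ ^ 2) (bigOmega (ω κ) ^ 2)) * u 1 1 n m t ^ 2 := by
    have h := congrFun (congrFun (congrFun (h2 (2 * 1)) n) m) t
    rw [W_two_two h10 (Or.inl rfl)] at h
    simp only [Pi.add_apply, Pi.smul_apply, smul_eq_mul, Pi.zero_apply, Pi.pow_apply,
      mul_one, zpow_ofNat, pow_one] at h
    exact eq_neg_div_mul_of_add_eq_zero hr h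
  have hn : u 1 1 n m t * u 1 (-1) n m t = ((‖u 1 1 n m t‖ ^ 2 : ℝ) : ℂ) := by
    rw [hconj, Complex.mul_conj, Complex.normSq_eq_norm_sq]
  have hp : u 1 1 n m t = u 1 1 (n - deriv ω κ * m) 0 t := hprof n m t
  rw [W_three_one h10, hs]
  simp only [Pi.add_apply, Pi.smul_apply, smul_eq_mul, Pi.mul_apply, Pi.pow_apply, zero_smul,
    Pi.zero_apply, hv, e1, e2, e3, e4, h20, h22]
  rw [nls, ← hp, ← hn, QPlus.nlsNonlinearity, QPlus.nlsDispersion]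
  -- `nlsFactor` contains -i so that the m₂-derivative carries the coefficient i after division.
  have hA : ∀ x : ℂ, c.nlsFactor ω κ * (Complex.I * x) =
      (bigOmega (ω κ) * (c .a₁ * bigK κ + c .a₂)) * x := by
    intro x
    rw [QPlus.nlsFactor]
    linear_combination -(bigOmega (ω κ) * (c .a₁ * bigK κ + c .a₂)) * x * Complex.I_mul_I
  have hB : ∀ x y P d Q e : ℂ, c.nlsFactor ω κ * (Complex.I * x + (Complex.I * y
      + P / c.nlsFactor ω κ * d + Q / c.nlsFactor ω κ * e)) =
      (bigOmega (ω κ) * (c .a₁ * bigK κ + c .a₂)) * (x + y) + P * d + Q * e := by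
    intro x y P d Q e
    rw [mul_add, mul_add, mul_add, hA, hA, ← mul_assoc, mul_div_cancel₀ _ hlam, ← mul_assoc,
      mul_div_cancel₀ _ hlam]
    ring
  rw [hB, QPlus.cubicTotal]
  ring

theorem reducesToNLS_nlsDispersion_nlsNonlinearity (hc : c.IsDispersive)
    (hω : c.IsDispersionRelation ω) (hr : c.NonResonant ω κ) :
    c.ReducesToNLS ω κ (c.nlsDispersion ω κ) (c.nlsNonlinearity ω κ) := by
  refine ⟨c.nlsFactor ω κ, nlsFactor_ne_zero hc, fun u hu h1 h2 ⟨ψ, hψ⟩ => ?_⟩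
  obtain ⟨hp, h3⟩ := W_three_one_eq hc hω hr hu h1 h2
  refine ⟨_, hp, fun n m t => ?_⟩
  rw [h3, hψ.dm₁_eq (hu.1 2 1)]
  ring

/-- W_3^{(1)} = 0 is a transport equation for u_2^{(1)} whose source, i times the NLS expression,
depends only on ξ and m₂. A nonzero source would cause growth linear in m₁. -/
theorem hasProfile_of_bounded (hc : c.IsDispersive) (hω : c.IsDispersionRelation ω)
    (hr : c.NonResonant ω κ) (hu : u.Admissible) (hb : u.Bounded)
    (h1 : ∀ α, c.W κ (ω κ) u 1 α = 0) (h2 : ∀ α, c.W κ (ω κ) u 2 α = 0)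
    (h3 : c.W κ (ω κ) u 3 1 = 0) :
    (∃ ψ, HasProfile (deriv ω κ) (u 2 1) ψ) ∧
      ∃ φ, HasProfile (deriv ω κ) (u 1 1) φ ∧
        ∀ x t, nls (c.nlsDispersion ω κ) (c.nlsNonlinearity ω κ) φ x t = 0 := by
  obtain ⟨hp, hW⟩ := W_three_one_eq hc hω hr hu h1 h2
  set N := nls (c.nlsDispersion ω κ) (c.nlsNonlinearity ω κ) (fun x t => u 1 1 x 0 t) with hN
  have htr : ∀ n m t, (deriv ω κ : ℝ) * dn₁ (u 2 1) n m t + dm₁ (u 2 1) n m t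
      = Complex.I * N (n - deriv ω κ * m) t := by
    intro n m t
    have h := hW n m t
    rw [h3] at h
    have h' := (mul_eq_zero.1 h.symm).resolve_left (nlsFactor_ne_zero hc)
    linear_combination -Complex.I * h' +
      ((deriv ω κ : ℝ) * dn₁ (u 2 1) n m t + dm₁ (u 2 1) n m t) * Complex.I_mul_I
  have hsol := eq_add_mul_of_transport (hu.1 2 1) (g := fun x t => Complex.I * N x t) htr
  obtain ⟨M, hM⟩ := hb 2 1
  have hzero : ∀ x t, N x t = 0 := by
    intro x t
    by_contra hne
    have hpos : 0 < ‖N x t‖ := norm_pos_iff.2 hne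
    have hM0 : 0 ≤ M := (norm_nonneg _).trans (hM 0 0 0)
    -- At this time the secular term has norm 2M + 1, more than two values bounded by M can differ.
    set m : ℝ := (2 * M + 1) / ‖N x t‖ with hm
    have h := hsol (x + deriv ω κ * m) m t
    rw [show x + deriv ω κ * m - deriv ω κ * m = x by ring] at h
    have h' : (m : ℂ) * (Complex.I * N x t) =
        u 2 1 (x + deriv ω κ * m) m t - u 2 1 x 0 t := by rw [h]; ring
    have hn := congrArg norm h'
    rw [norm_mul, norm_mul, Complex.norm_I, one_mul, Complex.norm_real, Real.norm_eq_abs,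
      abs_of_nonneg (by positivity), hm, div_mul_cancel₀ _ hpos.ne'] at hn
    have := norm_sub_le (u 2 1 (x + deriv ω κ * m) m t) (u 2 1 x 0 t)
    have i1 := hM (x + deriv ω κ * m) m t
    have i2 := hM x 0 t
    linarith
  refine ⟨⟨_, hasProfile_of_transport (hu.1 2 1) fun n m t => ?_⟩, _, hp, hzero⟩
  rw [htr, hzero, mul_zero]

end

section

open ComplexConjugate

variable {c : QPlus} {ω : ℝ → ℝ} {κ : ℝ} {u : Amplitudes}

/-! ### Amplitudes with a prescribed first harmonic -/

/-- Amplitudes with first harmonic `f` whose zeroth and second harmonics at order `ε²` are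
`A f²` and `B f²`. -/
def slavedAmplitudes (A B : ℂ) (f : Slow) : Amplitudes := fun ℓ α =>
  if ℓ = 1 ∧ (α = 1 ∨ α = -1) then f
  else if ℓ = 2 ∧ α = 0 then A • f ^ 2
  else if ℓ = 2 ∧ α = 2 then B • f ^ 2
  else if ℓ = 2 ∧ α = -2 then conj B • f ^ 2
  else 0

theorem slavedAmplitudes_admissible {A B : ℂ} {f : Slow} (hA : conj A = A) (hf : SmoothSlow f)
    (hreal : ∀ n m t, conj (f n m t) = f n m t) : (slavedAmplitudes A B f).Admissible := by
  have hsq : ∀ a : ℂ, SmoothSlow (a • f ^ 2) := fun a => (ContDiff.pow hf 2).const_smul a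
  refine ⟨fun ℓ α => ?_, fun ℓ α n m t => ?_⟩
  · change SmoothSlow (slavedAmplitudes A B f ℓ α)
    unfold slavedAmplitudes
    split_ifs
    · exact hf
    · exact hsq A
    · exact hsq B
    · exact hsq (conj B)
    · exact contDiff_const
  · have e1 : (-α = 1 ∨ -α = -1) ↔ (α = 1 ∨ α = -1) := by omega
    have e2 : (-α = 0) ↔ α = 0 := by omega
    have e3 : (-α = 2) ↔ α = -2 := by omega
    have e4 : (-α = -2) ↔ α = 2 := by omega
    unfold slavedAmplitudes
    simp only [e1, e2, e3, e4]
    by_cases h1 : ℓ = 1 ∧ (α = 1 ∨ α = -1)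
    · simp [h1, hreal]
    · by_cases h2 : ℓ = 2 ∧ α = 0
      · simp [h2, hreal, hA]
      · by_cases h3 : ℓ = 2 ∧ α = 2
        · simp [h3, hreal]
        · by_cases h4 : ℓ = 2 ∧ α = -2
          · simp [h4, hreal]
          · simp only [h1, h2, h3, h4, if_false]
            simp

theorem conj_meanCoeff (c : QPlus) (κ w : ℝ) :
    conj (c.meanCoeff (bigK κ) (bigOmega w)) = c.meanCoeff (bigK κ) (bigOmega w) := by
  simp only [QPlus.meanCoeff, QPlus.quadSum, map_add, map_mul, map_sub, map_inv₀, conj_bigK,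
    conj_bigOmega, Complex.conj_ofReal, map_one, inv_inv, mul_inv, inv_one]
  ring

theorem conj_secondCoeff (c : QPlus) (κ w : ℝ) :
    conj (c.secondCoeff (bigK κ) (bigOmega w)) = c.secondCoeff (bigK κ)⁻¹ (bigOmega w)⁻¹ := by
  simp only [QPlus.secondCoeff, QPlus.quadSum, map_add, map_mul, map_sub, conj_bigK,
    conj_bigOmega, Complex.conj_ofReal, map_one]

theorem conj_symbol (c : QPlus) (κ w : ℝ) (j : ℕ) :
    conj (c.symbol (bigK κ ^ j) (bigOmega w ^ j)) =
      c.symbol ((bigK κ)⁻¹ ^ j) ((bigOmega w)⁻¹ ^ j) := by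
  simp only [QPlus.symbol, map_add, map_mul, map_pow, conj_bigK,
    conj_bigOmega, Complex.conj_ofReal, map_one]

/-- Every real smooth profile is the first harmonic of amplitudes satisfying the first two
orders. -/
theorem exists_amplitudes (hc : c.IsDispersive) (hω : c.IsDispersionRelation ω)
    (hr : c.NonResonant ω κ) {f : Slow} (hf : SmoothSlow f)
    (hreal : ∀ n m t, conj (f n m t) = f n m t) {φ : ℝ → ℝ → ℂ}
    (hp : HasProfile (deriv ω κ) f φ) :
    ∃ u : Amplitudes, u.Admissible ∧ (∀ α, c.W κ (ω κ) u 1 α = 0) ∧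
      (∀ α, c.W κ (ω κ) u 2 α = 0) ∧ u 1 1 = f ∧ u 2 1 = 0 := by
  set A : ℂ := -(c.meanCoeff (bigK κ) (bigOmega (ω κ)) / (2 * (c .a₁ + c .a₂))) with hA
  set B : ℂ := -(c.secondCoeff (bigK κ) (bigOmega (ω κ)) /
      c.symbol (bigK κ ^ 2) (bigOmega (ω κ) ^ 2)) with hB
  have hAr : conj A = A := by
    rw [hA, map_neg, map_div₀, conj_meanCoeff, map_mul, map_add, Complex.conj_ofReal,
      Complex.conj_ofReal, Complex.conj_ofNat]
  have hs := hω.2 κ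
  have hv := hω.group_velocity κ
  -- The coefficients are real, so conjugation carries the dispersion relation and the group
  -- velocity relation over to the harmonic -1.
  have hs' : c.symbol (bigK κ)⁻¹ (bigOmega (ω κ))⁻¹ = 0 := by
    have := conj_symbol c κ (ω κ) 1
    simp only [pow_one] at this
    rw [← this, hs, map_zero]
  have hv' : (bigK κ)⁻¹ * (c .a₁ * (bigOmega (ω κ))⁻¹ + c .a₂)
      = deriv ω κ * ((bigOmega (ω κ))⁻¹ * (c .a₁ * (bigK κ)⁻¹ + c .a₂)) := by
    have := congrArg conj hv
    simpa only [map_mul, map_add, conj_bigK, conj_bigOmega, Complex.conj_ofReal] using this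
  have hdm : dm₁ f = (-(deriv ω κ : ℝ) : ℂ) • dn₁ f := by
    funext n m t; exact hp.dm₁_eq hf n m t
  have h10 : slavedAmplitudes A B f 1 0 = 0 := by simp [slavedAmplitudes]
  have h11 : slavedAmplitudes A B f 1 1 = f := by simp [slavedAmplitudes]
  have h11' : slavedAmplitudes A B f 1 (-1) = f := by simp [slavedAmplitudes]
  have h20 : slavedAmplitudes A B f 2 0 = A • f ^ 2 := by simp [slavedAmplitudes]
  have h21 : slavedAmplitudes A B f 2 1 = 0 := by simp [slavedAmplitudes]
  have h21' : slavedAmplitudes A B f 2 (-1) = 0 := by simp [slavedAmplitudes]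
  have h22 : slavedAmplitudes A B f 2 2 = B • f ^ 2 := by simp [slavedAmplitudes]
  have h22' : slavedAmplitudes A B f 2 (-2) = conj B • f ^ 2 := by simp [slavedAmplitudes]
  refine ⟨slavedAmplitudes A B f, slavedAmplitudes_admissible hAr hf hreal, fun α => ?_,
    fun α => ?_, h11, h21⟩
  · by_cases hα : α.natAbs ≤ 1
    · rw [W_one hα]
      have : α = 0 ∨ α = 1 ∨ α = -1 := by omega
      rcases this with rfl | rfl | rfl
      · rw [h10, smul_zero]
      · rw [zpow_one, zpow_one, hs, zero_smul]
      · rw [zpow_neg_one, zpow_neg_one, hs', zero_smul]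
    · exact W_one_of_lt (by omega)
  · by_cases hα : α.natAbs ≤ 2
    · have : α = 0 ∨ α = 1 ∨ α = -1 ∨ α = 2 ∨ α = -2 := by omega
      rcases this with rfl | rfl | rfl | rfl | rfl
      · rw [W_two_zero h10, h20, h11, h11', hA, smul_smul, ← pow_two, ← add_smul, mul_neg,
          mul_div_cancel₀ _ (ofReal_two_mul_add_ne_zero hc), neg_add_cancel, zero_smul]
      · rw [W_two_one h10 (Or.inl rfl), h21, h11, zpow_one, zpow_one, hv, hdm]
        module
      · rw [W_two_one h10 (Or.inr rfl), h21', h11', zpow_neg_one, zpow_neg_one, hv', hdm]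
        module
      · have h := W_two_two (c := c) (κ := κ) (w := ω κ) h10 (Or.inl rfl)
        simp only [mul_one, zpow_one, h22, h11] at h
        rw [h, hB, smul_smul, ← add_smul, mul_neg]
        norm_cast
        rw [mul_div_cancel₀ _ hr, neg_add_cancel, zero_smul]
      · have h := W_two_two (c := c) (κ := κ) (w := ω κ) h10 (Or.inr rfl)
        have hsy := conj_symbol c κ (ω κ) 2
        simp only [inv_pow] at hsy
        have hz : ∀ z : ℂ, z ^ (2 * -1 : ℤ) = (z ^ 2)⁻¹ := fun z => by
          rw [show (2 * -1 : ℤ) = -(2 : ℕ) by norm_num, zpow_neg, zpow_natCast]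
        have hne : conj (c.symbol (bigK κ ^ 2) (bigOmega (ω κ) ^ 2)) ≠ 0 :=
          (map_ne_zero _).2 hr
        simp only [hz, zpow_neg_one, h11', ← hsy, ← conj_secondCoeff] at h
        rw [show (2 * -1 : ℤ) = -2 by norm_num, h22'] at h
        rw [h, hB, smul_smul, ← add_smul, map_neg, map_div₀, mul_neg, mul_div_cancel₀ _ hne,
          neg_add_cancel, zero_smul]
    · exact W_two_of_lt (by omega)

/-- Real profiles suffice. At the origin the profile t leaves only the time derivative and shows
that the two factors agree; then x² isolates ρ₁ and the constant 1 isolates ρ₂. -/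
theorem reducesToNLS_unique (hc : c.IsDispersive) (hω : c.IsDispersionRelation ω)
    (hr : c.NonResonant ω κ) {ρ₁ ρ₂ σ₁ σ₂ : ℂ} (hρ : c.ReducesToNLS ω κ ρ₁ ρ₂)
    (hσ : c.ReducesToNLS ω κ σ₁ σ₂) : ρ₁ = σ₁ ∧ ρ₂ = σ₂ := by
  obtain ⟨l, hl, h⟩ := hρ
  obtain ⟨l', hl', h'⟩ := hσ
  have key : ∀ g : ℝ → ℝ → ℝ, ContDiff ℝ ((⊤ : ℕ∞) : WithTop ℕ∞) (fun p : ℝ × ℝ => g p.1 p.2) →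
      ∀ x t, l * nls ρ₁ ρ₂ (fun x t => (g x t : ℂ)) x t
        = l' * nls σ₁ σ₂ (fun x t => (g x t : ℂ)) x t := by
    intro g hg x t
    have hf : SmoothSlow fun n m t => (g (n - deriv ω κ * m) t : ℂ) := by
      have : ContDiff ℝ ((⊤ : ℕ∞) : WithTop ℕ∞)
          (fun p : ℝ × ℝ × ℝ => (p.1 - deriv ω κ * p.2.1, p.2.2)) := by fun_prop
      exact Complex.ofRealCLM.contDiff.comp (hg.comp this)
    obtain ⟨u, hu, h1, h2, h11, h21⟩ := exists_amplitudes hc hω hr hf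
      (fun n m t => Complex.conj_ofReal _) (φ := fun x t => (g x t : ℂ)) (fun n m t => rfl)
    have hψ : ∃ ψ, HasProfile (deriv ω κ) (u 2 1) ψ := ⟨0, fun n m t => by rw [h21]; rfl⟩
    obtain ⟨φ, hφ, e⟩ := h u hu h1 h2 hψ
    obtain ⟨φ', hφ', e'⟩ := h' u hu h1 h2 hψ
    have E : ∀ {φ : ℝ → ℝ → ℂ}, HasProfile (deriv ω κ) (u 1 1) φ →
        φ = fun x t => (g x t : ℂ) := by
      intro φ hφ
      rw [hφ.eq_zero_slice, h11]
      simp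
    rw [E hφ] at e
    rw [E hφ'] at e'
    have := (e x 0 t).symm.trans (e' x 0 t)
    simpa using this
  have hll : l = l' := by
    have := key (fun x t => t) (by fun_prop) 0 0
    have hd : deriv (fun s : ℝ => (s : ℂ)) 0 = 1 := by
      rw [(hasDerivAt_id' (0 : ℝ)).ofReal_comp.deriv, Complex.ofReal_one]
    simp only [nls, hd, iteratedDeriv_succ, iteratedDeriv_zero] at this
    simp at this
    exact this
  subst hll
  constructor
  · have := key (fun x t => x ^ 2) (by fun_prop) 0 0
    have hd : iteratedDeriv 2 (fun y : ℝ => ((y ^ 2 : ℝ) : ℂ)) 0 = 2 := by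
      have h1 : deriv (fun y : ℝ => ((y ^ 2 : ℝ) : ℂ)) = fun y : ℝ => 2 * (y : ℂ) := by
        funext y
        have := ((hasDerivAt_pow 2 y).ofReal_comp).deriv
        rw [this]
        simp
      rw [iteratedDeriv_succ, iteratedDeriv_one, h1]
      have := (Complex.ofRealCLM.hasDerivAt (x := (0 : ℝ))).const_mul (2 : ℂ)
      simpa using this.deriv
    simp only [nls, hd, deriv_const] at this
    simpa [hl] using this
  · have := key (fun x t => 1) (by fun_prop) 0 0
    simp only [nls, iteratedDeriv_succ, iteratedDeriv_zero, deriv_const] at this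
    simpa [hl] using this

end

/-! ### The dispersive coefficient and existence of the dispersion relation -/

section

open ComplexConjugate

variable {c : QPlus} {ω : ℝ → ℝ} {κ : ℝ}

theorem bigOmega_eq (hc : c.IsDispersive) (hω : c.IsDispersionRelation ω) (κ : ℝ) :
    bigOmega (ω κ) = -(c .a₁ + c .a₂ * bigK κ) / (c .a₁ * bigK κ + c .a₂) := by
  rw [eq_div_iff (hc.add_mul_ne_zero (norm_bigK κ))]
  have := hω.2 κ
  rw [QPlus.symbol] at this
  linear_combination this

theorem QPlus.IsDispersive.add_mul_ne_zero' (hc : c.IsDispersive) {z : ℂ} (hz : ‖z‖ = 1) :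
    (c .a₁ + c .a₂ * z : ℂ) ≠ 0 := by
  intro h
  apply hc.2.2
  have h1 := congrArg norm (eq_neg_of_add_eq_zero_left h)
  simpa [hz] using h1

/-- All quantities are rational in K: Ω is solved from the dispersion relation, ω' from the group
velocity relation, and a₁² + a₂² + 2 a₁ a₂ cos κ factors as (a₁ K + a₂)(a₁ + a₂ K)/K. -/
theorem nlsDispersion_eq (hc : c.IsDispersive) (hω : c.IsDispersionRelation ω) :
    c.nlsDispersion ω κ = ((c .a₁ * c .a₂ * (c .a₁ ^ 2 - c .a₂ ^ 2) * Real.sin κ /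
      (c .a₁ ^ 2 + c .a₂ ^ 2 + 2 * c .a₁ * c .a₂ * Real.cos κ) ^ 2 : ℝ) : ℂ) := by
  have hO := bigOmega_eq hc hω κ
  have hA := hc.add_mul_ne_zero (norm_bigK κ)
  have hb := hc.add_mul_ne_zero' (norm_bigK κ)
  have hK := bigK_ne_zero κ
  have hI := Complex.I_ne_zero
  have hinv : (bigK κ)⁻¹ = Complex.cos κ - Complex.sin κ * Complex.I := by
    rw [← conj_bigK, bigK_eq]
    simp [← Complex.ofReal_cos, ← Complex.ofReal_sin, sub_eq_add_neg]
  have hcos : Complex.cos κ = (bigK κ + (bigK κ)⁻¹) / 2 := by rw [hinv, bigK_eq]; ring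
  have hsin : Complex.sin κ = (bigK κ - (bigK κ)⁻¹) / (2 * Complex.I) := by
    rw [hinv, bigK_eq]; field_simp; ring
  have hG : (c .a₁ ^ 2 + c .a₂ ^ 2 + 2 * c .a₁ * c .a₂ * Complex.cos κ : ℂ) =
      (c .a₁ * bigK κ + c .a₂) * (c .a₁ + c .a₂ * bigK κ) / bigK κ := by
    rw [hcos]; field_simp; ring
  have hv : ((deriv ω κ : ℝ) : ℂ) = bigK κ * (c .a₁ ^ 2 - c .a₂ ^ 2) /
      ((c .a₁ * bigK κ + c .a₂) * (c .a₁ + c .a₂ * bigK κ)) := by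
    have h := hω.group_velocity κ
    have e1 : bigOmega (ω κ) * (c .a₁ * bigK κ + c .a₂) = -(c .a₁ + c .a₂ * bigK κ) := by
      rw [hO, div_mul_cancel₀ _ hA]
    rw [eq_div_iff (mul_ne_zero hA hb)]
    rw [e1] at h
    linear_combination (c .a₁ * bigK κ + c .a₂) * h - bigK κ * c .a₁ * e1
  push_cast
  rw [hG, hsin, QPlus.nlsDispersion, QPlus.nlsFactor, hv, hO]
  set A : ℂ := c .a₁ * bigK κ + c .a₂ with hA'
  set b : ℂ := c .a₁ + c .a₂ * bigK κ with hb'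
  field_simp
  rw [hA', hb']
  ring

/-- The argument of `1 + β e^{iκ}` for `|β| < 1`, as a differentiable function. -/
theorem exists_differentiable_arg {β : ℝ} (hβ : |β| < 1) :
    ∃ θ : ℝ → ℝ, Differentiable ℝ θ ∧ ∀ κ : ℝ,
      Complex.exp (2 * (θ κ * Complex.I)) * (1 + β * (bigK κ)⁻¹) = 1 + β * bigK κ := by
  -- As |β| < 1, the curve stays in the right half-plane, where the principal logarithm is
  -- differentiable; θ is its imaginary part.
  have hre : ∀ κ : ℝ, 0 < (1 + β * bigK κ : ℂ).re := by
    intro κ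
    have h1 : |(β * bigK κ : ℂ).re| ≤ |β| := by
      refine (Complex.abs_re_le_norm _).trans ?_
      rw [norm_mul, norm_bigK, mul_one, Complex.norm_real, Real.norm_eq_abs]
    have := (abs_le.1 h1).1
    rw [Complex.add_re, Complex.one_re]
    linarith
  refine ⟨fun κ => (Complex.log (1 + β * bigK κ)).im, fun κ => ?_, fun κ => ?_⟩
  · have hK : DifferentiableAt ℝ bigK κ := by
      have h1 : DifferentiableAt ℝ (fun κ : ℝ => Complex.I * (κ : ℂ)) κ :=
        Complex.ofRealCLM.differentiableAt.const_mul Complex.I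
      exact h1.cexp
    have h2 : DifferentiableAt ℝ (fun κ => 1 + β * bigK κ) κ := (hK.const_mul (β : ℂ)).const_add 1
    have h3 : DifferentiableAt ℝ (fun κ => Complex.log (1 + β * bigK κ)) κ :=
      (h2.hasDerivAt.clog_real (Or.inl (hre κ))).differentiableAt
    exact Complex.imCLM.differentiableAt.comp κ h3
  · set z : ℂ := 1 + β * bigK κ with hz
    have hc : (1 + β * (bigK κ)⁻¹ : ℂ) = conj z := by
      rw [hz, map_add, map_mul, conj_bigK, Complex.conj_ofReal, map_one]
    have h1 : (‖z‖ : ℂ) * Complex.exp (z.arg * Complex.I) = z := Complex.norm_mul_exp_arg_mul_I z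
    have h2 : conj z = ‖z‖ * Complex.exp (-(z.arg * Complex.I)) := by
      conv_lhs => rw [← h1]
      rw [map_mul, ← Complex.exp_conj]
      simp
    change Complex.exp (2 * ((Complex.log z).im * Complex.I)) * _ = z
    rw [hc, h2, Complex.log_im, mul_left_comm, ← Complex.exp_add]
    conv_rhs => rw [← h1]
    ring_nf

/-- In Ω = -(a₁ + a₂ K)/(a₁ K + a₂) the larger coefficient is factored out. This gives Ω = -K
e^{-2iθ} if |a₁| < |a₂|, and Ω = -K⁻¹ e^{2iθ} otherwise, where e^{2iθ} is the quotient of 1 + βK and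
its conjugate. -/
theorem exists_dispersionRelation (hc : c.IsDispersive) : ∃ ω, c.IsDispersionRelation ω := by
  obtain ⟨h1, h2, h3⟩ := hc
  have hpi : Complex.exp (-(Complex.I * Real.pi)) = -1 := by
    rw [Complex.exp_neg, mul_comm, Complex.exp_pi_mul_I]; norm_num
  rcases lt_or_gt_of_ne h3 with h | h
  · obtain ⟨θ, hθ, e⟩ := exists_differentiable_arg (β := c .a₁ / c .a₂)
      (by rw [abs_div, div_lt_one (abs_pos.2 h2)]; exact h)
    refine ⟨fun κ => -κ + Real.pi + 2 * θ κ, by fun_prop, fun κ => ?_⟩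
    have hO : bigOmega (-κ + Real.pi + 2 * θ κ) =
        -1 * (bigK κ * (Complex.exp (2 * (θ κ * Complex.I)))⁻¹) := by
      rw [← hpi, bigK, ← Complex.exp_neg, ← Complex.exp_add, ← Complex.exp_add, bigOmega]
      congr 1
      push_cast
      ring
    have hE : Complex.exp (2 * (θ κ * Complex.I)) ≠ 0 := Complex.exp_ne_zero _
    have hK := bigK_ne_zero κ
    have h2' : (c .a₂ : ℂ) ≠ 0 := by exact_mod_cast h2
    have e' := e κ
    push_cast at e'
    rw [QPlus.symbol, hO]
    set E := Complex.exp (2 * (θ κ * Complex.I))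
    field_simp at e' ⊢
    linear_combination e'
  · obtain ⟨θ, hθ, e⟩ := exists_differentiable_arg (β := c .a₂ / c .a₁)
      (by rw [abs_div, div_lt_one (abs_pos.2 h1)]; exact h)
    refine ⟨fun κ => κ + Real.pi - 2 * θ κ, by fun_prop, fun κ => ?_⟩
    have hO : bigOmega (κ + Real.pi - 2 * θ κ) =
        -1 * ((bigK κ)⁻¹ * Complex.exp (2 * (θ κ * Complex.I))) := by
      rw [← hpi, bigK, ← Complex.exp_neg, ← Complex.exp_add, ← Complex.exp_add, bigOmega]
      congr 1
      push_cast
      ring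
    have hK := bigK_ne_zero κ
    have h1' : (c .a₁ : ℂ) ≠ 0 := by exact_mod_cast h1
    have e' := e κ
    push_cast at e'
    rw [QPlus.symbol, hO]
    set E := Complex.exp (2 * (θ κ * Complex.I))
    field_simp at e' ⊢
    linear_combination -e'

end

section

/-! ### The reality condition as a system of polynomial equations -/

/-- The adjugate multiplies the system into determinant times unknown, so a nonzero kernel vector
makes the determinant vanish. -/
theorem det_three_eq_zero {m₁₁ m₁₂ m₁₃ m₂₁ m₂₂ m₂₃ m₃₁ m₃₂ m₃₃ a b g : ℝ}
    (h₁ : m₁₁ * a + m₁₂ * b + m₁₃ * g = 0) (h₂ : m₂₁ * a + m₂₂ * b + m₂₃ * g = 0)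
    (h₃ : m₃₁ * a + m₃₂ * b + m₃₃ * g = 0) (h : ¬(a = 0 ∧ b = 0 ∧ g = 0)) :
    m₁₁ * (m₂₂ * m₃₃ - m₂₃ * m₃₂) - m₁₂ * (m₂₁ * m₃₃ - m₂₃ * m₃₁)
      + m₁₃ * (m₂₁ * m₃₂ - m₂₂ * m₃₁) = 0 := by
  by_contra hd
  refine h ⟨?_, ?_, ?_⟩
  · refine (mul_eq_zero.1 ?_).resolve_left hd
    linear_combination (m₂₂ * m₃₃ - m₂₃ * m₃₂) * h₁ - (m₁₂ * m₃₃ - m₁₃ * m₃₂) * h₂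
      + (m₁₂ * m₂₃ - m₁₃ * m₂₂) * h₃
  · refine (mul_eq_zero.1 ?_).resolve_left hd
    linear_combination -(m₂₁ * m₃₃ - m₂₃ * m₃₁) * h₁ + (m₁₁ * m₃₃ - m₁₃ * m₃₁) * h₂
      - (m₁₁ * m₂₃ - m₁₃ * m₂₁) * h₃
  · refine (mul_eq_zero.1 ?_).resolve_left hd
    linear_combination (m₂₁ * m₃₂ - m₂₂ * m₃₁) * h₁ - (m₁₁ * m₃₂ - m₁₂ * m₃₁) * h₂
      + (m₁₁ * m₂₂ - m₁₂ * m₂₁) * h₃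

/-- The bilinear equations between `(α₂, β₂) = (A, B)` and the Möbius-reduced coefficients
`a, b, g` that are left after elimination of the cubic coefficients. -/
def BilinearSystem (r A B a b g : ℝ) : Prop :=
  (-A * (1 + r ^ 2) + 4 * B * r) * a + (4 * A - 6 * B * r) * b
    + (A * (4 + r ^ 2) - B * r) * g = 0 ∧
  (A * (3 - r ^ 4) + 4 * B * r) * a + (4 * A * r ^ 2 - B * r * (9 + r ^ 2)) * b
    + (A * (r ^ 4 - 6 * r ^ 2) + B * r * (7 + 2 * r ^ 2)) * g = 0 ∧
  (A * r * (9 + r ^ 2) - 4 * B * r ^ 2) * a + (-4 * A * r + B * (r ^ 4 - 3)) * b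
    + (-A * r * (7 + 2 * r ^ 2) + B * (6 * r ^ 2 - r ^ 4)) * g = 0 ∧
  (6 * A * r - 4 * B) * a + (-4 * A * r + B * (1 + r ^ 2)) * b
    + (A * r - B * (4 + r ^ 2)) * g = 0

/-- These are the minor conditions for A = B. The first factors as (r - 1)²(r + 3)(r² - 10r + 5);
modulo the quadratic factor the second becomes linear, with a rational root that is not a root of
the quadratic. -/
theorem eq_neg_three_of_equal {r : ℝ} (hr1 : r ≠ 1)
    (hs : 15 + 58 * r ^ 2 - 9 * r ^ 4 = r * (55 + 10 * r ^ 2 - r ^ 4))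
    (hm : -9 + 74 * r ^ 2 - r ^ 4 + r * (-24 - 39 * r ^ 2 - 2 * r ^ 4 + r ^ 6) = 0) :
    r = -3 := by
  have h : (r - 1) ^ 2 * ((r + 3) * (r ^ 2 - 10 * r + 5)) = 0 := by linear_combination hs
  rcases mul_eq_zero.1 ((mul_eq_zero.1 h).resolve_left (pow_ne_zero 2 (sub_ne_zero.2 hr1)))
    with h | h
  · linarith
  · exfalso
    have h1 : 743936 * r = 392704 := by
      linear_combination hm - (r ^ 5 + 10 * r ^ 4 + 93 * r ^ 3 + 879 * r ^ 2 + 8286 * r + 78539) * h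
    have h2 : r = 392704 / 743936 := by linarith
    rw [h2] at h
    norm_num at h

/-- For fixed (A, B) this is a linear system of four equations in (a, b, g). If B = rA or A = rB,
the first and last equations determine a and b from g. Otherwise a nonzero (a, b, g) makes the
minors vanish, which, after their common factor is cancelled, leaves linear relations between A and
B that are compatible only for A = ±B and r = ∓3. Exchanging A with B and a with b maps each
equation to the negative of another, in reverse order; this is the exchange of the lattice
directions. -/
theorem BilinearSystem.solutions {r A B a b g : ℝ} (hr0 : r ≠ 0) (hr1 : r ≠ 1) (hr2 : r ≠ -1)
    (h : BilinearSystem r A B a b g) :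
    (A = 0 ∧ B = 0) ∨ (a = 0 ∧ b = 0 ∧ g = 0) ∨
    (B = r * A ∧ (r ^ 2 - 1) * a = 2 * r ^ 2 * g ∧ (r ^ 2 - 1) * b = (r ^ 2 + 1) * g) ∨
    (A = r * B ∧ (r ^ 2 - 1) * a = (r ^ 2 + 1) * g ∧ (r ^ 2 - 1) * b = 2 * r ^ 2 * g) ∨
    (r = -3 ∧ A = B ∧ a = b ∧ g = 0) ∨ (r = 3 ∧ A = -B ∧ a = b ∧ g = 0) := by
  obtain ⟨e₁, e₂, e₃, e₄⟩ := h
  by_cases hAB : A = 0 ∧ B = 0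
  · exact Or.inl hAB
  by_cases hv : a = 0 ∧ b = 0 ∧ g = 0
  · exact Or.inr (Or.inl hv)
  -- In both special cases the determinant of the 2 × 2 system for a and b is (3r² + 5)(r² - 1).
  have hpos : 3 * r ^ 2 + 5 ≠ 0 := by positivity
  by_cases h5 : B = r * A
  · have hA : A ≠ 0 := fun h => hAB ⟨h, by rw [h5, h, mul_zero]⟩
    subst h5
    have f₁ : (3 * r ^ 2 - 1) * a + (4 - 6 * r ^ 2) * b + 4 * g = 0 := by
      apply mul_left_cancel₀ hA
      linear_combination e₁
    have f₄ : 2 * a + (r ^ 2 - 3) * b - (3 + r ^ 2) * g = 0 := by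
      apply mul_left_cancel₀ (mul_ne_zero hA hr0)
      linear_combination e₄
    refine Or.inr (Or.inr (Or.inl ⟨rfl, ?_, ?_⟩))
    · apply mul_left_cancel₀ hpos
      linear_combination (r ^ 2 - 3) * f₁ - (4 - 6 * r ^ 2) * f₄
    · apply mul_left_cancel₀ hpos
      linear_combination -2 * f₁ + (3 * r ^ 2 - 1) * f₄
  by_cases h6 : A = r * B
  · have hB : B ≠ 0 := fun h => hAB ⟨by rw [h6, h, mul_zero], h⟩
    subst h6
    have f₁ : (3 - r ^ 2) * a - 2 * b + (3 + r ^ 2) * g = 0 := by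
      apply mul_left_cancel₀ (mul_ne_zero hB hr0)
      linear_combination e₁
    have f₄ : (6 * r ^ 2 - 4) * a + (1 - 3 * r ^ 2) * b - 4 * g = 0 := by
      apply mul_left_cancel₀ hB
      linear_combination e₄
    refine Or.inr (Or.inr (Or.inr (Or.inl ⟨rfl, ?_, ?_⟩)))
    · apply mul_left_cancel₀ hpos
      linear_combination (1 - 3 * r ^ 2) * f₁ + 2 * f₄
    · apply mul_left_cancel₀ hpos
      linear_combination -(6 * r ^ 2 - 4) * f₁ + (3 - r ^ 2) * f₄
  have hprod : (B - r * A) * (A - r * B) ≠ 0 :=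
    mul_ne_zero (sub_ne_zero.2 h5) (sub_ne_zero.2 h6)
  -- Each minor is a cubic form in A and B, equal to 4(B - rA)(A - rB) times a linear form.
  have l₁ : (-9 + 74 * r ^ 2 - r ^ 4) * A + r * (-24 - 39 * r ^ 2 - 2 * r ^ 4 + r ^ 6) * B = 0 := by
    apply mul_left_cancel₀ hprod
    linear_combination (1 / 4) * det_three_eq_zero e₁ e₂ e₃ hv
  have l₂ : (15 + 58 * r ^ 2 - 9 * r ^ 4) * A = r * (55 + 10 * r ^ 2 - r ^ 4) * B := by
    apply mul_left_cancel₀ hprod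
    linear_combination (1 / 4) * det_three_eq_zero e₁ e₂ e₄ hv
  have l₃ : r * (55 + 10 * r ^ 2 - r ^ 4) * A = (15 + 58 * r ^ 2 - 9 * r ^ 4) * B := by
    apply mul_left_cancel₀ hprod
    linear_combination (1 / 4) * det_three_eq_zero e₁ e₃ e₄ hv
  set s := 15 + 58 * r ^ 2 - 9 * r ^ 4 with hs
  set t := r * (55 + 10 * r ^ 2 - r ^ 4) with ht
  by_cases hsum : A = -B
  · have hB : B ≠ 0 := fun h => hAB ⟨by rw [hsum, h, neg_zero], h⟩
    subst hsum
    -- Changing the signs of r and B together preserves the relations between A and B, so A = -B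
    -- reduces to A = B with -r in place of r.
    have hr3 : -r = -3 := by
      refine eq_neg_three_of_equal (fun h => hr2 (by linarith)) ?_ ?_
      · apply mul_left_cancel₀ hB
        linear_combination -l₂
      · apply mul_left_cancel₀ hB
        linear_combination -l₁
    have hr3' : r = 3 := by linarith
    subst hr3'
    have f₁ : 22 * a - 22 * b - 16 * g = 0 := by
      apply mul_left_cancel₀ hB
      linear_combination e₁
    have f₄ : 22 * a - 22 * b + 16 * g = 0 := by
      apply mul_left_cancel₀ hB
      linear_combination -e₄
    exact Or.inr (Or.inr (Or.inr (Or.inr (Or.inr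
      ⟨rfl, rfl, by linarith, by linarith⟩))))
  by_cases hdiff : A = B
  · have hB : B ≠ 0 := fun h => hAB ⟨by rw [hdiff, h], h⟩
    subst hdiff
    have hr3 : r = -3 := by
      refine eq_neg_three_of_equal hr1 ?_ ?_
      · apply mul_left_cancel₀ hB
        linear_combination l₂
      · apply mul_left_cancel₀ hB
        linear_combination l₁
    subst hr3
    have f₁ : 22 * a - 22 * b - 16 * g = 0 := by
      apply mul_left_cancel₀ hB
      linear_combination -e₁
    have f₄ : 22 * a - 22 * b + 16 * g = 0 := by
      apply mul_left_cancel₀ hB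
      linear_combination -e₄
    exact Or.inr (Or.inr (Or.inr (Or.inr (Or.inl
      ⟨rfl, rfl, by linarith, by linarith⟩))))
  exfalso
  have hst : s - t = 0 := by
    have : A + B ≠ 0 := fun h => hsum (eq_neg_of_add_eq_zero_left h)
    refine (mul_eq_zero.1 ?_).resolve_right this
    linear_combination l₂ - l₃
  have hst' : s + t = 0 := by
    refine (mul_eq_zero.1 ?_).resolve_right (sub_ne_zero.2 hdiff)
    linear_combination l₂ + l₃
  have hs0 : 15 + 58 * r ^ 2 - 9 * r ^ 4 = 0 := by linarith
  have ht0 : 55 + 10 * r ^ 2 - r ^ 4 = 0 := by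
    apply mul_left_cancel₀ hr0
    linarith
  -- Subtracting nine times the second equation from the first gives -480 - 32r² = 0.
  nlinarith [sq_nonneg r]

/-- The coefficients of the numerator of `Im ρ₂`, as a polynomial in `tan² (κ / 2)`. -/
def numeratorCoeff (r A B a b g X Y : ℝ) : Fin 6 → ℝ :=
  ![3 * r ^ 5 * (A * (a - b - g) - X),
    6*A*a*r^3 - 6*A*a*r^5 + 4*A*b*r^5 + 6*A*g*r^5 + 3*B*a*r^4 - 7*B*b*r^4 - 7*B*g*r^4
      - 8*X*r^3 + 4*X*r^5 + 5*Y*r^4,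
    3*A*a*r - 4*A*a*r^3 - A*a*r^5 + 3*A*b*r + 12*A*b*r^3 - A*b*r^5 + 3*A*g*r - 8*A*g*r^3
      + A*g*r^5 - 8*B*a*r^2 + 4*B*a*r^4 - 2*B*b*r^2 - 6*B*b*r^4 - 2*B*g*r^2 + 8*B*g*r^4
      + 3*X*r + 4*X*r^3 - X*r^5 + 16*Y*r^2 - 4*Y*r^4,
    2*A*a*r + 6*A*a*r^3 + 8*A*b*r - 4*A*b*r^3 + 2*A*g*r - 8*A*g*r^3 - 3*B*a - 12*B*a*r^2
      + B*a*r^4 - 3*B*b + 4*B*b*r^2 + B*b*r^4 - 3*B*g + 8*B*g*r^2 - B*g*r^4 + 16*X*r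
      - 4*X*r^3 + 3*Y + 4*Y*r^2 - Y*r^4,
    7*A*a*r - 3*A*b*r + 7*A*g*r - 4*B*a*r^2 - 6*B*b + 6*B*b*r^2 - 6*B*g*r^2 + 5*X*r
      - 8*Y + 4*Y*r^2,
    3 * (B * (a - b + g) - Y)]

/-- The extreme coefficients determine X and Y; after substitution the middle four are the bilinear
equations up to factors 2r³, 2r, 2 and 2. -/
theorem numeratorCoeff_eq_zero_iff {r A B a b g X Y : ℝ} (hr0 : r ≠ 0) :
    (∀ i, numeratorCoeff r A B a b g X Y i = 0) ↔
      BilinearSystem r A B a b g ∧ X = A * (a - b - g) ∧ Y = B * (a - b + g) := by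
  have h3 : r ^ 3 ≠ 0 := pow_ne_zero 3 hr0
  have h5 : 3 * r ^ 5 ≠ 0 := mul_ne_zero three_ne_zero (pow_ne_zero 5 hr0)
  constructor
  · intro h
    have c₀ := h 0
    have c₁ := h 1
    have c₂ := h 2
    have c₃ := h 3
    have c₄ := h 4
    have c₅ := h 5
    simp only [numeratorCoeff, Fin.isValue, Matrix.cons_val] at c₀ c₁ c₂ c₃ c₄ c₅
    have hX : X = A * (a - b - g) := by
      have := (mul_eq_zero.1 c₀).resolve_left h5
      linarith
    have hY : Y = B * (a - b + g) := by linarith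
    subst hX hY
    refine ⟨⟨?_, ?_, ?_, ?_⟩, rfl, rfl⟩
    · apply mul_left_cancel₀ h3
      linear_combination (1 / 2) * c₁
    · apply mul_left_cancel₀ hr0
      linear_combination (1 / 2) * c₂
    · linear_combination (1 / 2) * c₃
    · linear_combination (1 / 2) * c₄
  · rintro ⟨⟨e₁, e₂, e₃, e₄⟩, rfl, rfl⟩ i
    fin_cases i <;> simp only [numeratorCoeff, Fin.isValue, Fin.mk_one, Fin.zero_eta,
      Fin.reduceFinMk, Matrix.cons_val]
    · ring
    · linear_combination 2 * r ^ 3 * e₁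
    · linear_combination 2 * r * e₂
    · linear_combination 2 * e₃
    · linear_combination 2 * e₄
    · ring

end

section

open ComplexConjugate

/-! ### The imaginary part of `ρ₂` in half-angle variables

`C, S` are cosine and sine of `κ / 2`, and `d, T` those of `ω / 2`. -/

/-- `symbol (K²) (Ω²)`, multiplied by `(K Ω)⁻¹`. -/
def resonanceFn (c : QPlus) (C S d T : ℝ) : ℝ :=
  2 * ((c .a₁ + c .a₂) * ((C ^ 2 - S ^ 2) * (d ^ 2 - T ^ 2))
    + (c .a₁ - c .a₂) * (2 * C * S * (2 * d * T)))

/-- `meanCoeff` in half-angle variables. -/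
def meanFn (c : QPlus) (C S d T : ℝ) : ℝ :=
  4 * c .α₁ * (C ^ 2 - S ^ 2) + 4 * c .β₁ * (d ^ 2 - T ^ 2)
    + 2 * (c .γ₁ + c .γ₂) * ((C ^ 2 - S ^ 2) * (d ^ 2 - T ^ 2))
    + 2 * (c .γ₁ - c .γ₂) * (2 * C * S * (2 * d * T))

/-- Real part of `(K Ω)⁻¹ secondCoeff`. -/
def secondRe (c : QPlus) (C S d T : ℝ) : ℝ :=
  2 * c .α₁ * (d ^ 2 - T ^ 2) + 2 * c .β₁ * (C ^ 2 - S ^ 2) + (c .γ₁ + c .γ₂)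

/-- Imaginary part of `(K Ω)⁻¹ secondCoeff`. -/
def secondIm (c : QPlus) (C S d T : ℝ) : ℝ :=
  -(2 * c .α₂ * (2 * d * T)) + 2 * c .β₂ * (2 * C * S)

/-- Real part of `(K Ω)^(-1/2) secondCoupling`. -/
def couplingRe (c : QPlus) (C S d T : ℝ) : ℝ :=
  4 * c .α₁ * ((C ^ 3 - 3 * C * S ^ 2) * d) + 4 * c .β₁ * (C * (d ^ 3 - 3 * d * T ^ 2))
    + 2 * (c .γ₁ + c .γ₂) * ((C ^ 3 - 3 * C * S ^ 2) * (d ^ 3 - 3 * d * T ^ 2))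
    + 2 * (c .γ₁ - c .γ₂) * ((3 * C ^ 2 * S - S ^ 3) * (3 * d ^ 2 * T - T ^ 3))

/-- Imaginary part of `(K Ω)^(-1/2) secondCoupling`. -/
def couplingIm (c : QPlus) (C S d T : ℝ) : ℝ :=
  -(4 * c .α₂ * ((C ^ 3 - 3 * C * S ^ 2) * T)) + 4 * c .β₂ * (S * (d ^ 3 - 3 * d * T ^ 2))

/-- Imaginary part of `(K Ω)^(-1/2) meanCoupling`. -/
def meanCouplingIm (c : QPlus) (C S d T : ℝ) : ℝ := 4 * (c .β₂ * (S * d) - c .α₂ * (C * T))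

/-- Imaginary part of `(K Ω)^(-1/2) cubicCoeff`. -/
def cubicIm (c : QPlus) (C S d T : ℝ) : ℝ :=
  2 * (c .ξ₁ - c .ξ₂) * (C * (3 * d ^ 2 * T - T ^ 3) - (C ^ 3 - 3 * C * S ^ 2) * T - C * T)
    + 2 * (c .ξ₃ - c .ξ₄) * ((3 * C ^ 2 * S - S ^ 3) * d - S * (d ^ 3 - 3 * d * T ^ 2) - S * d)

/-- Imaginary part of `(K Ω)^(-1/2) cubicTotal`. -/
def totalIm (c : QPlus) (C S d T : ℝ) : ℝ :=
  cubicIm c C S d T - meanCouplingIm c C S d T * (meanFn c C S d T / (2 * (c .a₁ + c .a₂)))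
    - (couplingRe c C S d T * secondIm c C S d T + couplingIm c C S d T * secondRe c C S d T) /
      resonanceFn c C S d T

/-! ### Real and imaginary parts after division by powers of (KΩ)^{1/2} -/

section HalfAngle

variable {c : QPlus} {C S d T : ℝ} {x y : ℂ}

theorem inv_of_re_im (hx : x = C + S * Complex.I) (h : C ^ 2 + S ^ 2 = 1) :
    x⁻¹ = C - S * Complex.I := by
  have h' : (C ^ 2 + S ^ 2 : ℂ) = 1 := by exact_mod_cast h
  apply inv_eq_of_mul_eq_one_right
  rw [hx]
  linear_combination h' - (S ^ 2 : ℂ) * Complex.I_sq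

theorem symbol_sq_mul (hx : x = C + S * Complex.I) (hy : y = d - T * Complex.I)
    (hx' : x⁻¹ = C - S * Complex.I) (hy' : y⁻¹ = d + T * Complex.I) (hx0 : x ≠ 0) (hy0 : y ≠ 0) :
    c.symbol (x ^ 2) (y ^ 2) * (x⁻¹ * y⁻¹) =
      ((2 * ((c .a₁ + c .a₂) * (C * d) + (c .a₁ - c .a₂) * (S * T)) : ℝ) : ℂ) := by
  have h : c.symbol (x ^ 2) (y ^ 2) * (x⁻¹ * y⁻¹) =
      c .a₁ * (x⁻¹ * y⁻¹ + x * y) + c .a₂ * (x * y⁻¹ + x⁻¹ * y) := by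
    rw [QPlus.symbol]; field_simp
  rw [h, hx', hy', hx, hy]
  apply Complex.ext <;> simp <;> ring

theorem symbol_pow_four_mul (hx : x = C + S * Complex.I) (hy : y = d - T * Complex.I)
    (hx' : x⁻¹ = C - S * Complex.I) (hy' : y⁻¹ = d + T * Complex.I) (hx0 : x ≠ 0) (hy0 : y ≠ 0) :
    c.symbol ((x ^ 2) ^ 2) ((y ^ 2) ^ 2) * (x⁻¹ * y⁻¹) ^ 2 = (resonanceFn c C S d T : ℂ) := by
  have h : c.symbol ((x ^ 2) ^ 2) ((y ^ 2) ^ 2) * (x⁻¹ * y⁻¹) ^ 2 =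
      c .a₁ * (x⁻¹ ^ 2 * y⁻¹ ^ 2 + x ^ 2 * y ^ 2) + c .a₂ * (x ^ 2 * y⁻¹ ^ 2 + x⁻¹ ^ 2 * y ^ 2) := by
    rw [QPlus.symbol]; field_simp
  rw [h, hx', hy', hx, hy, resonanceFn]
  apply Complex.ext <;> simp [pow_succ] <;> ring

/-- The imaginary part is the negative of the half-angle dispersion relation. Hence this factor is
real, and Im ρ₂ is governed by the numerator alone. -/
theorem nlsFactor_mul (hx : x = C + S * Complex.I) (hy : y = d - T * Complex.I)
    (hx' : x⁻¹ = C - S * Complex.I) (hx0 : x ≠ 0) (hy0 : y ≠ 0)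
    (hs : (c .a₁ + c .a₂) * (C * d) + (c .a₁ - c .a₂) * (S * T) = 0) :
    -Complex.I * (y ^ 2 * (c .a₁ * x ^ 2 + c .a₂)) * (x⁻¹ * y⁻¹) =
      ((c .a₁ * (S * d - C * T) - c .a₂ * (S * d + C * T) : ℝ) : ℂ) := by
  have h : -Complex.I * (y ^ 2 * (c .a₁ * x ^ 2 + c .a₂)) * (x⁻¹ * y⁻¹) =
      -Complex.I * (c .a₁ * (x * y) + c .a₂ * (x⁻¹ * y)) := by
    field_simp
  rw [h, hx', hx, hy]
  apply Complex.ext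
  · simp; ring
  · simp; linear_combination -hs

theorem meanCoeff_eq (hx : x = C + S * Complex.I) (hy : y = d - T * Complex.I)
    (hx' : x⁻¹ = C - S * Complex.I) (hy' : y⁻¹ = d + T * Complex.I) (hx0 : x ≠ 0) (hy0 : y ≠ 0) :
    c.meanCoeff (x ^ 2) (y ^ 2) = (meanFn c C S d T : ℂ) := by
  have h : c.meanCoeff (x ^ 2) (y ^ 2) = 2 * c .α₁ * (x ^ 2 + x⁻¹ ^ 2)
      + 2 * c .β₁ * (y ^ 2 + y⁻¹ ^ 2) + c .γ₁ * (x ^ 2 * y ^ 2 + x⁻¹ ^ 2 * y⁻¹ ^ 2)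
      + c .γ₂ * (x ^ 2 * y⁻¹ ^ 2 + x⁻¹ ^ 2 * y ^ 2) := by
    rw [QPlus.meanCoeff, QPlus.quadSum]; field_simp; ring
  rw [h, hx', hy', hx, hy, meanFn]
  apply Complex.ext <;> simp [pow_succ] <;> ring

theorem secondCoeff_mul (hx : x = C + S * Complex.I) (hy : y = d - T * Complex.I)
    (hx' : x⁻¹ = C - S * Complex.I) (hy' : y⁻¹ = d + T * Complex.I) (hx0 : x ≠ 0) (hy0 : y ≠ 0) :
    c.secondCoeff (x ^ 2) (y ^ 2) * (x⁻¹ * y⁻¹) ^ 2 =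
      secondRe c C S d T + secondIm c C S d T * Complex.I := by
  have h : c.secondCoeff (x ^ 2) (y ^ 2) * (x⁻¹ * y⁻¹) ^ 2 = (c .α₁ - c .α₂) * y⁻¹ ^ 2
      + (c .α₁ + c .α₂) * y ^ 2 + (c .β₁ - c .β₂) * x⁻¹ ^ 2 + (c .β₁ + c .β₂) * x ^ 2
      + (c .γ₁ + c .γ₂) := by
    rw [QPlus.secondCoeff, QPlus.quadSum]; field_simp; ring
  rw [h, hx', hy', hx, hy, secondRe, secondIm]
  apply Complex.ext <;> simp [pow_succ] <;> ring

theorem secondCoupling_mul (hx : x = C + S * Complex.I) (hy : y = d - T * Complex.I)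
    (hx' : x⁻¹ = C - S * Complex.I) (hy' : y⁻¹ = d + T * Complex.I) (hx0 : x ≠ 0) (hy0 : y ≠ 0) :
    c.secondCoupling (x ^ 2) (y ^ 2) * (x⁻¹ * y⁻¹) =
      couplingRe c C S d T + couplingIm c C S d T * Complex.I := by
  have h : c.secondCoupling (x ^ 2) (y ^ 2) * (x⁻¹ * y⁻¹) =
      (c .α₁ - c .α₂) * ((x⁻¹ ^ 3 + x ^ 3) * y⁻¹) + (c .α₁ + c .α₂) * ((x⁻¹ ^ 3 + x ^ 3) * y)
      + (c .β₁ - c .β₂) * (x⁻¹ * (y⁻¹ ^ 3 + y ^ 3)) + (c .β₁ + c .β₂) * (x * (y⁻¹ ^ 3 + y ^ 3))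
      + c .γ₁ * (x⁻¹ ^ 3 * y⁻¹ ^ 3 + x ^ 3 * y ^ 3)
      + c .γ₂ * (x ^ 3 * y⁻¹ ^ 3 + x⁻¹ ^ 3 * y ^ 3) := by
    rw [QPlus.secondCoupling, QPlus.quadSum]; field_simp; ring
  rw [h, hx', hy', hx, hy, couplingRe, couplingIm]
  apply Complex.ext <;> simp [pow_succ] <;> ring

theorem meanCoupling_mul_im (hx : x = C + S * Complex.I) (hy : y = d - T * Complex.I)
    (hx' : x⁻¹ = C - S * Complex.I) (hy' : y⁻¹ = d + T * Complex.I) (hx0 : x ≠ 0) (hy0 : y ≠ 0) :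
    (c.meanCoupling (x ^ 2) (y ^ 2) * (x⁻¹ * y⁻¹)).im = meanCouplingIm c C S d T := by
  have h : c.meanCoupling (x ^ 2) (y ^ 2) * (x⁻¹ * y⁻¹) =
      (c .α₁ - c .α₂) * ((x⁻¹ + x) * y⁻¹) + (c .α₁ + c .α₂) * ((x⁻¹ + x) * y)
      + (c .β₁ - c .β₂) * (x⁻¹ * (y⁻¹ + y)) + (c .β₁ + c .β₂) * (x * (y⁻¹ + y))
      + c .γ₁ * (x⁻¹ * y⁻¹ + x * y) + c .γ₂ * (x * y⁻¹ + x⁻¹ * y) := by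
    rw [QPlus.meanCoupling, QPlus.quadSum]; field_simp
  rw [h, hx', hy', hx, hy, meanCouplingIm]
  simp
  ring

theorem cubicCoeff_mul_im (hx : x = C + S * Complex.I) (hy : y = d - T * Complex.I)
    (hx' : x⁻¹ = C - S * Complex.I) (hy' : y⁻¹ = d + T * Complex.I) (hx0 : x ≠ 0) (hy0 : y ≠ 0) :
    (c.cubicCoeff (x ^ 2) (y ^ 2) * (x⁻¹ * y⁻¹)).im = cubicIm c C S d T := by
  have h : c.cubicCoeff (x ^ 2) (y ^ 2) * (x⁻¹ * y⁻¹) =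
      (c .ξ₁ - c .ξ₃) * (x⁻¹ ^ 3 * y + x * y⁻¹ ^ 3 + x * y)
      + (c .ξ₁ + c .ξ₃) * (x ^ 3 * y + x⁻¹ * y + x⁻¹ * y⁻¹ ^ 3)
      + (c .ξ₂ - c .ξ₄) * (x⁻¹ * y ^ 3 + x ^ 3 * y⁻¹ + x⁻¹ * y⁻¹)
      + (c .ξ₂ + c .ξ₄) * (x * y ^ 3 + x * y⁻¹ + x⁻¹ ^ 3 * y⁻¹) := by
    rw [QPlus.cubicCoeff, QPlus.cubSum]; field_simp; ring
  rw [h, hx', hy', hx, hy, cubicIm]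
  simp [pow_succ]
  ring

/-- `meanCoeff` is real already. In the second-harmonic fraction, numerator and denominator are both
multiplied by (KΩ)⁻¹, which makes the denominator real. -/
theorem cubicTotal_mul_im (hx : x = C + S * Complex.I) (hy : y = d - T * Complex.I)
    (hx' : x⁻¹ = C - S * Complex.I) (hy' : y⁻¹ = d + T * Complex.I) (hx0 : x ≠ 0) (hy0 : y ≠ 0) :
    (c.cubicTotal (x ^ 2) (y ^ 2) * (x⁻¹ * y⁻¹)).im = totalIm c C S d T := by
  have hE : (x⁻¹ * y⁻¹) ^ 2 ≠ 0 :=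
    pow_ne_zero 2 (mul_ne_zero (inv_ne_zero hx0) (inv_ne_zero hy0))
  have h : c.cubicTotal (x ^ 2) (y ^ 2) * (x⁻¹ * y⁻¹) =
      c.cubicCoeff (x ^ 2) (y ^ 2) * (x⁻¹ * y⁻¹)
      - c.meanCoupling (x ^ 2) (y ^ 2) * (x⁻¹ * y⁻¹) *
        ((meanFn c C S d T / (2 * (c .a₁ + c .a₂)) : ℝ) : ℂ)
      - (c.secondCoupling (x ^ 2) (y ^ 2) * (x⁻¹ * y⁻¹)) *
        (c.secondCoeff (x ^ 2) (y ^ 2) * (x⁻¹ * y⁻¹) ^ 2) * ((resonanceFn c C S d T)⁻¹ : ℝ) := by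
    rw [QPlus.cubicTotal, meanCoeff_eq hx hy hx' hy' hx0 hy0, Complex.ofReal_inv,
      ← symbol_pow_four_mul hx hy hx' hy' hx0 hy0,
      ← mul_div_mul_right (c.secondCoeff (x ^ 2) (y ^ 2)) _ hE]
    push_cast
    ring
  rw [h, secondCoupling_mul hx hy hx' hy' hx0 hy0, secondCoeff_mul hx hy hx' hy' hx0 hy0,
    Complex.sub_im, Complex.sub_im, Complex.im_mul_ofReal, Complex.im_mul_ofReal,
    cubicCoeff_mul_im hx hy hx' hy' hx0 hy0, meanCoupling_mul_im hx hy hx' hy' hx0 hy0, totalIm]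
  simp
  ring

end HalfAngle

variable {c : QPlus} {ω : ℝ → ℝ} {κ : ℝ}

theorem bigK_half_sq (κ : ℝ) : bigK κ = bigK (κ / 2) ^ 2 := by
  rw [bigK, bigK, ← Complex.exp_nat_mul]
  congr 1
  push_cast
  ring

theorem bigOmega_half_sq (w : ℝ) : bigOmega w = bigOmega (w / 2) ^ 2 := by
  rw [bigOmega, bigOmega, ← Complex.exp_nat_mul]
  congr 1
  push_cast
  ring

/-- Half-angle form of the dispersion relation, the resonance condition, and the reality of the
nonlinear coefficient. -/
theorem half_angle_conditions (hc : c.IsDispersive) (hω : c.IsDispersionRelation ω) (κ : ℝ) :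
    let C := Real.cos (κ / 2); let S := Real.sin (κ / 2)
    let d := Real.cos (ω κ / 2); let T := Real.sin (ω κ / 2)
    (c .a₁ + c .a₂) * (C * d) + (c .a₁ - c .a₂) * (S * T) = 0 ∧
    (c.NonResonant ω κ ↔ resonanceFn c C S d T ≠ 0) ∧
    ((c.nlsNonlinearity ω κ).im = 0 ↔ totalIm c C S d T = 0) := by
  intro C S d T
  set x := bigK (κ / 2) with hxdef
  set y := bigOmega (ω κ / 2) with hydef
  have hx : x = C + S * Complex.I := by
    rw [hxdef, bigK_eq, ← Complex.ofReal_cos, ← Complex.ofReal_sin]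
  have hy : y = d - T * Complex.I := by
    have : y = bigK (-(ω κ / 2)) := by
      rw [hydef, bigOmega, bigK]; congr 1; push_cast; ring
    rw [this, bigK_eq, ← Complex.ofReal_cos, ← Complex.ofReal_sin, Real.cos_neg, Real.sin_neg,
      Complex.ofReal_neg]
    ring
  have hx0 : x ≠ 0 := bigK_ne_zero _
  have hy0 : y ≠ 0 := bigOmega_ne_zero _
  have hx' : x⁻¹ = C - S * Complex.I := inv_of_re_im hx (Real.cos_sq_add_sin_sq _)
  have hy' : y⁻¹ = d + T * Complex.I := by
    have := inv_of_re_im (x := y) (C := d) (S := -T) (by rw [hy]; push_cast; ring)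
      (by rw [neg_sq]; exact Real.cos_sq_add_sin_sq _)
    rw [this]; push_cast; ring
  have hK : bigK κ = x ^ 2 := bigK_half_sq κ
  have hO : bigOmega (ω κ) = y ^ 2 := bigOmega_half_sq _
  have hE : x⁻¹ * y⁻¹ ≠ 0 := mul_ne_zero (inv_ne_zero hx0) (inv_ne_zero hy0)
  have hs : (c .a₁ + c .a₂) * (C * d) + (c .a₁ - c .a₂) * (S * T) = 0 := by
    have h := symbol_sq_mul (c := c) hx hy hx' hy' hx0 hy0
    rw [← hK, ← hO, hω.2 κ, zero_mul] at h
    have h' := Complex.ofReal_eq_zero.1 h.symm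
    linarith
  refine ⟨hs, ?_, ?_⟩
  · rw [QPlus.NonResonant, hK, hO, ← Complex.ofReal_ne_zero,
      ← symbol_pow_four_mul hx hy hx' hy' hx0 hy0, mul_ne_zero_iff, and_iff_left (pow_ne_zero 2 hE)]
  · have hl := nlsFactor_mul hx hy hx' hx0 hy0 hs
    rw [← hK, ← hO] at hl
    have hl' : c.nlsFactor ω κ * (x⁻¹ * y⁻¹) = _ := hl
    set μ : ℝ := c .a₁ * (S * d - C * T) - c .a₂ * (S * d + C * T)
    have hμ : μ ≠ 0 := by
      have := mul_ne_zero (nlsFactor_ne_zero (ω := ω) (κ := κ) hc) hE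
      rw [hl'] at this
      exact_mod_cast this
    rw [QPlus.nlsNonlinearity, ← mul_div_mul_right _ _ hE, hl', Complex.div_ofReal_im, hK, hO,
      cubicTotal_mul_im hx hy hx' hy' hx0 hy0, div_eq_zero_iff, or_iff_left hμ]

end

/-! ### The imaginary part as a rational function of tan(κ/2) -/

section

/-- Coordinates adapted to the reality condition: `a₁ = (r - 1) τ`, `a₂ = (r + 1) τ`, and
`a, b, g, X, Y` are the coefficients after a Möbius transformation with parameter `m` which makes
the two diagonal quadratic coefficients equal. -/
structure ReducedCoordinates (c : QPlus) (r τ m a b g X Y : ℝ) : Prop where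
  a₁_eq : c .a₁ = (r - 1) * τ
  a₂_eq : c .a₂ = (r + 1) * τ
  α₁_eq : c .α₁ = a + 2 * r * τ * m
  β₁_eq : c .β₁ = b + 2 * r * τ * m
  γ₁_eq : c .γ₁ = g + 2 * (r - 1) * τ * m
  γ₂_eq : c .γ₂ = g + 2 * (r + 1) * τ * m
  ξ_sub_eq : c .ξ₁ - c .ξ₂ = X / (r * τ) - 2 * m * c .α₂
  ξ_sub_eq' : c .ξ₃ - c .ξ₄ = Y / (r * τ) + 2 * m * c .β₂
  r_ne_zero : r ≠ 0
  r_ne_one : r ≠ 1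
  r_ne_neg_one : r ≠ -1
  τ_ne_zero : τ ≠ 0

/-- The substitution with parameter m changes γ₂ - γ₁ by 2m(a₂ - a₁) = 4τm, which dictates m. The
scaling of X and Y by rτ makes them comparable with products of quadratic coefficients. -/
theorem exists_reducedCoordinates {c : QPlus} (hc : c.IsDispersive) :
    ∃ r τ m a b g X Y, ReducedCoordinates c r τ m a b g X Y := by
  have h1 := hc.add_ne_zero
  have h2 : c .a₂ - c .a₁ ≠ 0 := fun h => hc.sub_ne_zero (by linarith)
  set τ := (c .a₂ - c .a₁) / 2 with hτ
  set r := (c .a₁ + c .a₂) / (c .a₂ - c .a₁) with hr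
  set m := (c .γ₂ - c .γ₁) / (4 * τ) with hm
  have hτ0 : τ ≠ 0 := div_ne_zero h2 two_ne_zero
  have hr0 : r ≠ 0 := div_ne_zero h1 h2
  have e1 : r * τ = (c .a₁ + c .a₂) / 2 := by rw [hr, hτ]; field_simp
  have e2 : τ * m = (c .γ₂ - c .γ₁) / 4 := by rw [hm]; field_simp
  refine ⟨r, τ, m, c .α₁ - 2 * r * τ * m, c .β₁ - 2 * r * τ * m, c .γ₁ - 2 * (r - 1) * τ * m,
    r * τ * (c .ξ₁ - c .ξ₂ + 2 * m * c .α₂), r * τ * (c .ξ₃ - c .ξ₄ - 2 * m * c .β₂),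
    ?_, ?_, by ring, by ring, by ring, ?_, ?_, ?_, hr0, fun h => ?_, fun h => ?_, hτ0⟩
  · linear_combination -e1 + hτ
  · linear_combination -e1 - hτ
  · linear_combination -4 * e2
  · rw [mul_div_cancel_left₀ _ (mul_ne_zero hr0 hτ0)]; ring
  · rw [mul_div_cancel_left₀ _ (mul_ne_zero hr0 hτ0)]; ring
  · rw [h] at e1; exact hc.1 (by linarith)
  · rw [h] at e1; exact hc.2.1 (by linarith)

variable {c : QPlus} {r τ m a b g X Y C S d T p : ℝ}

/-- The denominator of the second harmonic, as a polynomial in `tan² (κ / 2)`. -/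
def resonancePoly (r x : ℝ) : ℝ := x ^ 2 + (3 - r ^ 2) * x + r ^ 2

theorem resonanceFn_eq (h : ReducedCoordinates c r τ m a b g X Y) (hp : p ≠ 0)
    (hS : S = p * C) (hT : T = r / p * d) (hC : C ^ 2 = 1 / (1 + p ^ 2))
    (hd : d ^ 2 = p ^ 2 / (p ^ 2 + r ^ 2)) :
    resonanceFn c C S d T =
      -4 * r * τ * resonancePoly r (p ^ 2) / ((1 + p ^ 2) * (p ^ 2 + r ^ 2)) := by
  have hr := h.r_ne_zero
  have p1 : 1 + p ^ 2 ≠ 0 := by positivity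
  have p2 : p ^ 2 + r ^ 2 ≠ 0 := by positivity
  have k1 : C ^ 2 - S ^ 2 = (1 - p ^ 2) / (1 + p ^ 2) := by
    rw [hS, show C ^ 2 - (p * C) ^ 2 = C ^ 2 * (1 - p ^ 2) by ring, hC]; ring
  have k2 : 2 * C * S = 2 * p / (1 + p ^ 2) := by
    rw [hS, show 2 * C * (p * C) = C ^ 2 * (2 * p) by ring, hC]; ring
  have k3 : d ^ 2 - T ^ 2 = (p ^ 2 - r ^ 2) / (p ^ 2 + r ^ 2) := by
    rw [hT, show d ^ 2 - (r / p * d) ^ 2 = d ^ 2 * (1 - (r / p) ^ 2) by ring, hd]; field_simp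
  have k4 : 2 * d * T = 2 * r * p / (p ^ 2 + r ^ 2) := by
    rw [hT, show 2 * d * (r / p * d) = d ^ 2 * (2 * (r / p)) by ring, hd]; field_simp
  rw [resonanceFn, k1, k2, k3, k4, h.a₁_eq, h.a₂_eq, resonancePoly]
  field_simp
  ring

/-- With p = tan(κ/2) and r/p = tan(ω/2), each double-angle term is rational in p, and each
triple-angle term is C or d times a rational function. The parameter m cancels, reflecting Möbius
covariance. -/
theorem totalIm_eq (h : ReducedCoordinates c r τ m a b g X Y) (hp : p ≠ 0)
    (hS : S = p * C) (hT : T = r / p * d) (hC : C ^ 2 = 1 / (1 + p ^ 2))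
    (hd : d ^ 2 = p ^ 2 / (p ^ 2 + r ^ 2)) (hD : resonancePoly r (p ^ 2) ≠ 0) :
    totalIm c C S d T = C * d * (2 * ∑ i, numeratorCoeff r (c .α₂) (c .β₂) a b g X Y i *
      (p ^ 2) ^ (i : ℕ)) /
        (p * r * τ * resonancePoly r (p ^ 2) * ((1 + p ^ 2) * (p ^ 2 + r ^ 2))) := by
  have hr := h.r_ne_zero
  have hτ := h.τ_ne_zero
  have p1 : 1 + p ^ 2 ≠ 0 := by positivity
  have p2 : p ^ 2 + r ^ 2 ≠ 0 := by positivity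
  have k1 : C ^ 2 - S ^ 2 = (1 - p ^ 2) / (1 + p ^ 2) := by
    rw [hS, show C ^ 2 - (p * C) ^ 2 = C ^ 2 * (1 - p ^ 2) by ring, hC]; ring
  have k2 : 2 * C * S = 2 * p / (1 + p ^ 2) := by
    rw [hS, show 2 * C * (p * C) = C ^ 2 * (2 * p) by ring, hC]; ring
  have k3 : d ^ 2 - T ^ 2 = (p ^ 2 - r ^ 2) / (p ^ 2 + r ^ 2) := by
    rw [hT, show d ^ 2 - (r / p * d) ^ 2 = d ^ 2 * (1 - (r / p) ^ 2) by ring, hd]; field_simp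
  have k4 : 2 * d * T = 2 * r * p / (p ^ 2 + r ^ 2) := by
    rw [hT, show 2 * d * (r / p * d) = d ^ 2 * (2 * (r / p)) by ring, hd]; field_simp
  have k5 : C ^ 3 - 3 * C * S ^ 2 = C * ((1 - 3 * p ^ 2) / (1 + p ^ 2)) := by
    rw [hS, show C ^ 3 - 3 * C * (p * C) ^ 2 = C * (C ^ 2 * (1 - 3 * p ^ 2)) by ring, hC]; ring
  have k6 : 3 * C ^ 2 * S - S ^ 3 = C * (p * (3 - p ^ 2) / (1 + p ^ 2)) := by
    rw [hS, show 3 * C ^ 2 * (p * C) - (p * C) ^ 3 = C * (C ^ 2 * (p * (3 - p ^ 2))) by ring, hC]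
    ring
  have k7 : d ^ 3 - 3 * d * T ^ 2 = d * ((p ^ 2 - 3 * r ^ 2) / (p ^ 2 + r ^ 2)) := by
    rw [hT, show d ^ 3 - 3 * d * (r / p * d) ^ 2 = d * (d ^ 2 * (1 - 3 * (r / p) ^ 2)) by ring, hd]
    field_simp
  have k8 : 3 * d ^ 2 * T - T ^ 3 = d * (r * (3 * p ^ 2 - r ^ 2) / (p * (p ^ 2 + r ^ 2))) := by
    rw [hT, show 3 * d ^ 2 * (r / p * d) - (r / p * d) ^ 3
      = d * (d ^ 2 * (r / p * (3 - (r / p) ^ 2))) by ring, hd]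
    field_simp
  rw [totalIm, resonanceFn_eq h hp hS hT hC hd, cubicIm, meanCouplingIm, meanFn, couplingRe,
    couplingIm, secondRe, secondIm, k1, k2, k3, k4, k5, k6, k7, k8, hS, hT, h.a₁_eq, h.a₂_eq,
    h.α₁_eq, h.β₁_eq, h.γ₁_eq, h.γ₂_eq, h.ξ_sub_eq, h.ξ_sub_eq',
    show (r - 1) * τ + (r + 1) * τ = 2 * r * τ by ring]
  simp only [Fin.sum_univ_six, numeratorCoeff, Fin.isValue, Matrix.cons_val, Fin.val_zero,
    Fin.val_one, Fin.val_two, show ((3 : Fin 6) : ℕ) = 3 from rfl,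
    show ((4 : Fin 6) : ℕ) = 4 from rfl, show ((5 : Fin 6) : ℕ) = 5 from rfl]
  -- The resonance polynomial stays opaque while denominators are cleared and is expanded only for
  -- the final identity.
  have hD' : resonancePoly r (p ^ 2) = (p ^ 2) ^ 2 + (3 - r ^ 2) * p ^ 2 + r ^ 2 := rfl
  set D := resonancePoly r (p ^ 2)
  field_simp
  rw [hD']
  ring

end

/-! ### Reality of ρ₂ and vanishing of the numerator -/

section

variable {c : QPlus} {ω : ℝ → ℝ} {κ r τ m a b g X Y : ℝ}

/-- Nothing is assumed at resonant points, but there the resonance polynomial Q vanishes. So the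
product PQ has every positive number as a root, and Q ≠ 0. -/
theorem coeff_eq_zero_of_resonancePoly {f : Fin 6 → ℝ}
    (h : ∀ x : ℝ, 0 < x → resonancePoly r x ≠ 0 → ∑ i, f i * x ^ (i : ℕ) = 0) (i : Fin 6) :
    f i = 0 := by
  open Polynomial in
  set P : ℝ[X] := ∑ i : Fin 6, C (f i) * X ^ (i : ℕ) with hP
  set Q : ℝ[X] := X ^ 2 + C (3 - r ^ 2) * X + C (r ^ 2) with hQ
  have hPQ : P * Q = 0 := by
    refine Polynomial.eq_zero_of_infinite_isRoot _ ((Set.Ioi_infinite (0 : ℝ)).mono fun x hx => ?_)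
    have hPx : P.eval x = ∑ i, f i * x ^ (i : ℕ) := by
      simp [hP, Polynomial.eval_finsetSum]
    have hQx : Q.eval x = resonancePoly r x := by simp [hQ, resonancePoly]
    change (P * Q).eval x = 0
    rw [Polynomial.eval_mul, hPx, hQx]
    by_cases hD : resonancePoly r x = 0
    · rw [hD, mul_zero]
    · rw [h x hx hD, zero_mul]
  have hQ0 : Q ≠ 0 := by
    intro h0
    have := congrArg (fun q => q.coeff 2) h0
    simp only [hQ, Polynomial.coeff_add, Polynomial.coeff_X_pow, Polynomial.coeff_C_mul,
      Polynomial.coeff_X, Polynomial.coeff_C, Polynomial.coeff_zero] at this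
    norm_num at this
  have hP0 := (mul_eq_zero.1 hPQ).resolve_right hQ0
  have := congrArg (fun q => q.coeff (i : ℕ)) hP0
  simp only [hP, Polynomial.finsetSum_coeff, Polynomial.coeff_C_mul, Polynomial.coeff_X_pow,
    Polynomial.coeff_zero] at this
  rw [Finset.sum_eq_single i] at this
  · simpa using this
  · intro j _ hj
    rw [if_neg (fun h => hj (Fin.ext h.symm)), mul_zero]
  · simp

theorem numeratorCoeff_eq_zero_of_real (hc : c.IsDispersive) (hω : c.IsDispersionRelation ω)
    (h : ReducedCoordinates c r τ m a b g X Y)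
    (hreal : ∀ κ, c.NonResonant ω κ → (c.nlsNonlinearity ω κ).im = 0) (i : Fin 6) :
    numeratorCoeff r (c .α₂) (c .β₂) a b g X Y i = 0 := by
  have hr := h.r_ne_zero
  have hτ := h.τ_ne_zero
  refine coeff_eq_zero_of_resonancePoly (r := r) (fun x hx hD => ?_) i
  set p := √x with hpdef
  have hp : p ≠ 0 := (Real.sqrt_pos.2 hx).ne'
  have hpx : p ^ 2 = x := Real.sq_sqrt hx.le
  -- Every x > 0 is the value of tan²(κ/2) at this wave number.
  set κ := 2 * Real.arctan p with hκ
  obtain ⟨hs, hnr, him⟩ := half_angle_conditions hc hω κ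
  have hhalf : κ / 2 = Real.arctan p := by rw [hκ]; ring
  rw [hhalf] at hs hnr him
  have hC : Real.cos (Real.arctan p) ^ 2 = 1 / (1 + p ^ 2) := Real.cos_sq_arctan p
  set C := Real.cos (Real.arctan p) with hCdef
  have hC0 : C ≠ 0 := (Real.cos_arctan_pos p).ne'
  set S := Real.sin (Real.arctan p) with hSdef
  have hS : S = p * C := by
    rw [hSdef, hCdef, Real.sin_arctan, Real.cos_arctan]; ring
  set d := Real.cos (ω κ / 2)
  set T := Real.sin (ω κ / 2)
  have hdT : d ^ 2 + T ^ 2 = 1 := Real.cos_sq_add_sin_sq _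
  have hT : T = r / p * d := by
    rw [h.a₁_eq, h.a₂_eq, hS] at hs
    have h2 : 2 * τ * C * (r * d - p * T) = 0 := by linear_combination hs
    have h3 := (mul_eq_zero.1 h2).resolve_left
      (mul_ne_zero (mul_ne_zero two_ne_zero hτ) hC0)
    rw [div_mul_eq_mul_div, eq_div_iff hp]
    linarith
  have p2 : p ^ 2 + r ^ 2 ≠ 0 := by positivity
  have hd : d ^ 2 = p ^ 2 / (p ^ 2 + r ^ 2) := by
    rw [hT] at hdT
    rw [eq_div_iff p2]
    field_simp at hdT
    linarith
  have hd0 : d ≠ 0 := by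
    intro h0
    rw [h0] at hT hdT
    rw [hT] at hdT
    norm_num at hdT
  rw [← hpx] at hD ⊢
  have p1 : (1 + p ^ 2) ≠ 0 := by positivity
  have hnr' : c.NonResonant ω κ := by
    refine hnr.2 ?_
    rw [resonanceFn_eq h hp hS hT hC hd]
    exact div_ne_zero (mul_ne_zero (mul_ne_zero (mul_ne_zero (by norm_num) hr) hτ) hD)
      (mul_ne_zero p1 p2)
  have h0 := him.1 (hreal κ hnr')
  rw [totalIm_eq h hp hS hT hC hd hD, div_eq_zero_iff] at h0
  have h1 := h0.resolve_right (mul_ne_zero (mul_ne_zero (mul_ne_zero (mul_ne_zero hp hr) hτ) hD)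
    (mul_ne_zero p1 p2))
  have h2 := (mul_eq_zero.1 h1).resolve_left (mul_ne_zero hC0 hd0)
  exact (mul_eq_zero.1 h2).resolve_left two_ne_zero

/-- The point p = ∞, where the quotient form is unavailable; only the condition of the leading
coefficient, on Y, is needed. -/
theorem totalIm_eq_zero_of_cos_eq_zero (h : ReducedCoordinates c r τ m a b g X Y)
    (hY : Y = c .β₂ * (a - b + g)) {S d : ℝ} (hS : S = 1 ∨ S = -1) (hd : d = 1 ∨ d = -1) :
    totalIm c 0 S d 0 = 0 := by
  have hr := h.r_ne_zero
  have hτ := h.τ_ne_zero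
  have hres : resonanceFn c 0 S d 0 = -4 * r * τ := by
    rw [resonanceFn, h.a₁_eq, h.a₂_eq]
    rcases hS with rfl | rfl <;> rcases hd with rfl | rfl <;> ring
  rw [totalIm, hres, cubicIm, meanCouplingIm, meanFn, couplingRe,
    couplingIm, secondRe, secondIm, h.a₁_eq, h.a₂_eq, h.α₁_eq, h.β₁_eq, h.γ₁_eq, h.γ₂_eq,
    h.ξ_sub_eq', hY, show (r - 1) * τ + (r + 1) * τ = 2 * r * τ by ring]
  rcases hS with rfl | rfl <;> rcases hd with rfl | rfl <;> field_simp <;> ring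

/-- The point p = 0, governed by the constant coefficient, that is, by the condition on X. -/
theorem totalIm_eq_zero_of_sin_eq_zero (h : ReducedCoordinates c r τ m a b g X Y)
    (hX : X = c .α₂ * (a - b - g)) {C T : ℝ} (hC : C = 1 ∨ C = -1) (hT : T = 1 ∨ T = -1) :
    totalIm c C 0 0 T = 0 := by
  have hr := h.r_ne_zero
  have hτ := h.τ_ne_zero
  have hres : resonanceFn c C 0 0 T = -4 * r * τ := by
    rw [resonanceFn, h.a₁_eq, h.a₂_eq]
    rcases hC with rfl | rfl <;> rcases hT with rfl | rfl <;> ring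
  rw [totalIm, hres, cubicIm, meanCouplingIm, meanFn, couplingRe,
    couplingIm, secondRe, secondIm, h.a₁_eq, h.a₂_eq, h.α₁_eq, h.β₁_eq, h.γ₁_eq, h.γ₂_eq,
    h.ξ_sub_eq, hX, show (r - 1) * τ + (r + 1) * τ = 2 * r * τ by ring]
  rcases hC with rfl | rfl <;> rcases hT with rfl | rfl <;> field_simp <;> ring

/-- Away from cos(κ/2) = 0 and cos(ω/2) = 0 the dispersion relation makes p finite and nonzero, and
the quotient form of `totalIm_eq` applies. The two excluded situations are treated directly. -/
theorem real_of_numeratorCoeff_eq_zero (hc : c.IsDispersive) (hω : c.IsDispersionRelation ω)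
    (h : ReducedCoordinates c r τ m a b g X Y)
    (h0 : ∀ i, numeratorCoeff r (c .α₂) (c .β₂) a b g X Y i = 0) (hres : c.NonResonant ω κ) :
    (c.nlsNonlinearity ω κ).im = 0 := by
  have hr := h.r_ne_zero
  have hτ := h.τ_ne_zero
  obtain ⟨-, hX, hY⟩ := (numeratorCoeff_eq_zero_iff hr).1 h0
  obtain ⟨hs, hnr, him⟩ := half_angle_conditions hc hω κ
  have hCS : Real.cos (κ / 2) ^ 2 + Real.sin (κ / 2) ^ 2 = 1 := Real.cos_sq_add_sin_sq _
  have hdT : Real.cos (ω κ / 2) ^ 2 + Real.sin (ω κ / 2) ^ 2 = 1 := Real.cos_sq_add_sin_sq _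
  rw [him]
  rw [hnr] at hres
  set C := Real.cos (κ / 2)
  set S := Real.sin (κ / 2)
  set d := Real.cos (ω κ / 2)
  set T := Real.sin (ω κ / 2)
  have hs' : r * (C * d) = S * T := by
    rw [h.a₁_eq, h.a₂_eq] at hs
    apply mul_left_cancel₀ (mul_ne_zero two_ne_zero hτ)
    linear_combination hs
  have sq_one : ∀ {z : ℝ}, z ^ 2 = 1 → z = 1 ∨ z = -1 := fun h =>
    mul_self_eq_one_iff.1 ((sq _).symm.trans h)
  by_cases hC0 : C = 0
  · rw [hC0] at hCS hs' ⊢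
    have hS := sq_one (z := S) (by linarith)
    have hT : T = 0 := by
      rcases hS with e | e <;> rw [e] at hs' <;> linarith
    rw [hT] at hdT ⊢
    exact totalIm_eq_zero_of_cos_eq_zero h hY hS (sq_one (by linarith))
  by_cases hd0 : d = 0
  · rw [hd0] at hdT hs' ⊢
    have hT := sq_one (z := T) (by linarith)
    have hS : S = 0 := by
      rcases hT with e | e <;> rw [e] at hs' <;> linarith
    rw [hS] at hCS ⊢
    exact totalIm_eq_zero_of_sin_eq_zero h hX (sq_one (by linarith)) hT
  have hS0 : S ≠ 0 := by
    intro e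
    rw [e, zero_mul] at hs'
    exact mul_ne_zero hr (mul_ne_zero hC0 hd0) hs'
  set p := S / C with hpdef
  have hp : p ≠ 0 := div_ne_zero hS0 hC0
  have hS : S = p * C := by rw [hpdef]; field_simp
  have hT : T = r / p * d := by
    rw [hpdef]
    field_simp
    linarith
  have p1 : 1 + p ^ 2 ≠ 0 := by positivity
  have p2 : p ^ 2 + r ^ 2 ≠ 0 := by positivity
  have hC : C ^ 2 = 1 / (1 + p ^ 2) := by
    rw [hS] at hCS
    rw [eq_div_iff p1]
    linarith
  have hd : d ^ 2 = p ^ 2 / (p ^ 2 + r ^ 2) := by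
    rw [hT] at hdT
    rw [eq_div_iff p2]
    field_simp at hdT
    linarith
  have hD : resonancePoly r (p ^ 2) ≠ 0 := by
    intro e
    rw [resonanceFn_eq h hp hS hT hC hd, e] at hres
    simp at hres
  rw [totalIm_eq h hp hS hT hC hd hD]
  simp [h0]

end

/-! ### The six cases in reduced coordinates -/

section

variable {c : QPlus} {r τ m a b g X Y : ℝ}

namespace ReducedCoordinates

theorem X_eq (h : ReducedCoordinates c r τ m a b g X Y) :
    X = r * τ * (c .ξ₁ - c .ξ₂ + 2 * m * c .α₂) := by
  have := mul_ne_zero h.r_ne_zero h.τ_ne_zero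
  rw [h.ξ_sub_eq, sub_add_cancel, mul_div_cancel₀ _ this]

theorem Y_eq (h : ReducedCoordinates c r τ m a b g X Y) :
    Y = r * τ * (c .ξ₃ - c .ξ₄ - 2 * m * c .β₂) := by
  have := mul_ne_zero h.r_ne_zero h.τ_ne_zero
  rw [h.ξ_sub_eq', add_sub_cancel_right, mul_div_cancel₀ _ this]

theorem case1_iff (h : ReducedCoordinates c r τ m a b g X Y) :
    c.Case1 ↔ c .α₂ = 0 ∧ c .β₂ = 0 ∧ X = 0 ∧ Y = 0 := by
  have hrτ := mul_ne_zero h.r_ne_zero h.τ_ne_zero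
  rw [QPlus.Case1, h.X_eq, h.Y_eq]
  constructor
  · rintro ⟨h1, h2, h3, h4⟩
    refine ⟨h1, h2, ?_, ?_⟩
    · rw [h1, h3]; ring
    · rw [h2, h4]; ring
  · rintro ⟨h1, h2, h3, h4⟩
    refine ⟨h1, h2, ?_, ?_⟩
    · have := (mul_eq_zero.1 h3).resolve_left hrτ
      rw [h1] at this
      linarith
    · have := (mul_eq_zero.1 h4).resolve_left hrτ
      rw [h2] at this
      linarith

theorem case2_iff (h : ReducedCoordinates c r τ m a b g X Y) :
    c.Case2 ↔ r = -3 ∧ c .α₂ = c .β₂ ∧ a = b ∧ g = 0 ∧ X = 0 ∧ Y = 0 := by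
  have hτ := h.τ_ne_zero
  rw [QPlus.Case2, h.X_eq, h.Y_eq, h.a₁_eq, h.a₂_eq, h.α₁_eq, h.β₁_eq, h.γ₁_eq, h.γ₂_eq]
  constructor
  · rintro ⟨h1, h2, h3, h4, h5, h6⟩
    have hr : r = -3 := by
      apply mul_left_cancel₀ hτ
      linear_combination -h3
    subst hr
    have hg : g = 0 := by linear_combination -h4
    subst hg
    refine ⟨rfl, h1, by linarith, rfl, ?_, ?_⟩
    · linear_combination 3 / 4 * h5
    · linear_combination -3 / 4 * h6 - 6 * τ * m * h1
  · rintro ⟨rfl, h1, rfl, rfl, h5, h6⟩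
    refine ⟨h1, rfl, by ring, by ring, ?_, ?_⟩
    · linear_combination 4 / 3 * h5
    · linear_combination -4 / 3 * h6 - 8 * τ * m * h1

theorem case3_iff (h : ReducedCoordinates c r τ m a b g X Y) :
    c.Case3 ↔ r = 3 ∧ c .α₂ = -c .β₂ ∧ a = b ∧ g = 0 ∧ X = 0 ∧ Y = 0 := by
  have hτ := h.τ_ne_zero
  rw [QPlus.Case3, h.X_eq, h.Y_eq, h.a₁_eq, h.a₂_eq, h.α₁_eq, h.β₁_eq, h.γ₁_eq, h.γ₂_eq]
  constructor
  · rintro ⟨h1, h2, h3, h4, h5, h6⟩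
    have hr : r = 3 := by
      apply mul_left_cancel₀ hτ
      linear_combination -h3
    subst hr
    have hg : g = 0 := by linear_combination -h4
    subst hg
    refine ⟨rfl, h1, by linarith, rfl, ?_, ?_⟩
    · linear_combination 3 / 2 * h5
    · linear_combination 3 / 2 * h6 - 6 * τ * m * h1
  · rintro ⟨rfl, h1, rfl, rfl, h5, h6⟩
    refine ⟨h1, rfl, by ring, by ring, ?_, ?_⟩
    · linear_combination 2 / 3 * h5
    · linear_combination 2 / 3 * h6 + 4 * τ * m * h1

/-- In Case 4 the coefficients α₁, β₁, γ₁, γ₂ are exactly those that a Möbius substitution creates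
from the linear part. -/
theorem case4_iff (h : ReducedCoordinates c r τ m a b g X Y) :
    c.Case4 ↔ a = 0 ∧ b = 0 ∧ g = 0 ∧ X = 0 ∧ Y = 0 := by
  have hτ := h.τ_ne_zero
  have hr := h.r_ne_zero
  have hm : r - 1 ≠ 0 := sub_ne_zero.2 h.r_ne_one
  have hp : r + 1 ≠ 0 := fun e => h.r_ne_neg_one (eq_neg_of_add_eq_zero_left e)
  rw [QPlus.Case4, h.X_eq, h.Y_eq, h.a₁_eq, h.a₂_eq, h.α₁_eq, h.β₁_eq, h.γ₁_eq, h.γ₂_eq]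
  constructor
  · rintro ⟨h1, h2, h3, h4, h5⟩
    have hg : g = 0 := by
      apply mul_left_cancel₀ hτ
      linear_combination 1 / 2 * h3
    subst hg
    refine ⟨?_, ?_, rfl, ?_, ?_⟩
    · apply mul_left_cancel₀ (mul_ne_zero hp hτ)
      linear_combination h1
    · apply mul_left_cancel₀ (mul_ne_zero hp hτ)
      linear_combination h2
    · apply mul_left_cancel₀ hm
      linear_combination r * h4
    · apply mul_left_cancel₀ hm
      linear_combination r * h5
  · rintro ⟨rfl, rfl, rfl, h4, h5⟩
    refine ⟨by ring, by ring, by ring, ?_, ?_⟩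
    · apply mul_left_cancel₀ hr
      linear_combination (r - 1) * h4
    · apply mul_left_cancel₀ hr
      linear_combination (r - 1) * h5

/-- Cases 5 and 6 are the branches B = rA and A = rB of the bilinear system, related by the exchange
of the lattice directions. -/
theorem case5_iff (h : ReducedCoordinates c r τ m a b g X Y) :
    c.Case5 ↔ c .β₂ = r * c .α₂ ∧ (r ^ 2 - 1) * a = 2 * r ^ 2 * g ∧
      (r ^ 2 - 1) * b = (r ^ 2 + 1) * g ∧ X = 0 ∧ Y = 2 * r * c .α₂ * g := by
  have hτ := h.τ_ne_zero
  have hr := h.r_ne_zero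
  rw [QPlus.Case5, h.X_eq, h.Y_eq, h.a₁_eq, h.a₂_eq, h.α₁_eq, h.β₁_eq, h.γ₁_eq, h.γ₂_eq]
  constructor
  · rintro ⟨h1, h2, h3, h4, h5⟩
    have hB : c .β₂ = r * c .α₂ := by
      apply mul_left_cancel₀ hτ
      linear_combination 1 / 2 * h1
    refine ⟨hB, ?_, ?_, ?_, ?_⟩
    · apply mul_left_cancel₀ (pow_ne_zero 3 hτ)
      linear_combination -1 / 4 * h2
    · apply mul_left_cancel₀ (pow_ne_zero 2 hτ)
      linear_combination 1 / 2 * h3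
    · linear_combination r / 2 * h4
    · apply mul_left_cancel₀ hτ
      linear_combination r / 4 * h5 - 2 * r * τ ^ 2 * m * hB
  · rintro ⟨h1, h2, h3, h4, h5⟩
    refine ⟨?_, ?_, ?_, ?_, ?_⟩
    · linear_combination 2 * τ * h1
    · linear_combination -4 * τ ^ 3 * h2
    · linear_combination 2 * τ ^ 2 * h3
    · apply mul_left_cancel₀ hr
      linear_combination 2 * h4
    · apply mul_left_cancel₀ hr
      linear_combination 4 * τ * h5 + 8 * r * τ ^ 2 * m * h1

theorem case6_iff (h : ReducedCoordinates c r τ m a b g X Y) :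
    c.Case6 ↔ c .α₂ = r * c .β₂ ∧ (r ^ 2 - 1) * a = (r ^ 2 + 1) * g ∧
      (r ^ 2 - 1) * b = 2 * r ^ 2 * g ∧ X = -2 * c .α₂ * g ∧ Y = 0 := by
  have hτ := h.τ_ne_zero
  have hr := h.r_ne_zero
  rw [QPlus.Case6, h.X_eq, h.Y_eq, h.a₁_eq, h.a₂_eq, h.α₁_eq, h.β₁_eq, h.γ₁_eq, h.γ₂_eq]
  constructor
  · rintro ⟨h1, h2, h3, h4, h5⟩
    have hB : c .α₂ = r * c .β₂ := by
      apply mul_left_cancel₀ hτ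
      linear_combination -1 / 2 * h1
    refine ⟨hB, ?_, ?_, ?_, ?_⟩
    · apply mul_left_cancel₀ (pow_ne_zero 2 hτ)
      linear_combination 1 / 2 * h2
    · apply mul_left_cancel₀ (pow_ne_zero 3 hτ)
      linear_combination -1 / 4 * h3
    · apply mul_left_cancel₀ hτ
      linear_combination 1 / 4 * h4
    · linear_combination 1 / 2 * h5 + 2 * τ * m * hB
  · rintro ⟨h1, h2, h3, h4, h5⟩
    refine ⟨?_, ?_, ?_, ?_, ?_⟩
    · linear_combination -2 * τ * h1
    · linear_combination 2 * τ ^ 2 * h2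
    · linear_combination -4 * τ ^ 3 * h3
    · linear_combination 4 * τ * h4
    · linear_combination 2 * h5 - 4 * τ * m * h1

/-- The numerator of `Im ρ₂` vanishes identically exactly for the six families. -/
theorem numeratorCoeff_eq_zero_iff_cases (h : ReducedCoordinates c r τ m a b g X Y) :
    (∀ i, numeratorCoeff r (c .α₂) (c .β₂) a b g X Y i = 0) ↔
      c.Case1 ∨ c.Case2 ∨ c.Case3 ∨ c.Case4 ∨ c.Case5 ∨ c.Case6 := by
  have hr := h.r_ne_zero
  have hr' : r ^ 2 - 1 ≠ 0 := by
    rw [show r ^ 2 - 1 = (r - 1) * (r + 1) by ring]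
    exact mul_ne_zero (sub_ne_zero.2 h.r_ne_one)
      (fun e => h.r_ne_neg_one (eq_neg_of_add_eq_zero_left e))
  rw [numeratorCoeff_eq_zero_iff hr, h.case1_iff, h.case2_iff, h.case3_iff, h.case4_iff,
    h.case5_iff, h.case6_iff]
  constructor
  · rintro ⟨hsys, hX, hY⟩
    rcases hsys.solutions hr h.r_ne_one h.r_ne_neg_one with
      ⟨hA, hB⟩ | ⟨ha, hb, hg⟩ | ⟨hB, ha, hb⟩ | ⟨hA, ha, hb⟩ | ⟨h3, hA, ha, hg⟩ | ⟨h3, hA, ha, hg⟩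
    · exact Or.inl ⟨hA, hB, by rw [hX, hA, zero_mul], by rw [hY, hB, zero_mul]⟩
    · exact Or.inr (Or.inr (Or.inr (Or.inl ⟨ha, hb, hg, by rw [hX, ha, hb, hg]; ring,
        by rw [hY, ha, hb, hg]; ring⟩)))
    · refine Or.inr (Or.inr (Or.inr (Or.inr (Or.inl ⟨hB, ha, hb, ?_, ?_⟩))))
      · apply mul_left_cancel₀ hr'
        linear_combination (r ^ 2 - 1) * hX + c .α₂ * ha - c .α₂ * hb
      · apply mul_left_cancel₀ hr'
        linear_combination (r ^ 2 - 1) * hY + c .β₂ * ha - c .β₂ * hb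
          + (2 * g * (r ^ 2 - 1)) * hB
    · refine Or.inr (Or.inr (Or.inr (Or.inr (Or.inr ⟨hA, ha, hb, ?_, ?_⟩))))
      · apply mul_left_cancel₀ hr'
        linear_combination (r ^ 2 - 1) * hX + c .α₂ * ha - c .α₂ * hb
      · apply mul_left_cancel₀ hr'
        linear_combination (r ^ 2 - 1) * hY + c .β₂ * ha - c .β₂ * hb
    · exact Or.inr (Or.inl ⟨h3, hA, ha, hg, by rw [hX, ha, hg]; ring, by rw [hY, ha, hg]; ring⟩)
    · exact Or.inr (Or.inr (Or.inl ⟨h3, hA, ha, hg, by rw [hX, ha, hg]; ring,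
        by rw [hY, ha, hg]; ring⟩))
  · rintro (⟨hA, hB, hX, hY⟩ | ⟨h3, hA, ha, hg, hX, hY⟩ | ⟨h3, hA, ha, hg, hX, hY⟩ |
      ⟨ha, hb, hg, hX, hY⟩ | ⟨hB, ha, hb, hX, hY⟩ | ⟨hA, ha, hb, hX, hY⟩)
    · rw [hA, hB, hX, hY]
      exact ⟨⟨by ring, by ring, by ring, by ring⟩, by ring, by ring⟩
    · rw [h3, hA, ha, hg, hX, hY]
      exact ⟨⟨by ring, by ring, by ring, by ring⟩, by ring, by ring⟩
    · rw [h3, hA, ha, hg, hX, hY]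
      exact ⟨⟨by ring, by ring, by ring, by ring⟩, by ring, by ring⟩
    · rw [ha, hb, hg, hX, hY]
      exact ⟨⟨by ring, by ring, by ring, by ring⟩, by ring, by ring⟩
    · rw [hB, hX, hY]
      -- The family fixes only (r² - 1)a and (r² - 1)b, so each equation is checked after
      -- multiplication by r² - 1.
      refine ⟨⟨?_, ?_, ?_, ?_⟩, ?_, ?_⟩ <;> apply mul_left_cancel₀ hr'
      · linear_combination (c .α₂ * (3 * r ^ 2 - 1)) * ha + (c .α₂ * (4 - 6 * r ^ 2)) * hb
      · linear_combination (c .α₂ * (3 - r ^ 4 + 4 * r ^ 2)) * ha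
          + (c .α₂ * (-5 * r ^ 2 - r ^ 4)) * hb
      · linear_combination (c .α₂ * r * (9 - 3 * r ^ 2)) * ha + (c .α₂ * r * (r ^ 4 - 7)) * hb
      · linear_combination (c .α₂ * r * 2) * ha + (c .α₂ * r * (r ^ 2 - 3)) * hb
      · linear_combination -c .α₂ * ha + c .α₂ * hb
      · linear_combination -r * c .α₂ * ha + r * c .α₂ * hb
    · rw [hX, hY, hA]
      refine ⟨⟨?_, ?_, ?_, ?_⟩, ?_, ?_⟩ <;> apply mul_left_cancel₀ hr'
      · linear_combination (c .β₂ * r * (3 - r ^ 2)) * ha + (c .β₂ * r * -2) * hb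
      · linear_combination (c .β₂ * r * (7 - r ^ 4)) * ha + (c .β₂ * r * (3 * r ^ 2 - 9)) * hb
      · linear_combination (c .β₂ * (5 * r ^ 2 + r ^ 4)) * ha
          + (c .β₂ * (r ^ 4 - 3 - 4 * r ^ 2)) * hb
      · linear_combination (c .β₂ * (6 * r ^ 2 - 4)) * ha + (c .β₂ * (1 - 3 * r ^ 2)) * hb
      · linear_combination -r * c .β₂ * ha + r * c .β₂ * hb
      · linear_combination -c .β₂ * ha + c .β₂ * hb

end ReducedCoordinates

theorem nlsNonlinearity_real_iff {ω : ℝ → ℝ} (hc : c.IsDispersive)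
    (hω : c.IsDispersionRelation ω) :
    (∀ κ, c.NonResonant ω κ → (c.nlsNonlinearity ω κ).im = 0) ↔
      c.Case1 ∨ c.Case2 ∨ c.Case3 ∨ c.Case4 ∨ c.Case5 ∨ c.Case6 := by
  obtain ⟨r, τ, m, a, b, g, X, Y, h⟩ := exists_reducedCoordinates hc
  rw [← h.numeratorCoeff_eq_zero_iff_cases]
  exact ⟨fun hreal => numeratorCoeff_eq_zero_of_real hc hω h hreal,
    fun h0 κ hκ => real_of_numeratorCoeff_eq_zero hc hω h h0 hκ⟩

end

section

/-! ### Restricted Möbius transformations -/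

/-- The coefficients of the Möbius image of an equation. -/
def mobius (C D : ℝ) (c : QPlus) : QPlus
  | .a₁ => D ^ 3 * c .a₁
  | .a₂ => D ^ 3 * c .a₂
  | .α₁ => D ^ 2 * (c .α₁ + C * (c .a₁ + c .a₂))
  | .α₂ => D ^ 2 * c .α₂
  | .β₁ => D ^ 2 * (c .β₁ + C * (c .a₁ + c .a₂))
  | .β₂ => D ^ 2 * c .β₂
  | .γ₁ => D ^ 2 * (c .γ₁ + 2 * C * c .a₁)
  | .γ₂ => D ^ 2 * (c .γ₂ + 2 * C * c .a₂)
  | .ξ₁ => D * (c .ξ₁ + C / 2 * (2 * (c .α₁ - c .α₂) + 2 * c .β₁ + c .γ₁ + c .γ₂)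
      + 3 / 2 * C ^ 2 * (c .a₁ + c .a₂))
  | .ξ₂ => D * (c .ξ₂ + C / 2 * (2 * (c .α₁ + c .α₂) + 2 * c .β₁ + c .γ₁ + c .γ₂)
      + 3 / 2 * C ^ 2 * (c .a₁ + c .a₂))
  | .ξ₃ => D * (c .ξ₃ + C / 2 * (2 * c .β₂ + c .γ₁ - c .γ₂) + C ^ 2 / 2 * (c .a₁ - c .a₂))
  | .ξ₄ => D * (c .ξ₄ + C / 2 * (-2 * c .β₂ + c .γ₁ - c .γ₂) + C ^ 2 / 2 * (c .a₁ - c .a₂))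
  | .ζ => c .ζ + 2 * C * (c .ξ₁ + c .ξ₂) + C ^ 2 * (2 * c .α₁ + 2 * c .β₁ + c .γ₁ + c .γ₂)
      + 2 * C ^ 3 * (c .a₁ + c .a₂)

variable {C D : ℝ} {c c' : QPlus}

/-- The four denominators are independent symbols here, so clearing them uses only multilinearity.
Inserting Cu + D afterwards leaves a polynomial identity. -/
theorem mul_lhs_div (c : QPlus) {x y z w p q s t : ℝ} (hp : p ≠ 0) (hq : q ≠ 0) (hs : s ≠ 0)
    (ht : t ≠ 0) :
    p * q * s * t * c.lhs (x / p) (y / q) (z / s) (w / t) =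
      c .a₁ * (x * (q * s * t) + w * (p * q * s)) + c .a₂ * (y * (p * s * t) + z * (p * q * t))
      + (c .α₁ - c .α₂) * (x * y * (s * t)) + (c .α₁ + c .α₂) * (z * w * (p * q))
      + (c .β₁ - c .β₂) * (x * z * (q * t)) + (c .β₁ + c .β₂) * (y * w * (p * s))
      + c .γ₁ * (x * w * (q * s)) + c .γ₂ * (y * z * (p * t))
      + (c .ξ₁ - c .ξ₃) * (x * y * z * t) + (c .ξ₁ + c .ξ₃) * (x * y * w * s)
      + (c .ξ₂ - c .ξ₄) * (y * z * w * p) + (c .ξ₂ + c .ξ₄) * (x * z * w * q)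
      + c .ζ * (x * y * z * w) := by
  obtain ⟨x, rfl⟩ : ∃ x', x = x' * p := ⟨x / p, by field_simp⟩
  obtain ⟨y, rfl⟩ : ∃ y', y = y' * q := ⟨y / q, by field_simp⟩
  obtain ⟨z, rfl⟩ : ∃ z', z = z' * s := ⟨z / s, by field_simp⟩
  obtain ⟨w, rfl⟩ : ∃ w', w = w' * t := ⟨w / t, by field_simp⟩
  simp only [QPlus.lhs, smul_eq_mul, mul_div_cancel_right₀ _ hp, mul_div_cancel_right₀ _ hq,
    mul_div_cancel_right₀ _ hs, mul_div_cancel_right₀ _ ht]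
  ring

theorem isMobiusImage_mobius (C D : ℝ) (c : QPlus) : IsMobiusImage C D c (mobius C D c) := by
  intro x y z w hx hy hz hw
  rw [mul_lhs_div c hx hy hz hw]
  simp only [QPlus.lhs, smul_eq_mul, mobius]
  ring

/-- Supplies the side of a cube whose vertices avoid the pole of the substitution. -/
theorem exists_ne_zero_of_affine (hD : D ≠ 0) : ∃ t : ℝ, t ≠ 0 ∧ C * t + D ≠ 0 := by
  by_cases h : C + D = 0
  · refine ⟨-1, by norm_num, fun h' => hD ?_⟩
    linarith
  · exact ⟨1, one_ne_zero, by rwa [mul_one]⟩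

/-- The coefficients are determined by the values of the equation at the points of a cube. -/
theorem QPlus.eq_of_lhs_eq {t : ℝ} (ht : t ≠ 0)
    (h : ∀ x ∈ ({0, t} : Set ℝ), ∀ y ∈ ({0, t} : Set ℝ), ∀ z ∈ ({0, t} : Set ℝ),
      ∀ w ∈ ({0, t} : Set ℝ), c.lhs x y z w = c'.lhs x y z w) : c = c' := by
  have m0 : (0 : ℝ) ∈ ({0, t} : Set ℝ) := by simp
  have m1 : t ∈ ({0, t} : Set ℝ) := by simp
  simp only [QPlus.lhs, smul_eq_mul] at h
  have t2 : t ^ 2 ≠ 0 := pow_ne_zero 2 ht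
  have t3 : t ^ 3 ≠ 0 := pow_ne_zero 3 ht
  -- The system is triangular: a vertex with k nonzero coordinates involves one coefficient of
  -- degree k, or sum or difference of two, besides terms of lower degree.
  have ha₁ : c .a₁ = c' .a₁ := by
    apply mul_left_cancel₀ ht
    linear_combination h t m1 0 m0 0 m0 0 m0
  have ha₂ : c .a₂ = c' .a₂ := by
    apply mul_left_cancel₀ ht
    linear_combination h 0 m0 t m1 0 m0 0 m0
  have q₁ : c .α₁ - c .α₂ = c' .α₁ - c' .α₂ := by
    apply mul_left_cancel₀ t2
    linear_combination h t m1 t m1 0 m0 0 m0 - t * ha₁ - t * ha₂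
  have q₂ : c .α₁ + c .α₂ = c' .α₁ + c' .α₂ := by
    apply mul_left_cancel₀ t2
    linear_combination h 0 m0 0 m0 t m1 t m1 - t * ha₁ - t * ha₂
  have q₃ : c .β₁ - c .β₂ = c' .β₁ - c' .β₂ := by
    apply mul_left_cancel₀ t2
    linear_combination h t m1 0 m0 t m1 0 m0 - t * ha₁ - t * ha₂
  have q₄ : c .β₁ + c .β₂ = c' .β₁ + c' .β₂ := by
    apply mul_left_cancel₀ t2
    linear_combination h 0 m0 t m1 0 m0 t m1 - t * ha₁ - t * ha₂
  have hγ₁ : c .γ₁ = c' .γ₁ := by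
    apply mul_left_cancel₀ t2
    linear_combination h t m1 0 m0 0 m0 t m1 - 2 * t * ha₁
  have hγ₂ : c .γ₂ = c' .γ₂ := by
    apply mul_left_cancel₀ t2
    linear_combination h 0 m0 t m1 t m1 0 m0 - 2 * t * ha₂
  have k₁ : c .ξ₁ - c .ξ₃ = c' .ξ₁ - c' .ξ₃ := by
    apply mul_left_cancel₀ t3
    linear_combination h t m1 t m1 t m1 0 m0 - t * ha₁ - 2 * t * ha₂ - t ^ 2 * (q₁ + q₃ + hγ₂)
  have k₂ : c .ξ₁ + c .ξ₃ = c' .ξ₁ + c' .ξ₃ := by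
    apply mul_left_cancel₀ t3
    linear_combination h t m1 t m1 0 m0 t m1 - 2 * t * ha₁ - t * ha₂ - t ^ 2 * (q₁ + q₄ + hγ₁)
  have k₃ : c .ξ₂ - c .ξ₄ = c' .ξ₂ - c' .ξ₄ := by
    apply mul_left_cancel₀ t3
    linear_combination h 0 m0 t m1 t m1 t m1 - t * ha₁ - 2 * t * ha₂ - t ^ 2 * (q₂ + q₄ + hγ₂)
  have k₄ : c .ξ₂ + c .ξ₄ = c' .ξ₂ + c' .ξ₄ := by
    apply mul_left_cancel₀ t3
    linear_combination h t m1 0 m0 t m1 t m1 - 2 * t * ha₁ - t * ha₂ - t ^ 2 * (q₂ + q₃ + hγ₁)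
  have hζ : c .ζ = c' .ζ := by
    apply mul_left_cancel₀ (pow_ne_zero 4 ht)
    linear_combination h t m1 t m1 t m1 t m1 - 2 * t * ha₁ - 2 * t * ha₂
      - t ^ 2 * (q₁ + q₂ + q₃ + q₄ + hγ₁ + hγ₂) - t ^ 3 * (k₁ + k₂ + k₃ + k₄)
  funext j
  cases j <;> linarith

theorem IsMobiusImage.eq_mobius (hD : D ≠ 0) (h : IsMobiusImage C D c c') :
    c' = mobius C D c := by
  obtain ⟨t, ht, htD⟩ := exists_ne_zero_of_affine (C := C) hD
  have key : ∀ x ∈ ({0, t} : Set ℝ), C * x + D ≠ 0 := by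
    rintro x (rfl | rfl)
    · simpa using hD
    · exact htD
  refine QPlus.eq_of_lhs_eq ht fun x hx y hy z hz w hw => ?_
  rw [h x y z w (key x hx) (key y hy) (key z hz) (key w hw),
    isMobiusImage_mobius C D c x y z w (key x hx) (key y hy) (key z hz) (key w hw)]

/-- The inverse of u ↦ u/(Cu + D) is u ↦ u/(-(C/D)u + 1/D), again of the restricted form. -/
theorem mobius_mobius_inv (hD : D ≠ 0) (c : QPlus) :
    mobius (-C / D) (1 / D) (mobius C D c) = c := by
  funext j
  cases j <;> simp only [mobius] <;> field_simp <;> ring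

theorem mobius_isDispersive (hD : D ≠ 0) (hc : c.IsDispersive) :
    (mobius C D c).IsDispersive := by
  have h3 : D ^ 3 ≠ 0 := pow_ne_zero 3 hD
  refine ⟨mul_ne_zero h3 hc.1, mul_ne_zero h3 hc.2.1, ?_⟩
  simp only [mobius, abs_mul]
  exact fun h => hc.2.2 (mul_left_cancel₀ (abs_ne_zero.2 h3) h)

/-- Each defining condition turns into a power of D times itself plus, in some cases, multiples of
earlier conditions of the same case. -/
theorem mobius_mem_family (hD : D ≠ 0) {i : Fin 6} (h : c ∈ family i) :
    mobius C D c ∈ family i := by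
  fin_cases i <;> obtain ⟨hc, h⟩ := h <;> refine ⟨mobius_isDispersive hD hc, ?_⟩
  · obtain ⟨h1, h2, h3, h4⟩ := h
    refine ⟨?_, ?_, ?_, ?_⟩ <;> simp only [mobius]
    · linear_combination D ^ 2 * h1
    · linear_combination D ^ 2 * h2
    · linear_combination D * h3 - 2 * C * D * h1
    · linear_combination D * h4 + 2 * C * D * h2
  · obtain ⟨h1, h2, h3, h4, h5, h6⟩ := h
    refine ⟨?_, ?_, ?_, ?_, ?_, ?_⟩ <;> simp only [mobius]
    · linear_combination D ^ 2 * h1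
    · linear_combination D ^ 2 * h2
    · linear_combination D ^ 3 * h3
    · linear_combination D ^ 2 * h4 + 2 * C * D ^ 2 * h3
    · linear_combination D ^ 4 * h5 - 2 * C * D ^ 4 * c .α₂ * h3
    · linear_combination D ^ 4 * h6 - 2 * C * D ^ 4 * c .α₂ * h3 + 2 * C * D ^ 4 * c .a₁ * h1
  · obtain ⟨h1, h2, h3, h4, h5, h6⟩ := h
    refine ⟨?_, ?_, ?_, ?_, ?_, ?_⟩ <;> simp only [mobius]
    · linear_combination D ^ 2 * h1
    · linear_combination D ^ 2 * h2
    · linear_combination D ^ 3 * h3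
    · linear_combination D ^ 2 * h4 + 2 * C * D ^ 2 * h3
    · linear_combination D ^ 4 * h5
    · linear_combination D ^ 4 * h6 + 2 * C * D ^ 4 * c .a₁ * h1
  · obtain ⟨h1, h2, h3, h4, h5⟩ := h
    refine ⟨?_, ?_, ?_, ?_, ?_⟩ <;> simp only [mobius]
    · linear_combination D ^ 5 * h1
    · linear_combination D ^ 5 * h2
    · linear_combination D ^ 5 * h3
    · linear_combination D ^ 4 * h4
    · linear_combination D ^ 4 * h5
  · obtain ⟨h1, h2, h3, h4, h5⟩ := h
    refine ⟨?_, ?_, ?_, ?_, ?_⟩ <;> simp only [mobius]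
    · linear_combination D ^ 5 * h1
    · linear_combination D ^ 11 * h2
    · linear_combination D ^ 8 * h3
    · linear_combination D ^ 4 * h4
    · linear_combination D ^ 7 * h5 + 2 * C * D ^ 7 * (c .a₂ - c .a₁) * h1
  · obtain ⟨h1, h2, h3, h4, h5⟩ := h
    refine ⟨?_, ?_, ?_, ?_, ?_⟩ <;> simp only [mobius]
    · linear_combination D ^ 5 * h1
    · linear_combination D ^ 8 * h2
    · linear_combination D ^ 11 * h3
    · linear_combination D ^ 7 * h4
    · linear_combination D ^ 4 * h5 + 2 * C * D ^ 4 * h1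

theorem mobius_mem_family_iff (hD : D ≠ 0) (i : Fin 6) :
    c ∈ family i ↔ mobius C D c ∈ family i := by
  refine ⟨mobius_mem_family hD, fun h => ?_⟩
  have := mobius_mem_family (C := -C / D) (one_div_ne_zero hD) h
  rwa [mobius_mobius_inv hD] at this

end

section

/-! ### Free parameters -/

theorem forall_param {P : Param → Prop} :
    (∀ j, P j) ↔ P .a₁ ∧ P .a₂ ∧ P .α₁ ∧ P .α₂ ∧ P .β₁ ∧ P .β₂ ∧ P .γ₁ ∧ P .γ₂ ∧ P .ξ₁ ∧
      P .ξ₂ ∧ P .ξ₃ ∧ P .ξ₄ ∧ P .ζ := by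
  refine ⟨fun h => ⟨h _, h _, h _, h _, h _, h _, h _, h _, h _, h _, h _, h _, h _⟩, ?_⟩
  rintro ⟨h1, h2, h3, h4, h5, h6, h7, h8, h9, h10, h11, h12, h13⟩ j
  cases j <;> assumption

/-- Extension of a partial list of coefficients by zero. -/
def extendByZero (J : Finset Param) (p : J → ℝ) : QPlus :=
  fun j => if h : j ∈ J then p ⟨j, h⟩ else 0

theorem contDiff_extendByZero (J : Finset Param) {n : WithTop ℕ∞} :
    ContDiff ℝ n (extendByZero J) := by
  refine contDiff_pi.2 fun j => ?_
  by_cases h : j ∈ J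
  · simpa only [extendByZero, h, dif_pos] using contDiff_apply ℝ ℝ (⟨j, h⟩ : J)
  · simpa only [extendByZero, h, dif_neg, not_false_iff] using contDiff_const

/-- A set of equations which is the fixed point set, within an open set, of a smooth map that
computes the coefficients outside `J` from those in `J` has `J.card` free parameters. -/
theorem hasFreeParameters_of_fixed {N : ℕ} (J : Finset Param) (hJ : J.card = N)
    (S V : Set QPlus) (G : QPlus → QPlus) (hV : IsOpen V) (hne : V.Nonempty) (hG : ContDiffOn ℝ ((⊤ : ℕ∞) : WithTop ℕ∞) G V)
    (hfix : ∀ c, ∀ j ∈ J, G c j = c j)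
    (hdep : ∀ c c' : QPlus, (∀ j ∈ J, c j = c' j) → G c = G c' ∧ (c ∈ V → c' ∈ V))
    (hS : ∀ c, c ∈ S ↔ c ∈ V ∧ G c = c) : HasFreeParameters S N := by
  have hr : ∀ (c : QPlus), ∀ j ∈ J, extendByZero J (fun j => c j) j = c j := by
    intro c j hj
    simp [extendByZero, hj]
  -- By `hdep`, membership in V and the value of G depend only on the coefficients in J, so the
  -- others may be set to zero.
  refine ⟨J, hJ, extendByZero J ⁻¹' V, hV.preimage (contDiff_extendByZero J (n := 0)).continuous,
    ?_, G ∘ extendByZero J, hG.comp (contDiff_extendByZero J).contDiffOn (fun _ h => h),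
    fun p _ j => ?_, ?_⟩
  · obtain ⟨c, hc⟩ := hne
    exact ⟨fun j => c j, (hdep c _ fun j hj => (hr c j hj).symm).2 hc⟩
  · rw [Function.comp_apply, hfix _ _ j.2]
    simp [extendByZero]
  · ext c
    rw [hS]
    constructor
    · rintro ⟨hc, hGc⟩
      refine ⟨fun j => c j, (hdep c _ fun j hj => (hr c j hj).symm).2 hc, ?_⟩
      rw [Function.comp_apply, (hdep _ c (hr c)).1, hGc]
    · rintro ⟨p, hp, rfl⟩
      have h := hdep (extendByZero J p) (G (extendByZero J p)) fun j hj => (hfix _ j hj).symm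
      exact ⟨h.2 hp, h.1.symm⟩

theorem isOpen_isDispersive : IsOpen {c : QPlus | c.IsDispersive} := by
  have h : ∀ j : Param, Continuous fun c : QPlus => c j := fun j => continuous_apply j
  exact (isOpen_ne_fun (h .a₁) continuous_const).inter
    ((isOpen_ne_fun (h .a₂) continuous_const).inter (isOpen_ne_fun (h .a₁).abs (h .a₂).abs))

theorem exists_isDispersive : {c : QPlus | c.IsDispersive}.Nonempty := by
  refine ⟨fun j => if j = .a₁ then 1 else 2, ?_⟩
  simp [QPlus.IsDispersive]

/-- The members of the first family as functions of their free coefficients. -/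
def fill₁ (c : QPlus) : QPlus
  | .α₂ => 0 | .β₂ => 0 | .ξ₁ => c .ξ₂ | .ξ₃ => c .ξ₄ | j => c j

/-- The members of the second family as functions of their free coefficients. -/
def fill₂ (c : QPlus) : QPlus
  | .a₁ => 2 * c .a₂ | .α₁ => c .β₁ | .β₂ => c .α₂ | .γ₁ => 2 * c .γ₂
  | .ξ₁ => c .ξ₂ - c .α₂ * c .γ₂ / c .a₂ | .ξ₃ => c .ξ₄ + c .α₂ * c .γ₂ / c .a₂ | j => c j

/-- The members of the third family as functions of their free coefficients. -/
def fill₃ (c : QPlus) : QPlus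
  | .a₂ => 2 * c .a₁ | .α₁ => c .β₁ | .β₂ => -c .α₂ | .γ₂ => 2 * c .γ₁
  | .ξ₁ => c .ξ₂ - c .α₂ * c .γ₁ / c .a₁ | .ξ₃ => c .ξ₄ - c .α₂ * c .γ₁ / c .a₁ | j => c j

/-- The members of the fourth family as functions of their free coefficients. -/
def fill₄ (c : QPlus) : QPlus
  | .α₁ => (c .a₁ + c .a₂) * c .γ₂ / (2 * c .a₂) | .β₁ => (c .a₁ + c .a₂) * c .γ₂ / (2 * c .a₂)
  | .γ₁ => c .a₁ * c .γ₂ / c .a₂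
  | .ξ₁ => c .ξ₂ - c .α₂ * c .γ₂ / c .a₂ | .ξ₃ => c .ξ₄ + c .β₂ * c .γ₂ / c .a₂ | j => c j

/-- The members of the fifth family as functions of their free coefficients. -/
def fill₅ (c : QPlus) : QPlus
  | .β₂ => (c .a₂ + c .a₁) * c .α₂ / (c .a₂ - c .a₁)
  | .α₁ => (c .a₁ + c .a₂) * (c .γ₂ * c .a₁ ^ 2 - c .γ₁ * c .a₂ ^ 2) /
      (2 * c .a₁ * c .a₂ * (c .a₁ - c .a₂))
  | .β₁ => (c .γ₁ * c .a₂ ^ 2 + c .γ₂ * c .a₁ ^ 2) / (2 * c .a₁ * c .a₂)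
  | .ξ₁ => c .ξ₂ + (c .γ₁ - c .γ₂) * c .α₂ / (c .a₂ - c .a₁)
  | .ξ₃ => c .ξ₄ + (c .γ₂ * (c .a₂ - 3 * c .a₁) - c .γ₁ * (c .a₁ - 3 * c .a₂)) * c .α₂ /
      (c .a₂ - c .a₁) ^ 2
  | j => c j

/-- The members of the sixth family as functions of their free coefficients. -/
def fill₆ (c : QPlus) : QPlus
  | .β₂ => (c .a₂ - c .a₁) * c .α₂ / (c .a₂ + c .a₁)
  | .α₁ => (c .γ₁ * c .a₂ ^ 2 + c .γ₂ * c .a₁ ^ 2) / (2 * c .a₁ * c .a₂)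
  | .β₁ => (c .a₁ + c .a₂) * (c .γ₂ * c .a₁ ^ 2 - c .γ₁ * c .a₂ ^ 2) /
      (2 * c .a₁ * c .a₂ * (c .a₁ - c .a₂))
  | .ξ₁ => c .ξ₂ + (c .γ₁ * (c .a₁ - 3 * c .a₂) - c .γ₂ * (c .a₂ - 3 * c .a₁)) * c .α₂ /
      (c .a₂ ^ 2 - c .a₁ ^ 2)
  | .ξ₃ => c .ξ₄ + (c .γ₂ - c .γ₁) * c .α₂ / (c .a₁ + c .a₂)
  | j => c j

theorem contDiffOn_fill {G : QPlus → QPlus} {V : Set QPlus}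
    (h : ∀ c ∈ V, ∀ j, ContDiffAt ℝ ((⊤ : ℕ∞) : WithTop ℕ∞) (fun c => G c j) c) :
    ContDiffOn ℝ ((⊤ : ℕ∞) : WithTop ℕ∞) G V := fun c hc =>
  (contDiffAt_pi.2 (h c hc)).contDiffWithinAt

theorem hasFreeParameters_family_zero : HasFreeParameters (family 0) 9 := by
  refine hasFreeParameters_of_fixed {.a₁, .a₂, .α₁, .β₁, .γ₁, .γ₂, .ξ₂, .ξ₄, .ζ} (by decide) _
    {c | c.IsDispersive} fill₁ isOpen_isDispersive exists_isDispersive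
    (contDiffOn_fill fun c hc j => ?_) (fun c j hj => ?_) (fun c c' h => ⟨?_, ?_⟩) fun c => ?_
  · cases j <;> simp only [fill₁] <;> fun_prop
  · revert hj; cases j <;> simp [fill₁]
  · rw [funext_iff, forall_param]; simp at h; simp [fill₁, h]
  · simp at h; simp [QPlus.IsDispersive, h]
  · rw [funext_iff, forall_param]
    change _ ∧ _ ↔ _ ∧ _
    simp only [fill₁, QPlus.Case1, true_and, and_true]
    refine and_congr_right fun hc => ?_
    grind

theorem ne_zero_of_dispersive {c : QPlus} (hc : c.IsDispersive) :
    c .a₁ ≠ 0 ∧ c .a₂ ≠ 0 ∧ c .a₂ - c .a₁ ≠ 0 ∧ c .a₁ - c .a₂ ≠ 0 ∧ c .a₂ + c .a₁ ≠ 0 ∧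
      c .a₁ + c .a₂ ≠ 0 ∧ c .a₂ ^ 2 - c .a₁ ^ 2 ≠ 0 := by
  have h1 := hc.add_ne_zero
  have h2 := hc.sub_ne_zero
  have h3 : c .a₂ - c .a₁ ≠ 0 := fun h => h2 (by linarith)
  have h4 : c .a₂ + c .a₁ ≠ 0 := fun h => h1 (by linarith)
  refine ⟨hc.1, hc.2.1, h3, h2, h4, h1, ?_⟩
  rw [show c .a₂ ^ 2 - c .a₁ ^ 2 = (c .a₂ - c .a₁) * (c .a₂ + c .a₁) by ring]
  exact mul_ne_zero h3 h4

theorem isOpen_ne_zero (j : Param) : IsOpen {c : QPlus | c j ≠ 0} :=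
  isOpen_ne_fun (continuous_apply j) continuous_const

theorem isDispersive_of_eq_two_mul {c : QPlus} (h2 : c .a₂ ≠ 0) (h : c .a₁ = 2 * c .a₂) :
    c.IsDispersive := by
  refine ⟨by rw [h]; exact mul_ne_zero two_ne_zero h2, h2, ?_⟩
  rw [h, abs_mul, abs_two]
  have := abs_pos.2 h2
  intro e
  linarith

theorem isDispersive_of_eq_two_mul' {c : QPlus} (h1 : c .a₁ ≠ 0) (h : c .a₂ = 2 * c .a₁) :
    c.IsDispersive := by
  refine ⟨h1, by rw [h]; exact mul_ne_zero two_ne_zero h1, ?_⟩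
  rw [h, abs_mul, abs_two]
  have := abs_pos.2 h1
  intro e
  linarith

theorem hasFreeParameters_family_one : HasFreeParameters (family 1) 7 := by
  refine hasFreeParameters_of_fixed {.a₂, .α₂, .β₁, .γ₂, .ξ₂, .ξ₄, .ζ} (by decide) _
    -- As a₁ is not free here, dispersivity cannot define the open set; it follows from a₂ ≠ 0 and
    -- a₁ = 2a₂.
    {c | c .a₂ ≠ 0} fill₂ (isOpen_ne_zero .a₂) ⟨fun _ => 1, one_ne_zero⟩
    (contDiffOn_fill fun c hc j => ?_) (fun c j hj => ?_) (fun c c' h => ⟨?_, ?_⟩) fun c => ?_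
  · rw [Set.mem_ofPred_eq] at hc
    cases j <;> simp only [fill₂] <;> fun_prop (disch := assumption)
  · revert hj; cases j <;> simp [fill₂]
  · rw [funext_iff, forall_param]; simp at h; simp [fill₂, h]
  · simp at h; simp [h]
  · rw [funext_iff, forall_param]
    change _ ∧ _ ↔ _ ∧ _
    simp only [fill₂, QPlus.Case2, true_and, and_true, Set.mem_ofPred_eq]
    constructor
    · rintro ⟨⟨h1, h2, -⟩, h3, h4, h5, h6, h7, h8⟩
      refine ⟨h2, h5.symm, h4.symm, h3, h6.symm, ?_, ?_⟩
      · rw [h5] at h7; field_simp; linear_combination -h7 / 2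
      · rw [h5] at h8; field_simp; linear_combination h8 / 2
    · rintro ⟨h2, h5, h4, h3, h6, h7, h8⟩
      refine ⟨isDispersive_of_eq_two_mul h2 h5.symm, h3, h4.symm, h5.symm, h6.symm, ?_, ?_⟩
      · rw [← h7, ← h5]; field_simp; ring
      · rw [← h8, ← h5]; field_simp; ring

theorem hasFreeParameters_family_two : HasFreeParameters (family 2) 7 := by
  refine hasFreeParameters_of_fixed {.a₁, .α₂, .β₁, .γ₁, .ξ₂, .ξ₄, .ζ} (by decide) _
    {c | c .a₁ ≠ 0} fill₃ (isOpen_ne_zero .a₁) ⟨fun _ => 1, one_ne_zero⟩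
    (contDiffOn_fill fun c hc j => ?_) (fun c j hj => ?_) (fun c c' h => ⟨?_, ?_⟩) fun c => ?_
  · rw [Set.mem_ofPred_eq] at hc
    cases j <;> simp only [fill₃] <;> fun_prop (disch := assumption)
  · revert hj; cases j <;> simp [fill₃]
  · rw [funext_iff, forall_param]; simp at h; simp [fill₃, h]
  · simp at h; simp [h]
  · rw [funext_iff, forall_param]
    change _ ∧ _ ↔ _ ∧ _
    simp only [fill₃, QPlus.Case3, true_and, and_true, Set.mem_ofPred_eq]
    constructor
    · rintro ⟨⟨h1, h2, -⟩, h3, h4, h5, h6, h7, h8⟩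
      refine ⟨h1, h5.symm, h4.symm, by linarith, h6.symm, ?_, ?_⟩
      · field_simp; linear_combination -h7
      · field_simp; linear_combination -h8
    · rintro ⟨h1, h5, h4, h3, h6, h7, h8⟩
      refine ⟨isDispersive_of_eq_two_mul' h1 h5.symm, by linarith, h4.symm, h5.symm, h6.symm,
        ?_, ?_⟩
      · rw [← h7]; field_simp; ring
      · rw [← h8]; field_simp; ring

theorem hasFreeParameters_family_three : HasFreeParameters (family 3) 8 := by
  refine hasFreeParameters_of_fixed {.a₁, .a₂, .α₂, .β₂, .γ₂, .ξ₂, .ξ₄, .ζ} (by decide) _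
    {c | c.IsDispersive} fill₄ isOpen_isDispersive exists_isDispersive
    (contDiffOn_fill fun c hc j => ?_) (fun c j hj => ?_) (fun c c' h => ⟨?_, ?_⟩) fun c => ?_
  · have h2 : c .a₂ ≠ 0 := hc.2.1
    have h2' : 2 * c .a₂ ≠ 0 := mul_ne_zero two_ne_zero h2
    cases j <;> simp only [fill₄] <;> fun_prop (disch := assumption)
  · revert hj; cases j <;> simp [fill₄]
  · rw [funext_iff, forall_param]; simp at h; simp [fill₄, h]
  · simp at h; simp [QPlus.IsDispersive, h]
  · rw [funext_iff, forall_param]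
    change _ ∧ _ ↔ _ ∧ _
    simp only [fill₄, QPlus.Case4, true_and, and_true, Set.mem_ofPred_eq]
    refine and_congr_right fun hc => ?_
    obtain ⟨n1, n2, -⟩ := hc
    constructor
    · rintro ⟨h1, h2, h3, h4, h5⟩
      refine ⟨?_, ?_, ?_, ?_, ?_⟩
      · field_simp; linear_combination -2 * h1
      · field_simp; linear_combination -2 * h2
      · field_simp; linear_combination -h3
      · field_simp
        -- The case uses γ₁/a₁ and the parametrization γ₂/a₂; they agree by a₂γ₁ = a₁γ₂.
        apply mul_left_cancel₀ n1
        linear_combination -c .a₂ * h4 + c .α₂ * h3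
      · field_simp
        apply mul_left_cancel₀ n1
        linear_combination -c .a₂ * h5 - c .β₂ * h3
    · rintro ⟨h1, h2, h3, h4, h5⟩
      refine ⟨?_, ?_, ?_, ?_, ?_⟩
      · rw [← h1]; field_simp
      · rw [← h2]; field_simp
      · rw [← h3]; field_simp
      · rw [← h4, ← h3]; field_simp; ring
      · rw [← h5, ← h3]; field_simp; ring

theorem hasFreeParameters_family_four : HasFreeParameters (family 4) 8 := by
  refine hasFreeParameters_of_fixed {.a₁, .a₂, .α₂, .γ₁, .γ₂, .ξ₂, .ξ₄, .ζ} (by decide) _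
    {c | c.IsDispersive} fill₅ isOpen_isDispersive exists_isDispersive
    (contDiffOn_fill fun c hc j => ?_) (fun c j hj => ?_) (fun c c' h => ⟨?_, ?_⟩) fun c => ?_
  · obtain ⟨n1, n2, n3, n4, n5, n6, n7⟩ := ne_zero_of_dispersive hc
    have n8 : 2 * c .a₁ * c .a₂ ≠ 0 := mul_ne_zero (mul_ne_zero two_ne_zero n1) n2
    have n9 : 2 * c .a₁ * c .a₂ * (c .a₁ - c .a₂) ≠ 0 := mul_ne_zero n8 n4
    have n10 : (c .a₂ - c .a₁) ^ 2 ≠ 0 := pow_ne_zero 2 n3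
    cases j <;> simp only [fill₅] <;> fun_prop (disch := assumption)
  · revert hj; cases j <;> simp [fill₅]
  · rw [funext_iff, forall_param]; simp at h; simp [fill₅, h]
  · simp at h; simp [QPlus.IsDispersive, h]
  · rw [funext_iff, forall_param]
    change _ ∧ _ ↔ _ ∧ _
    simp only [fill₅, QPlus.Case5, true_and, and_true, Set.mem_ofPred_eq]
    refine and_congr_right fun hc => ?_
    obtain ⟨n1, n2, n3, n4, n5, n6, n7⟩ := ne_zero_of_dispersive hc
    constructor
    · rintro ⟨h1, h2, h3, h4, h5⟩
      refine ⟨?_, ?_, ?_, ?_, ?_⟩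
      · rw [← h2]; field_simp
      · rw [← h3]; field_simp
      · rw [← h1]; field_simp
      · rw [← h4]; field_simp; ring
      · rw [← h5]; field_simp; ring
    · rintro ⟨h2, h3, h1, h4, h5⟩
      refine ⟨?_, ?_, ?_, ?_, ?_⟩
      · rw [← h1]; field_simp
      · rw [← h2]; field_simp
      · rw [← h3]; field_simp
      · rw [← h4]; field_simp; ring
      · rw [← h5]; field_simp; ring

theorem hasFreeParameters_family_five : HasFreeParameters (family 5) 8 := by
  refine hasFreeParameters_of_fixed {.a₁, .a₂, .α₂, .γ₁, .γ₂, .ξ₂, .ξ₄, .ζ} (by decide) _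
    {c | c.IsDispersive} fill₆ isOpen_isDispersive exists_isDispersive
    (contDiffOn_fill fun c hc j => ?_) (fun c j hj => ?_) (fun c c' h => ⟨?_, ?_⟩) fun c => ?_
  · obtain ⟨n1, n2, n3, n4, n5, n6, n7⟩ := ne_zero_of_dispersive hc
    have n8 : 2 * c .a₁ * c .a₂ ≠ 0 := mul_ne_zero (mul_ne_zero two_ne_zero n1) n2
    have n9 : 2 * c .a₁ * c .a₂ * (c .a₁ - c .a₂) ≠ 0 := mul_ne_zero n8 n4
    cases j <;> simp only [fill₆] <;> fun_prop (disch := assumption)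
  · revert hj; cases j <;> simp [fill₆]
  · rw [funext_iff, forall_param]; simp at h; simp [fill₆, h]
  · simp at h; simp [QPlus.IsDispersive, h]
  · rw [funext_iff, forall_param]
    change _ ∧ _ ↔ _ ∧ _
    simp only [fill₆, QPlus.Case6, true_and, and_true, Set.mem_ofPred_eq]
    refine and_congr_right fun hc => ?_
    obtain ⟨n1, n2, n3, n4, n5, n6, n7⟩ := ne_zero_of_dispersive hc
    constructor
    · rintro ⟨h1, h2, h3, h4, h5⟩
      refine ⟨?_, ?_, ?_, ?_, ?_⟩
      · rw [← h2]; field_simp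
      · rw [← h3]; field_simp
      · rw [← h1]; field_simp
      · rw [← h4]; field_simp; ring
      · rw [← h5]; field_simp; ring
    · rintro ⟨h2, h3, h1, h4, h5⟩
      refine ⟨?_, ?_, ?_, ?_, ?_⟩
      · rw [← h1]; field_simp
      · rw [← h2]; field_simp
      · rw [← h3]; field_simp
      · rw [← h4]; field_simp; ring
      · rw [← h5]; field_simp; ring

theorem hasFreeParameters_family (i : Fin 6) : HasFreeParameters (family i) (numFree i) := by
  fin_cases i
  · exact hasFreeParameters_family_zero
  · exact hasFreeParameters_family_one
  · exact hasFreeParameters_family_two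
  · exact hasFreeParameters_family_three
  · exact hasFreeParameters_family_four
  · exact hasFreeParameters_family_five

end

end Multiscale

end

/-! ### The main theorem -/

open Multiscale in
theorem mainTheorem1 :
    -- the order `ε³` of the expansion is an NLS equation, and its nonlinear coefficient is real
    -- for all wave numbers exactly for the equations in the six families
    (∀ c : QPlus, c.IsDispersive →
      (∃ ω, c.IsDispersionRelation ω) ∧
      ∀ ω, c.IsDispersionRelation ω →
        (∀ κ, c.NonResonant ω κ → ∃! ρ : ℂ × ℂ, c.ReducesToNLS ω κ ρ.1 ρ.2) ∧
        (∀ κ, c.NonResonant ω κ → ∀ ρ₁ ρ₂ : ℂ, c.ReducesToNLS ω κ ρ₁ ρ₂ →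
          ρ₁ = ((c .a₁ * c .a₂ * (c .a₁ ^ 2 - c .a₂ ^ 2) * Real.sin κ /
            (c .a₁ ^ 2 + c .a₂ ^ 2 + 2 * c .a₁ * c .a₂ * Real.cos κ) ^ 2 : ℝ) : ℂ) ∧
          -- bounded amplitudes: `u_2^{(1)}` depends on `ξ`, and `u_1^{(1)}` solves the NLS equation
          ∀ u : Amplitudes, u.Admissible → u.Bounded →
            (∀ α, c.W κ (ω κ) u 1 α = 0) → (∀ α, c.W κ (ω κ) u 2 α = 0) →
            c.W κ (ω κ) u 3 1 = 0 →
            (∃ ψ, HasProfile (deriv ω κ) (u 2 1) ψ) ∧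
            ∃ φ, HasProfile (deriv ω κ) (u 1 1) φ ∧ ∀ x t, nls ρ₁ ρ₂ φ x t = 0) ∧
        ((∀ κ, c.NonResonant ω κ → ∀ ρ₁ ρ₂ : ℂ, c.ReducesToNLS ω κ ρ₁ ρ₂ → ρ₂.im = 0) ↔
          c.Case1 ∨ c.Case2 ∨ c.Case3 ∨ c.Case4 ∨ c.Case5 ∨ c.Case6)) ∧
    -- numbers of free parameters
    (∀ i, HasFreeParameters (family i) (numFree i)) ∧
    -- invariance under the restricted Möbius transformations
    (∀ C D : ℝ, D ≠ 0 →
      (∀ c : QPlus, ∃! c' : QPlus, IsMobiusImage C D c c') ∧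
      ∀ c c' : QPlus, IsMobiusImage C D c c' → ∀ i, c ∈ family i ↔ c' ∈ family i) := by
  refine ⟨fun c hc => ⟨exists_dispersionRelation hc, fun ω hω => ⟨fun κ hκ => ?_,
    fun κ hκ ρ₁ ρ₂ hρ => ?_, ?_⟩⟩, hasFreeParameters_family,
    fun C D hD => ⟨fun c => ⟨mobius C D c, isMobiusImage_mobius C D c,
      fun c' h => h.eq_mobius hD⟩, fun c c' h i => ?_⟩⟩
  · refine ⟨(c.nlsDispersion ω κ, c.nlsNonlinearity ω κ),
      reducesToNLS_nlsDispersion_nlsNonlinearity hc hω hκ, fun ρ hρ => ?_⟩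
    obtain ⟨h1, h2⟩ := reducesToNLS_unique hc hω hκ hρ
      (reducesToNLS_nlsDispersion_nlsNonlinearity hc hω hκ)
    exact Prod.ext h1 h2
  · obtain ⟨rfl, rfl⟩ := reducesToNLS_unique hc hω hκ hρ
      (reducesToNLS_nlsDispersion_nlsNonlinearity hc hω hκ)
    exact ⟨nlsDispersion_eq hc hω, fun u hu hb h1 h2 h3 =>
      hasProfile_of_bounded hc hω hκ hu hb h1 h2 h3⟩
  -- By uniqueness, a statement about every admissible pair (ρ₁, ρ₂) is a statement about the
  -- computed one.
  · rw [← nlsNonlinearity_real_iff hc hω]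
    refine forall₂_congr fun κ hκ => ⟨fun h => h _ _
      (reducesToNLS_nlsDispersion_nlsNonlinearity hc hω hκ), fun h ρ₁ ρ₂ hρ => ?_⟩
    rw [(reducesToNLS_unique hc hω hκ hρ
      (reducesToNLS_nlsDispersion_nlsNonlinearity hc hω hκ)).2]
    exact h
  · rw [h.eq_mobius hD]
    exact mobius_mem_family_iff hD i
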